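/- For $n\ge 1$ let $\mathrm{OPol}_n=\mathbb Z\langle x_1,\dots,x_n\rangle/(x_ix_j+x_jx_i : i\ne j)$. Let $\partial_i:\mathrm{OPol}_n\to\mathrm{OPol}_n$ ($1\le i\le n-1$) be the odd divided difference operators: the additive maps with $\partial_i(x_j)=1$ if $j\in\{i,i+1\}$, $\partial_i(x_j)=0$ otherwise, and $\partial_i(fg)=\partial_i(f)g+s_i(f)\partial_i(g)$, where $s_i$ is the ring endomorphism with $s_i(x_i)=-x_{i+1}$, $s_i(x_{i+1})=-x_i$ and $s_i(x_j)=-x_j$ for $j\ne i,i+1$. Let $\mathrm{O}\Lambda_n=\bigcap_i\ker\partial_i$, and let $\mathrm{O}\Lambda=\varprojlim \mathrm{O}\Lambda_n$ be the inverse limit in graded rings along the maps $x_{n+1}\mapsto 0$ (the ring of odd symmetric functions). For a partition $\lambda$ (identified with its Young diagram) let $N(\lambda)$ be the sum over all boxes $B$ of $\lambda$ of the number of boxes of $\lambda$ in rows strictly above $B$, and let $dN(\lambda)$ be the sum over all boxes $B$ of the number of boxes directly above $B$ in its column. The row word $w_r(T)$ of a (skew) tableau $T$ is obtained by reading its entries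 left to right in each row, rows from bottom to top. Put $\widetilde x_i=(-1)^{i-1}x_i$ and $\widetilde x^{\,w}=\widetilde x_{w_1}\cdots\widetilde x_{w_r}$ for a word $w=w_1\cdots w_r$. The odd Schur function $s_\lambda$ is the family, indexed by $n$, of the elements $$s_\lambda=(-1)^{dN(\lambda)+N(\lambda)}\sum_{T}\widetilde x^{\,w_r(T)}\in\mathrm{OPol}_n ,$$ where $T$ runs over the semistandard Young tableaux of shape $\lambda$ with entries in $\{1,\dots,n\}$. A semistandard skew tableau $S$ of shape $\lambda/\mu$ (with $\mu\subseteq\lambda$) is a filling of the boxes of $\lambda$ outside $\mu$ by positive integers, weakly increasing along rows and strictly increasing down columns; it has content $\nu$ if exactly $\nu_k$ entries equal $k$ for every $k\ge1$. Let $\widehat S$ be the filling of $\lambda$ that extends $S$ by $0$ on $\mu$, and let $N^<(S)$ be the sum over all boxes $B$ of $\lambda$ of the number of boxes of $\lambda$ in rows strictly above $B$ whose entry in $\widehat S$ is strictly smaller than that of $B$. A word in the positive integers is Yamanouchi if each of its final segments contains at least as many $a$'s as $b$'s whenever $a<b$. **Theorem (odd Littlewood–Richardson rule).** The odd Schur functions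 $s_\lambda$, for $\lambda$ ranging over all partitions, form a $\mathbb Z$-basis of $\mathrm{O}\Lambda$. For all partitions $\mu,\nu,\lambda$, the odd Littlewood–Richardson coefficient $c_{\mu\nu}^\lambda$, i.e. the coefficient of $s_\lambda$ in the expansion of $s_\mu s_\nu$ in this basis, is $$c_{\mu\nu}^\lambda=(-1)^{N(\mu)+N(\lambda)}\sum_{S}(-1)^{N^<(S)},$$ where $S$ runs over all semistandard skew tableaux of shape $\lambda/\mu$ and content $\nu$ whose row word is Yamanouchi (the sum is $0$ if there are none, in particular if $\mu\not\subseteq\lambda$). -/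

import Mathlib

/-! ### Skew polynomials -/

/-- The defining relations `x_i x_j + x_j x_i = 0` for `i ≠ j`. -/
inductive OPolRel (n : ℕ) : FreeAlgebra ℤ (Fin n) → FreeAlgebra ℤ (Fin n) → Prop
  | anticomm (i j : Fin n) (h : i ≠ j) :
      OPolRel n (FreeAlgebra.ι ℤ i * FreeAlgebra.ι ℤ j + FreeAlgebra.ι ℤ j * FreeAlgebra.ι ℤ i) 0

/-- The ring `OPol_n = ℤ⟨x_1, …, x_n⟩ / (x_i x_j + x_j x_i : i ≠ j)` of skew polynomials.
The variables are indexed from `0`: the element `OPol.x i` is the variable `x_{i+1}`. -/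
def OPol (n : ℕ) : Type := RingQuot (OPolRel n)

namespace OPol

noncomputable instance instRing (n : ℕ) : Ring (OPol n) :=
  inferInstanceAs (Ring (RingQuot (OPolRel n)))

/-- The quotient map from the free ring. -/
noncomputable def mk (n : ℕ) : FreeAlgebra ℤ (Fin n) →+* OPol n := RingQuot.mkRingHom (OPolRel n)

/-- The variables. -/
noncomputable def x {n : ℕ} (i : Fin n) : OPol n := mk n (FreeAlgebra.ι ℤ i)

theorem x_anticomm {n : ℕ} (i j : Fin n) (h : i ≠ j) : x i * x j + x j * x i = 0 := by
  have := RingQuot.mkRingHom_rel (OPolRel.anticomm i j h)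
  rw [map_add, map_mul, map_mul, map_zero] at this
  exact this

/-- The universal property of `OPol_n`: pairwise anticommuting elements of a ring `R` define a
ring homomorphism `OPol_n → R`. -/
noncomputable def lift {n : ℕ} {R : Type} [Ring R] (y : Fin n → R)
    (hy : ∀ i j, i ≠ j → y i * y j + y j * y i = 0) : OPol n →+* R :=
  RingQuot.lift ⟨(FreeAlgebra.lift ℤ y).toRingHom, by
    rintro _ _ ⟨i, j, h⟩
    simpa using hy i j h⟩

theorem lift_x {n : ℕ} {R : Type} [Ring R] (y : Fin n → R)
    (hy : ∀ i j, i ≠ j → y i * y j + y j * y i = 0) (i : Fin n) : lift y hy (x i) = y i := by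
  have := RingQuot.lift_mkRingHom_apply (r := OPolRel n) (FreeAlgebra.lift ℤ y).toRingHom
    (by rintro _ _ ⟨i, j, h⟩; simpa using hy i j h) (FreeAlgebra.ι ℤ i)
  refine this.trans ?_
  simp

/-- For variables `p`, `q`, the ring homomorphism `f ↦ !![s f, ∂ f; 0, f]`, where `s` is the signed
transposition `x_j ↦ -x_{σ j}`, `σ = (p q)`, and `∂` is the odd divided difference operator.
Multiplicativity of this map is the Leibniz rule `∂(f g) = ∂(f) g + s(f) ∂(g)`. -/
noncomputable def divDiffMatrix {n : ℕ} (p q : Fin n) :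
    OPol n →+* Matrix (Fin 2) (Fin 2) (OPol n) :=
  lift (fun j => !![-x (Equiv.swap p q j), if j = p ∨ j = q then 1 else 0; 0, x j]) (by
    intro i j h
    have h1 := x_anticomm i j h
    have h2 := x_anticomm (Equiv.swap p q i) (Equiv.swap p q j) (fun e => h (Equiv.injective _ e))
    ext a b
    fin_cases a <;> fin_cases b
    · by_cases hi : i = p ∨ i = q <;> by_cases hj : j = p ∨ j = q <;>
        simpa [Matrix.mul_apply, Fin.sum_univ_two, hi, hj] using h2
    · by_cases hip : i = p <;> by_cases hiq : i = q <;> by_cases hjp : j = p <;>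
        by_cases hjq : j = q <;>
        simp_all [Equiv.swap_apply_of_ne_of_ne]
    · simp
    · simpa [Matrix.mul_apply, Fin.sum_univ_two] using h1)

/-- The odd divided difference operator attached to the variables `p`, `q`.  For neighbouring
variables `x_i`, `x_{i+1}` it is the operator `∂_i`; see `divDiff_x` and `divDiff_mul`. -/
noncomputable def divDiff {n : ℕ} (p q : Fin n) (f : OPol n) : OPol n := divDiffMatrix p q f 0 1

/-- The signed action of the transposition `(p q)`; see `signedSwap_x`. -/
noncomputable def signedSwap {n : ℕ} (p q : Fin n) (f : OPol n) : OPol n := divDiffMatrix p q f 0 0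

theorem divDiff_x {n : ℕ} (p q j : Fin n) :
    divDiff p q (x j) = if j = p ∨ j = q then 1 else 0 := by
  simp [divDiff, divDiffMatrix, lift_x]

theorem signedSwap_x {n : ℕ} (p q j : Fin n) :
    signedSwap p q (x j) = -x (Equiv.swap p q j) := by
  simp [signedSwap, divDiffMatrix, lift_x]

theorem divDiff_add {n : ℕ} (p q : Fin n) (f g : OPol n) :
    divDiff p q (f + g) = divDiff p q f + divDiff p q g := by
  simp [divDiff]

theorem divDiff_neg {n : ℕ} (p q : Fin n) (f : OPol n) :
    divDiff p q (-f) = -divDiff p q f := by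
  simp [divDiff]

theorem divDiff_zero {n : ℕ} (p q : Fin n) : divDiff p q (0 : OPol n) = 0 := by
  simp [divDiff]

theorem divDiff_one {n : ℕ} (p q : Fin n) : divDiff p q (1 : OPol n) = 0 := by
  simp [divDiff]

/-- Induction on skew polynomials. -/
theorem induction_on {n : ℕ} {P : OPol n → Prop} (hz : ∀ k : ℤ, P k) (hx : ∀ i, P (x i))
    (ha : ∀ f g, P f → P g → P (f + g)) (hm : ∀ f g, P f → P g → P (f * g)) (f : OPol n) : P f := by
  obtain ⟨f, rfl⟩ := RingQuot.mkRingHom_surjective (OPolRel n) f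
  change P (mk n f)
  induction f using FreeAlgebra.induction with
  | grade0 r => simpa using hz r
  | grade1 i => exact hx i
  | mul a b h1 h2 => rw [map_mul]; exact hm _ _ h1 h2
  | add a b h1 h2 => rw [map_add]; exact ha _ _ h1 h2

theorem divDiffMatrix_one_zero {n : ℕ} (p q : Fin n) (f : OPol n) : divDiffMatrix p q f 1 0 = 0 := by
  induction f using induction_on with
  | hz k => simp [Matrix.intCast_apply]
  | hx i => simp [divDiffMatrix, lift_x]
  | ha f g h1 h2 => simp [h1, h2]
  | hm f g h1 h2 => simp [Matrix.mul_apply, Fin.sum_univ_two, h1, h2]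

theorem divDiffMatrix_one_one {n : ℕ} (p q : Fin n) (f : OPol n) : divDiffMatrix p q f 1 1 = f := by
  induction f using induction_on with
  | hz k => simp [Matrix.intCast_apply]
  | hx i => simp [divDiffMatrix, lift_x]
  | ha f g h1 h2 => simp [h1, h2]
  | hm f g h1 h2 => simp [Matrix.mul_apply, Fin.sum_univ_two, h1, h2, divDiffMatrix_one_zero]

/-- The Leibniz rule. -/
theorem divDiff_mul {n : ℕ} (p q : Fin n) (f g : OPol n) :
    divDiff p q (f * g) = divDiff p q f * g + signedSwap p q f * divDiff p q g := by
  simp [divDiff, signedSwap, Matrix.mul_apply, Fin.sum_univ_two, divDiffMatrix_one_one, add_comm]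

/-- The ring `OΛ_n` of odd symmetric polynomials: the common kernel of the `∂_i`. -/
noncomputable def oddSymm (n : ℕ) : Subring (OPol n) where
  carrier := {f | ∀ (i : ℕ) (h : i + 1 < n), divDiff ⟨i, by omega⟩ ⟨i + 1, h⟩ f = 0}
  mul_mem' hf hg i h := by rw [divDiff_mul, hf i h, hg i h, zero_mul, mul_zero, add_zero]
  one_mem' i h := divDiff_one _ _
  add_mem' hf hg i h := by rw [divDiff_add, hf i h, hg i h, add_zero]
  zero_mem' i h := divDiff_zero _ _
  neg_mem' hf i h := by rw [divDiff_neg, hf i h, neg_zero]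

/-- The map `OPol_{n+1} → OPol_n` that sends the last variable to `0` and fixes the others. -/
noncomputable def proj (n : ℕ) : OPol (n + 1) →+* OPol n :=
  lift (fun i => if h : (i : ℕ) < n then x ⟨i, h⟩ else 0) (by
    intro i j hij
    by_cases hi : (i : ℕ) < n <;> by_cases hj : (j : ℕ) < n <;> simp only [hi, hj, dif_pos, dif_neg,
      not_false_eq_true, mul_zero, zero_mul, add_zero]
    exact x_anticomm _ _ (fun e => hij (Fin.ext (by simpa using e))))

/-- The additive group of skew polynomials of polynomial degree at most `d`. -/
noncomputable def degLE (n d : ℕ) : AddSubgroup (OPol n) :=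
  AddSubgroup.closure {f | ∃ l : List (Fin n), l.length ≤ d ∧ (l.map x).prod = f}

theorem degLE_mono (n : ℕ) {d e : ℕ} (h : d ≤ e) : degLE n d ≤ degLE n e :=
  AddSubgroup.closure_mono (fun _ ⟨l, hl, hf⟩ => ⟨l, hl.trans h, hf⟩)

theorem mul_mem_degLE {n d e : ℕ} {f g : OPol n} (hf : f ∈ degLE n d) (hg : g ∈ degLE n e) :
    f * g ∈ degLE n (d + e) := by
  induction hf using AddSubgroup.closure_induction with
  | mem f hf =>
    obtain ⟨l, hl, rfl⟩ := hf
    induction hg using AddSubgroup.closure_induction with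
    | mem g hg =>
      obtain ⟨m, hm, rfl⟩ := hg
      exact AddSubgroup.subset_closure ⟨l ++ m, by simp; omega, by simp⟩
    | zero => rw [mul_zero]; exact zero_mem _
    | add g g' _ _ h1 h2 => rw [mul_add]; exact add_mem h1 h2
    | neg g _ h => rw [mul_neg]; exact neg_mem h
  | zero => rw [zero_mul]; exact zero_mem _
  | add f f' _ _ h1 h2 => rw [add_mul]; exact add_mem h1 h2
  | neg f _ h => rw [neg_mul]; exact neg_mem h

theorem one_mem_degLE (n d : ℕ) : (1 : OPol n) ∈ degLE n d :=
  AddSubgroup.subset_closure ⟨[], by simp, by simp⟩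

/-- The element `x̃_i = (-1)^{i-1} x_i`.  With indices from `0` the sign is `(-1)^i`.  The index is
allowed to be any natural number, and the value is `0` when there is no such variable. -/
noncomputable def xt (n : ℕ) (i : ℕ) : OPol n :=
  if h : i < n then (-1) ^ i * x ⟨i, h⟩ else 0

end OPol

/-- The ring `OΛ` of odd symmetric functions: the inverse limit of the rings `OΛ_n` in the category
of graded rings, that is, the ring of all compatible families of odd symmetric polynomials
`f_n ∈ OΛ_n` whose degrees are bounded. -/
noncomputable def OddSymm : Subring (∀ n : ℕ, OPol n) where
  carrier := {f | (∀ n, f n ∈ OPol.oddSymm n) ∧ (∀ n, OPol.proj n (f (n + 1)) = f n) ∧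
    ∃ d, ∀ n, f n ∈ OPol.degLE n d}
  mul_mem' := by
    rintro f g ⟨hf, hf', d, hd⟩ ⟨hg, hg', e, he⟩
    exact ⟨fun n => mul_mem (hf n) (hg n), fun n => by simp [hf', hg'], d + e,
      fun n => OPol.mul_mem_degLE (hd n) (he n)⟩
  one_mem' := ⟨fun n => one_mem _, fun n => by simp, 0, fun n => OPol.one_mem_degLE n 0⟩
  add_mem' := by
    rintro f g ⟨hf, hf', d, hd⟩ ⟨hg, hg', e, he⟩
    exact ⟨fun n => add_mem (hf n) (hg n), fun n => by simp [hf', hg'], max d e, fun n =>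
      add_mem (OPol.degLE_mono n (le_max_left d e) (hd n))
        (OPol.degLE_mono n (le_max_right d e) (he n))⟩
  zero_mem' := ⟨fun n => zero_mem _, fun n => by simp, 0, fun n => zero_mem _⟩
  neg_mem' := by
    rintro f ⟨hf, hf', d, hd⟩
    exact ⟨fun n => neg_mem (hf n), fun n => by simp [hf'], d, fun n => neg_mem (hd n)⟩

/-! ### Box counts and row words

The cell `(i, j)` of a Young diagram lies in row `i` (counted from the top) and column `j`
(counted from the left), both counted from `0`. -/

/-- `N(λ)`: the sum over all boxes `c` of the number of boxes in rows above that of `c`. -/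
def boxN (lam : YoungDiagram) : ℕ :=
  ∑ c ∈ lam.cells, (lam.cells.filter fun d => d.1 < c.1).card

/-- `dN(λ)`: the sum over all boxes `c` of the number of boxes directly above `c`. -/
def boxdN (lam : YoungDiagram) : ℕ :=
  ∑ c ∈ lam.cells, (lam.cells.filter fun d => d.1 < c.1 ∧ d.2 = c.2).card

/-- `N^<(T)` for a filling `T` of the boxes of `λ`: the sum over all boxes `c` of the number of
boxes in rows above that of `c` with entry smaller than that of `c`. -/
def boxNLess (lam : YoungDiagram) (T : ℕ → ℕ → ℕ) : ℕ :=
  ∑ c ∈ lam.cells, (lam.cells.filter fun d => d.1 < c.1 ∧ T d.1 d.2 < T c.1 c.2).card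

/-- The row word of a filling `T` of the boxes of `λ/μ`: the entries are read from left to right in
each row, and the rows are read from bottom to top. -/
def rowWord (lam mu : YoungDiagram) (T : ℕ → ℕ → ℕ) : List ℕ :=
  (List.range (lam.colLen 0)).reverse.flatMap fun i =>
    ((List.range (lam.rowLen i)).filter fun j => (i, j) ∉ mu).map fun j => T i j

/-! ### Odd Schur functions -/

/-- `SSYT(λ)` for the alphabet of size `n`, which is `{0, …, n-1}` here: entries and variables are
both indexed from `0`. -/
def BoundedSSYT (lam : YoungDiagram) (n : ℕ) : Type :=
  {T : SemistandardYoungTableau lam // ∀ i j, (i, j) ∈ lam → T i j < n}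

instance BoundedSSYT.instFinite (lam : YoungDiagram) (n : ℕ) : Finite (BoundedSSYT lam n) := by
  refine Finite.of_injective
    (fun T : BoundedSSYT lam n => fun c : lam.cells =>
      (⟨T.1 c.1.1 c.1.2, T.2 _ _ c.2⟩ : Fin n)) ?_
  intro T T' h
  apply Subtype.ext
  ext i j
  by_cases hc : (i, j) ∈ lam
  · have := congrFun h ⟨(i, j), hc⟩
    simpa using this
  · rw [T.1.zeros hc, T'.1.zeros hc]

noncomputable instance BoundedSSYT.instFintype (lam : YoungDiagram) (n : ℕ) :
    Fintype (BoundedSSYT lam n) := Fintype.ofFinite _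

/-- The odd Schur polynomial `s_λ = (-1)^{dN(λ)+N(λ)} ∑_T x̃^{w_r(T)}` in `n` variables. -/
noncomputable def oddSchurPol (lam : YoungDiagram) (n : ℕ) : OPol n :=
  (-1) ^ (boxdN lam + boxN lam) *
    ∑ T : BoundedSSYT lam n, ((rowWord lam ⊥ fun i j => T.1 i j).map (OPol.xt n)).prod

/-! ### Skew tableaux -/

/-- A semistandard skew tableau of shape `λ/μ` (where `μ ⊆ λ`) with positive integer entries.  The
function `entry` is extended by `0` to the boxes of `μ` and outside `λ`; on the boxes of `λ` it is
then the filling `Ŝ` obtained from `S` by placing in each box of `μ` a letter smaller than every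
entry of `S`. -/
structure SkewSSYT (lam mu : YoungDiagram) where
  entry : ℕ → ℕ → ℕ
  sub : mu ≤ lam
  pos : ∀ {i j : ℕ}, (i, j) ∈ lam → (i, j) ∉ mu → 0 < entry i j
  zeros : ∀ {i j : ℕ}, (i, j) ∉ lam ∨ (i, j) ∈ mu → entry i j = 0
  row_weak : ∀ {i j₁ j₂ : ℕ}, j₁ < j₂ → (i, j₂) ∈ lam → (i, j₁) ∉ mu → entry i j₁ ≤ entry i j₂
  col_strict : ∀ {i₁ i₂ j : ℕ}, i₁ < i₂ → (i₂, j) ∈ lam → (i₁, j) ∉ mu → entry i₁ j < entry i₂ j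

/-- `S` has content `ν`: for each `k ≥ 1`, exactly `ν_k` boxes have entry `k`. -/
def SkewSSYT.HasContent {lam mu : YoungDiagram} (S : SkewSSYT lam mu) (nu : YoungDiagram) : Prop :=
  ∀ k : ℕ, ((lam.cells \ mu.cells).filter fun c => S.entry c.1 c.2 = k + 1).card = nu.rowLen k

/-- A word in the positive integers is Yamanouchi if each of its final segments contains at least as
many letters `a` as letters `b` whenever `a < b`. -/
def IsYamanouchi (w : List ℕ) : Prop :=
  ∀ u : List ℕ, u <:+ w → ∀ a b : ℕ, 0 < a → a < b → u.count b ≤ u.count a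

/-- Semistandard skew tableaux of shape `λ/μ` and content `ν` whose row word is Yamanouchi. -/
def LRTableau (lam mu nu : YoungDiagram) : Type :=
  {S : SkewSSYT lam mu // S.HasContent nu ∧ IsYamanouchi (rowWord lam mu S.entry)}

instance LRTableau.instFinite (lam mu nu : YoungDiagram) : Finite (LRTableau lam mu nu) := by
  have hb : ∀ (S : LRTableau lam mu nu) (i j : ℕ), S.1.entry i j < nu.colLen 0 + 1 := by
    intro S i j
    by_cases hc : (i, j) ∉ lam ∨ (i, j) ∈ mu
    · rw [S.1.zeros hc]; omega
    · push Not at hc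
      obtain ⟨k, hk⟩ : ∃ k, S.1.entry i j = k + 1 :=
        ⟨S.1.entry i j - 1, by have := S.1.pos hc.1 hc.2; omega⟩
      have h1 := S.2.1 k
      have h2 : 0 < nu.rowLen k := by
        rw [← h1, Finset.card_pos]
        exact ⟨(i, j), by simp [hc.1, hc.2, hk]⟩
      have h3 : k < nu.colLen 0 :=
        YoungDiagram.mem_iff_lt_colLen.1 (YoungDiagram.mem_iff_lt_rowLen.2 h2)
      omega
  refine Finite.of_injective
    (fun S : LRTableau lam mu nu => fun c : lam.cells =>
      (⟨S.1.entry c.1.1 c.1.2, hb S _ _⟩ : Fin (nu.colLen 0 + 1))) ?_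
  rintro ⟨⟨e, _, _, hz, _, _⟩, _⟩ ⟨⟨e', _, _, hz', _, _⟩, _⟩ h
  have : e = e' := by
    funext i j
    by_cases hc : (i, j) ∈ lam
    · have := congrFun h ⟨(i, j), hc⟩
      simpa using this
    · rw [hz (Or.inl hc), hz' (Or.inl hc)]
  subst this
  rfl

noncomputable instance LRTableau.instFintype (lam mu nu : YoungDiagram) :
    Fintype (LRTableau lam mu nu) := Fintype.ofFinite _

/-! The engine is a left `OΛ_n`-linear operator π (`straighten`): up to sign, the composite of the
operators s_i ∂_i along a reduced word of the longest permutation. It kills every ker ∂_i and sends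
x̃^ρ, ρ = (n-1, …, 1, 0), to 1, so that g = π(g x̃^ρ) for every odd symmetric g. It plays the role
of antisymmetrizing and dividing by the Vandermonde determinant, and it turns identities of odd
symmetric polynomials into cancellations among monomials.

A tableau is treated as a chain of columns, and its monomial is read by columns; the row word gives
the same monomial up to a sign that depends only on the shape (`inversions_colCells`). Fix a column
D and sum over all chains to the left of D. By induction on the number of columns this sum lies in
ker ∂_i as soon as i ∈ D implies i+1 ∈ D (`chainSum_mem_kerDiv_aux`). Hence Schur polynomials are
odd symmetric. The same fact gives the cancellation (`straighten_chainSum_mul`): multiply the sum by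
a word v with strictly decreasing exponents and add columns from the right. If a column C is the
first to destroy strict decrease, at i say, then C contains i+1 but not i, so both the sum over
everything left of C and the word C v lie in ker ∂_i, and π kills their product.

For v = ρ exactly one chain survives, so the Schur sum of λ is ±π of any word of exponents λ+ρ. For
v = μ+ρ the survivors are the tableaux T of shape ν that build up from μ through partitions, and
they expand s_ν s_μ (`schurSum_mul`). The factors then stand in the wrong order, which matters in
this ring. The anti-automorphism `flip`, which also reverses the alphabet, repairs this: it turns
straight shapes into rotated ones, whose sums straighten to the same monomial up to sign, so every
Schur polynomial is fixed up to the sign (-1)^(dN+N) once there are enough variables.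

Finally T corresponds to an LR tableau S by transposing the matrix of letter multiplicities per row
(`Companion`): shape and content trade places, semistandardness of T becomes the Yamanouchi
condition on S, and building up through partitions becomes column strictness of S. The inversion
count is a quadratic form in this matrix that transposition preserves, which transfers the sign
(`inversions_companion`).

For the basis statement, independence is triangularity of coefficients, and spanning comes from f =
π(f x̃^ρ) by rewriting words modulo the kernels. The degree bound makes a single component determine
an odd symmetric function. -/

/-! ### Words in the signed variables -/

/-- The number of inversions of a word. -/
def inversions : List ℕ → ℕ
  | [] => 0
  | a :: l => l.countP (· < a) + inversions l

namespace OPol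

variable {n : ℕ}

theorem xt_of_lt {i : ℕ} (h : i < n) : xt n i = ((-1 : ℤ) ^ i) • x ⟨i, h⟩ := by
  rw [xt, dif_pos h, zsmul_eq_mul]; push_cast; rfl

theorem xt_of_le {i : ℕ} (h : n ≤ i) : xt n i = 0 := by
  rw [xt, dif_neg (by omega)]

theorem xt_anticomm {i j : ℕ} (h : i ≠ j) : xt n i * xt n j = -(xt n j * xt n i) := by
  rcases lt_or_ge i n with hi | hi
  · rcases lt_or_ge j n with hj | hj
    · have := x_anticomm (⟨i, hi⟩ : Fin n) ⟨j, hj⟩ (fun e => h (by simpa using e))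
      rw [xt_of_lt hi, xt_of_lt hj]
      simp only [smul_mul_assoc, mul_smul_comm, eq_neg_of_add_eq_zero_left this, smul_neg]
      rw [smul_comm]
    · simp [xt_of_le hj]
  · simp [xt_of_le hi]

/-- The product of signed variables spelled by a word. -/
noncomputable def word (n : ℕ) (w : List ℕ) : OPol n := (w.map (xt n)).prod

@[simp] theorem word_nil : word n [] = 1 := rfl

@[simp] theorem word_cons (a : ℕ) (w : List ℕ) : word n (a :: w) = xt n a * word n w := by
  simp [word]

@[simp] theorem word_append (v w : List ℕ) : word n (v ++ w) = word n v * word n w := by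
  simp [word]

theorem word_eq_zero {w : List ℕ} {a : ℕ} (ha : a ∈ w) (h : n ≤ a) : word n w = 0 :=
  List.prod_eq_zero (List.mem_map.2 ⟨a, ha, xt_of_le h⟩)

/-- Rearranging a word changes its product by the parity of the change of the inversions. -/
theorem word_perm {v w : List ℕ} (h : v.Perm w) :
    word n v = ((-1 : ℤ) ^ (inversions v + inversions w)) • word n w := by
  induction h with
  | nil => simp [inversions]
  | @cons a v w h ih =>
    rw [word_cons, word_cons, ih, mul_smul_comm]
    congr 1
    simp only [inversions, h.countP_eq]
    rw [show ∀ a b c : ℕ, a + b + (a + c) = 2 * a + (b + c) by intros; ring, pow_add _ (2 * _), pow_mul]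
    simp
  | swap a b l =>
    rcases eq_or_ne a b with rfl | hab
    · rw [← two_mul, pow_mul]; simp
    · simp only [word_cons, inversions, ← mul_assoc, List.countP_cons]
      rw [xt_anticomm hab.symm]
      rcases lt_or_gt_of_ne hab with h | h
      · have h' : ¬ b < a := by omega
        simp only [h, h', decide_true, decide_false, if_true, Bool.false_eq_true, if_false]
        rw [show ∀ p q r : ℕ, (p + 1 + (q + r)) + (q + 0 + (p + r)) = 2 * (p + q + r) + 1 by
          intros; ring, pow_succ, pow_mul]
        simp
      · have h' : ¬ a < b := by omega
        simp only [h, h', decide_true, decide_false, if_true, Bool.false_eq_true, if_false]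
        rw [show ∀ p q r : ℕ, (p + 0 + (q + r)) + (q + 1 + (p + r)) = 2 * (p + q + r) + 1 by
          intros; ring, pow_succ, pow_mul]
        simp
  | @trans u v w _ _ h1 h2 =>
    rw [h1, h2, smul_smul, ← pow_add,
      show ∀ p q r : ℕ, p + q + (q + r) = 2 * q + (p + r) by intros; ring, pow_add, pow_mul]
    simp

/-- Words of the same content have the same product up to a sign. -/
theorem word_perm_unit {v w : List ℕ} (h : v.Perm w) :
    ∃ ε : ℤˣ, word n v = (ε : ℤ) • word n w :=
  ⟨(-1) ^ (inversions v + inversions w), by rw [word_perm h]; push_cast; rfl⟩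

theorem word_mem_degLE (w : List ℕ) : word n w ∈ degLE n w.length := by
  induction w with
  | nil => exact one_mem_degLE n _
  | cons a w ih =>
    rw [word_cons, List.length_cons, add_comm]
    refine mul_mem_degLE ?_ ih
    rcases lt_or_ge a n with h | h
    · rw [xt_of_lt h]
      have hx : x ⟨a, h⟩ ∈ degLE n 1 := AddSubgroup.subset_closure ⟨[⟨a, h⟩], by simp, by simp⟩
      exact zsmul_mem hx _
    · rw [xt_of_le h]; exact zero_mem _

theorem exists_mem_degLE (f : OPol n) : ∃ d, f ∈ degLE n d := by
  induction f using induction_on with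
  | hz k =>
    refine ⟨0, ?_⟩
    rw [← zsmul_one]
    exact zsmul_mem (one_mem_degLE n 0) k
  | hx i => exact ⟨1, AddSubgroup.subset_closure ⟨[i], by simp, by simp⟩⟩
  | ha f g hf hg =>
    obtain ⟨d, hd⟩ := hf
    obtain ⟨e, he⟩ := hg
    exact ⟨max d e, add_mem (degLE_mono n (le_max_left _ _) hd) (degLE_mono n (le_max_right _ _) he)⟩
  | hm f g hf hg =>
    obtain ⟨d, hd⟩ := hf
    obtain ⟨e, he⟩ := hg
    exact ⟨d + e, mul_mem_degLE hd he⟩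

/-- Skew polynomials of degree at most `d` are combinations of words of length at most `d`. -/
theorem degLE_le_closure_word (d : ℕ) :
    degLE n d ≤ AddSubgroup.closure
      {f | ∃ w : List ℕ, (∀ a ∈ w, a < n) ∧ w.length ≤ d ∧ word n w = f} := by
  rw [degLE, AddSubgroup.closure_le]
  rintro _ ⟨l, hl, rfl⟩
  have : ∃ ε : ℤ, (l.map x).prod = ε • word n (l.map Fin.val) := by
    clear hl
    induction l with
    | nil => exact ⟨1, by simp⟩
    | cons a l ih =>
      obtain ⟨ε, hε⟩ := ih
      refine ⟨(-1) ^ (a : ℕ) * ε, ?_⟩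
      rw [List.map_cons, List.prod_cons, hε, List.map_cons, word_cons, xt_of_lt a.2,
        smul_mul_assoc, smul_smul, mul_smul_comm, mul_right_comm, ← pow_add, ← two_mul, pow_mul]
      simp
  obtain ⟨ε, hε⟩ := this
  rw [hε]
  refine zsmul_mem (AddSubgroup.subset_closure ?_) _
  exact ⟨l.map Fin.val, by simp, by simpa using hl, rfl⟩

/-- To prove a property of skew polynomials, multiply by variables on the right. -/
theorem induction_right {P : OPol n → Prop} (h1 : P 1) (ha : ∀ f g, P f → P g → P (f + g))
    (hn : ∀ f, P f → P (-f)) (h0 : P 0) (hx : ∀ f i, P f → P (f * x i)) (f : OPol n) : P f := by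
  obtain ⟨d, hd⟩ := exists_mem_degLE f
  induction hd using AddSubgroup.closure_induction with
  | mem f hf =>
    obtain ⟨l, -, rfl⟩ := hf
    induction l using List.reverseRecOn with
    | nil => simpa using h1
    | append_singleton l i ih => simpa using hx _ i ih
  | zero => exact h0
  | add f g _ _ h1 h2 => exact ha _ _ h1 h2
  | neg f _ h => exact hn _ h

/-! ### The kernels of the divided differences -/

theorem divDiff_zsmul (p q : Fin n) (k : ℤ) (f : OPol n) :
    divDiff p q (k • f) = k • divDiff p q f :=
  map_zsmul (⟨⟨divDiff p q, divDiff_zero p q⟩, divDiff_add p q⟩ : OPol n →+ OPol n) k f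

/-- The kernel of `∂_i`; everything if there is no such operator. -/
noncomputable def kerDiv (n i : ℕ) : Subring (OPol n) where
  carrier := {f | ∀ h : i + 1 < n, divDiff ⟨i, by omega⟩ ⟨i + 1, h⟩ f = 0}
  mul_mem' hf hg h := by rw [divDiff_mul, hf h, hg h, zero_mul, mul_zero, add_zero]
  one_mem' h := divDiff_one _ _
  add_mem' hf hg h := by rw [divDiff_add, hf h, hg h, add_zero]
  zero_mem' h := divDiff_zero _ _
  neg_mem' hf h := by rw [divDiff_neg, hf h, neg_zero]

theorem mem_oddSymm {f : OPol n} : f ∈ oddSymm n ↔ ∀ i, f ∈ kerDiv n i := Iff.rfl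

theorem xt_mem_kerDiv {i j : ℕ} (h1 : j ≠ i) (h2 : j ≠ i + 1) : xt n j ∈ kerDiv n i := by
  intro h
  rcases lt_or_ge j n with hj | hj
  · rw [xt_of_lt hj, divDiff_zsmul, divDiff_x, if_neg, smul_zero]
    simp [h1, h2]
  · rw [xt_of_le hj, divDiff_zero]

/-- The signs in x̃ serve this purpose: the two divided differences are (-1)^i and (-1)^(i+1). -/
theorem xt_add_mem_kerDiv (i : ℕ) : xt n i + xt n (i + 1) ∈ kerDiv n i := by
  intro h
  rw [xt_of_lt h, xt_of_lt (by omega : i < n), divDiff_add, divDiff_zsmul, divDiff_zsmul,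
    divDiff_x, divDiff_x, if_pos (by simp), if_pos (by simp), ← add_smul, pow_succ]
  simp

theorem xt_mul_mem_kerDiv (i : ℕ) : xt n i * xt n (i + 1) ∈ kerDiv n i := by
  intro h
  rw [xt_of_lt h, xt_of_lt (by omega : i < n), smul_mul_smul_comm, divDiff_zsmul, divDiff_mul,
    divDiff_x, divDiff_x, signedSwap_x]
  simp

/-- Letters i and i+1 pair off: up to sign the word is a product of factors x̃_i x̃_{i+1} and of
variables that ∂_i annihilates. -/
theorem word_mem_kerDiv {i : ℕ} {w : List ℕ} (h : w.count i = w.count (i + 1)) :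
    word n w ∈ kerDiv n i := by
  induction hw : w.count i generalizing w with
  | zero =>
    rw [word]
    refine Subring.list_prod_mem _ fun f hf => ?_
    obtain ⟨j, hj, rfl⟩ := List.mem_map.1 hf
    refine xt_mem_kerDiv ?_ ?_
    · rintro rfl; exact List.count_eq_zero.1 hw hj
    · rintro rfl; exact List.count_eq_zero.1 (h ▸ hw) hj
  | succ k ih =>
    have hi : i ∈ w := List.count_pos_iff.1 (by omega)
    have hi' : i + 1 ∈ w.erase i :=
      List.count_pos_iff.1 (by rw [List.count_erase_of_ne (by omega)]; omega)
    have hp : w.Perm (i :: (i + 1) :: (w.erase i).erase (i + 1)) :=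
      (List.perm_cons_erase hi).trans ((List.perm_cons_erase hi').cons i)
    obtain ⟨ε, hε⟩ := word_perm_unit (n := n) hp
    have c1 := hp.count_eq i
    have c2 := hp.count_eq (i + 1)
    simp only [List.count_cons_self, List.count_cons_of_ne (show i + 1 ≠ i by omega),
      List.count_cons_of_ne (show i ≠ i + 1 by omega)] at c1 c2
    rw [hε, word_cons, word_cons, ← mul_assoc]
    exact zsmul_mem (mul_mem (xt_mul_mem_kerDiv i) (ih (by omega) (by omega))) _

/-! ### Divided differences with the Leibniz rule on the other side -/

theorem signedSwap_mul (p q : Fin n) (f g : OPol n) :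
    signedSwap p q (f * g) = signedSwap p q f * signedSwap p q g := by
  simp [signedSwap, Matrix.mul_apply, Fin.sum_univ_two, divDiffMatrix_one_zero]

theorem signedSwap_add (p q : Fin n) (f g : OPol n) :
    signedSwap p q (f + g) = signedSwap p q f + signedSwap p q g := by
  simp [signedSwap]

theorem signedSwap_intCast (p q : Fin n) (k : ℤ) : signedSwap p q (k : OPol n) = k := by
  simp [signedSwap, Matrix.intCast_apply]

theorem signedSwap_neg (p q : Fin n) (f : OPol n) : signedSwap p q (-f) = -signedSwap p q f := by
  simp [signedSwap]

theorem signedSwap_signedSwap (p q : Fin n) (f : OPol n) :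
    signedSwap p q (signedSwap p q f) = f := by
  induction f using induction_on with
  | hz k => simp [signedSwap_intCast]
  | hx i => simp [signedSwap_x, signedSwap_neg]
  | ha f g h1 h2 => rw [signedSwap_add, signedSwap_add, h1, h2]
  | hm f g h1 h2 => rw [signedSwap_mul, signedSwap_mul, h1, h2]

/-- The operator `s ∂`, which satisfies the Leibniz rule `D(f g) = f D(g) + D(f) s(g)`. -/
noncomputable def rightDiff (p q : Fin n) : OPol n →+ OPol n where
  toFun f := signedSwap p q (divDiff p q f)
  map_zero' := by simpa [divDiff_zero] using signedSwap_intCast p q 0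
  map_add' f g := by rw [divDiff_add, signedSwap_add]

theorem rightDiff_one (p q : Fin n) : rightDiff p q 1 = 0 := by
  simpa [rightDiff, divDiff_one] using signedSwap_intCast p q 0

theorem rightDiff_eq_zero {p q : Fin n} {f : OPol n} (h : divDiff p q f = 0) :
    rightDiff p q f = 0 := by
  simpa [rightDiff, h] using signedSwap_intCast p q 0

theorem rightDiff_mul_x (p q : Fin n) (f : OPol n) (j : Fin n) :
    rightDiff p q (f * x j) =
      (if j = p ∨ j = q then f else 0) - rightDiff p q f * x (Equiv.swap p q j) := by
  change signedSwap p q (divDiff p q (f * x j)) = _ - signedSwap p q (divDiff p q f) * _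
  rw [divDiff_mul, signedSwap_add, signedSwap_mul, signedSwap_mul, signedSwap_signedSwap,
    signedSwap_x, divDiff_x]
  have h0 := signedSwap_intCast p q 0
  have h1 := signedSwap_intCast p q 1
  push_cast at h0 h1
  split_ifs <;> simp [h0, h1, sub_eq_add_neg, add_comm]

/-- This is the reason for using s∂ in place of ∂, for which the factor would come out as s(g). -/
theorem rightDiff_mul_left {p q : Fin n} {g : OPol n} (hg : divDiff p q g = 0) (f : OPol n) :
    rightDiff p q (g * f) = g * rightDiff p q f := by
  change signedSwap p q (divDiff p q (g * f)) = g * signedSwap p q (divDiff p q f)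
  rw [divDiff_mul, hg, zero_mul, zero_add, signedSwap_mul, signedSwap_signedSwap]

/-- Vanishing squares, anticommutation at a distance and the braid relation are each proved by
passing from f to f x_j: `rightDiff_mul_x` moves the variable outside and leaves the relation for f.
-/
theorem rightDiff_rightDiff (p q : Fin n) (f : OPol n) :
    rightDiff p q (rightDiff p q f) = 0 := by
  induction f using induction_right with
  | h1 => rw [rightDiff_one, map_zero]
  | ha f g h1 h2 => rw [map_add, map_add, h1, h2, add_zero]
  | hn f h => rw [map_neg, map_neg, h, neg_zero]
  | h0 => simp
  | hx f j h =>
    rw [rightDiff_mul_x, map_sub, rightDiff_mul_x, h]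
    by_cases h1 : j = p
    · subst h1; simp
    · by_cases h2 : j = q
      · subst h2; simp
      · simp [Equiv.swap_apply_of_ne_of_ne h1 h2, h1, h2]

theorem rightDiff_comm {p q r s : Fin n} (h1 : p ≠ r) (h2 : p ≠ s) (h3 : q ≠ r) (h4 : q ≠ s)
    (f : OPol n) : rightDiff p q (rightDiff r s f) = -rightDiff r s (rightDiff p q f) := by
  induction f using induction_right with
  | h1 => simp [rightDiff_one]
  | ha f g h1 h2 => simp only [map_add, h1, h2, neg_add]
  | hn f h => simp only [map_neg, h]
  | h0 => simp
  | hx f j h =>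
    simp only [rightDiff_mul_x, map_sub]
    by_cases j1 : j = p
    · subst j1
      simp [Equiv.swap_apply_of_ne_of_ne h1 h2, Equiv.swap_apply_of_ne_of_ne h3 h4, h1, h2, h3, h4,
        h]
    by_cases j2 : j = q
    · subst j2
      simp [Equiv.swap_apply_of_ne_of_ne h1 h2, Equiv.swap_apply_of_ne_of_ne h3 h4, h1, h2, h3, h4,
        h]
    by_cases j3 : j = r
    · subst j3
      simp [Equiv.swap_apply_of_ne_of_ne h1.symm h3.symm, Equiv.swap_apply_of_ne_of_ne h2.symm
        h4.symm, h1.symm, h2.symm, h3.symm, h4.symm, h]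
    by_cases j4 : j = s
    · subst j4
      simp [Equiv.swap_apply_of_ne_of_ne h1.symm h3.symm, Equiv.swap_apply_of_ne_of_ne h2.symm
        h4.symm, h1.symm, h2.symm, h3.symm, h4.symm, h]
    simp [Equiv.swap_apply_of_ne_of_ne j1 j2, Equiv.swap_apply_of_ne_of_ne j3 j4, j1, j2, j3, j4,
      h]

theorem rightDiff_braid {p q r : Fin n} (h1 : p ≠ q) (h2 : p ≠ r) (h3 : q ≠ r)
    (f : OPol n) : rightDiff p q (rightDiff q r (rightDiff p q f)) =
      rightDiff q r (rightDiff p q (rightDiff q r f)) := by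
  have e1 : Equiv.swap p q r = r := Equiv.swap_apply_of_ne_of_ne h2.symm h3.symm
  have e2 : Equiv.swap q r p = p := Equiv.swap_apply_of_ne_of_ne h1 h2
  induction f using induction_right with
  | h1 => simp [rightDiff_one]
  | ha f g h1 h2 => simp only [map_add, h1, h2]
  | hn f h => simp only [map_neg, h]
  | h0 => simp
  | hx f j h =>
    simp only [rightDiff_mul_x, map_sub]
    by_cases j1 : j = p
    · subst j1
      simp [e1, e2, h1, h2, h3, h2.symm, h3.symm, h, rightDiff_rightDiff]
    by_cases j2 : j = q
    · subst j2
      simp [e1, e2, h1, h2, h3, h1.symm, h2.symm, h3.symm, h]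
      abel
    by_cases j3 : j = r
    · subst j3
      simp [e1, e2, h1, h2, h1.symm, h2.symm, h3.symm, h, rightDiff_rightDiff]
    simp [Equiv.swap_apply_of_ne_of_ne j1 j2, Equiv.swap_apply_of_ne_of_ne j2 j3, j1, j2, j3,
      h]

end OPol

namespace OPol

variable {n : ℕ}

/-! ### The longest divided difference -/

/-- The operator `s_i ∂_i`; zero if there is no such operator. -/
noncomputable def adjDiff (n i : ℕ) : OPol n →+ OPol n :=
  if h : i + 1 < n then rightDiff ⟨i, by omega⟩ ⟨i + 1, h⟩ else 0

theorem adjDiff_of_lt {i : ℕ} (h : i + 1 < n) :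
    adjDiff n i = rightDiff ⟨i, by omega⟩ ⟨i + 1, h⟩ := dif_pos h

theorem adjDiff_eq_zero {i : ℕ} {f : OPol n} (hf : f ∈ kerDiv n i) : adjDiff n i f = 0 := by
  by_cases h : i + 1 < n
  · rw [adjDiff_of_lt h, rightDiff_eq_zero (hf h)]
  · simp [adjDiff, h]

theorem adjDiff_mul_left {i : ℕ} {g : OPol n} (hg : g ∈ kerDiv n i) (f : OPol n) :
    adjDiff n i (g * f) = g * adjDiff n i f := by
  by_cases h : i + 1 < n
  · rw [adjDiff_of_lt h, rightDiff_mul_left (hg h)]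
  · simp [adjDiff, h]

theorem adjDiff_comm {i j : ℕ} (h : i + 1 < j) (f : OPol n) :
    adjDiff n i (adjDiff n j f) = -adjDiff n j (adjDiff n i f) := by
  by_cases hj : j + 1 < n
  · rw [adjDiff_of_lt hj, adjDiff_of_lt (by omega), rightDiff_comm] <;>
      simp only [ne_eq, Fin.mk.injEq] <;> omega
  · simp [adjDiff, hj]

theorem adjDiff_braid {i : ℕ} (h : i + 2 < n) (f : OPol n) :
    adjDiff n i (adjDiff n (i + 1) (adjDiff n i f)) =
      adjDiff n (i + 1) (adjDiff n i (adjDiff n (i + 1) f)) := by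
  rw [adjDiff_of_lt h, adjDiff_of_lt (by omega), rightDiff_braid] <;>
    simp only [ne_eq, Fin.mk.injEq] <;> omega

theorem adjDiff_xt {i : ℕ} (h : i + 1 < n) : adjDiff n i (xt n i) = ((-1) ^ i : ℤ) • 1 := by
  have := rightDiff_mul_x (⟨i, by omega⟩ : Fin n) ⟨i + 1, h⟩ 1 ⟨i, by omega⟩
  rw [one_mul] at this
  rw [adjDiff_of_lt h, xt_of_lt (by omega), map_zsmul, this]
  simp [rightDiff_one]

/-- The composition `D_{m-1} ⋯ D_0`. -/
noncomputable def downDiff (n : ℕ) : ℕ → (OPol n →+ OPol n)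
  | 0 => AddMonoidHom.id _
  | m + 1 => (adjDiff n m).comp (downDiff n m)

/-- The composition of divided differences along a reduced word of the longest permutation of
`m + 1` letters. -/
noncomputable def longDiff (n : ℕ) : ℕ → (OPol n →+ OPol n)
  | 0 => AddMonoidHom.id _
  | m + 1 => (longDiff n m).comp (downDiff n (m + 1))

/-- All factors of D_{m-1} ⋯ D_0 have index at most i - 2, so D_i anticommutes with them. -/
theorem adjDiff_downDiff_of_le {i m : ℕ} (h : m + 1 ≤ i) {f : OPol n} (hf : adjDiff n i f = 0) :
    adjDiff n i (downDiff n m f) = 0 := by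
  induction m with
  | zero => exact hf
  | succ m ih =>
    have := adjDiff_comm (n := n) (show m + 1 < i by omega) (downDiff n m f)
    rw [ih (by omega), map_zero, eq_comm, neg_eq_zero] at this
    exact this

/-- Passing through D_{m-1} ⋯ D_0 lowers the index of the operator by one. The braid relation turns
D_i D_{i+1} D_i into D_{i+1} D_i D_{i+1}, whose innermost factor reaches f; the factors of larger
index anticommute with D_i. -/
theorem adjDiff_downDiff {i m : ℕ} (h : i + 2 ≤ m) (hm : m < n) {f : OPol n}
    (hf : adjDiff n (i + 1) f = 0) : adjDiff n i (downDiff n m f) = 0 := by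
  induction m, h using Nat.le_induction with
  | base =>
    change adjDiff n i (adjDiff n (i + 1) (adjDiff n i (downDiff n i f))) = 0
    rw [adjDiff_braid hm, adjDiff_downDiff_of_le le_rfl hf, map_zero, map_zero]
  | succ m h ih =>
    change adjDiff n i (adjDiff n m (downDiff n m f)) = 0
    rw [adjDiff_comm (by omega), ih (by omega), map_zero, neg_zero]

theorem downDiff_eq_zero {m : ℕ} {f : OPol n} (hf : adjDiff n 0 f = 0) :
    downDiff n (m + 1) f = 0 := by
  induction m with
  | zero => exact hf
  | succ m ih =>
    change adjDiff n (m + 1) (downDiff n (m + 1) f) = 0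
    rw [ih, map_zero]

/-- Each block lowers the index i by one, until the index is 0 and the next block begins with D_0
itself. -/
theorem longDiff_eq_zero {i m : ℕ} (h : i < m) (hm : m < n) {f : OPol n}
    (hf : adjDiff n i f = 0) : longDiff n m f = 0 := by
  induction m generalizing i f with
  | zero => omega
  | succ m ih =>
    change longDiff n m (downDiff n (m + 1) f) = 0
    cases i with
    | zero => rw [downDiff_eq_zero hf, map_zero]
    | succ i => exact ih (by omega) (by omega) (adjDiff_downDiff (by omega) hm hf)

theorem downDiff_mul_left {g : OPol n} (hg : g ∈ oddSymm n) (m : ℕ) (f : OPol n) :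
    downDiff n m (g * f) = g * downDiff n m f := by
  induction m with
  | zero => rfl
  | succ m ih =>
    change adjDiff n m (downDiff n m (g * f)) = g * adjDiff n m (downDiff n m f)
    rw [ih, adjDiff_mul_left (mem_oddSymm.1 hg m)]

theorem longDiff_mul_left {g : OPol n} (hg : g ∈ oddSymm n) (m : ℕ) (f : OPol n) :
    longDiff n m (g * f) = g * longDiff n m f := by
  induction m generalizing f with
  | zero => rfl
  | succ m ih =>
    change longDiff n m (downDiff n (m + 1) (g * f)) = g * longDiff n m (downDiff n (m + 1) f)
    rw [downDiff_mul_left hg, ih]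

/-- With one letter i moved to the right end, the remaining word is balanced in i and i+1; it lies
in the kernel and factors out on the left. -/
theorem adjDiff_word {i : ℕ} (h : i + 1 < n) {w : List ℕ}
    (hw : w.count i = w.count (i + 1) + 1) :
    ∃ ε : ℤˣ, adjDiff n i (word n w) = (ε : ℤ) • word n (w.erase i) := by
  have hi : i ∈ w := List.count_pos_iff.1 (by omega)
  have hp : w.Perm (w.erase i ++ [i]) :=
    (List.perm_cons_erase hi).trans (List.perm_append_singleton _ _).symm
  obtain ⟨ε, hε⟩ := word_perm_unit (n := n) hp
  refine ⟨ε * (-1) ^ i, ?_⟩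
  rw [hε, map_zsmul, word_append, adjDiff_mul_left]
  · simp only [word_cons, word_nil, mul_one, adjDiff_xt h]
    rw [mul_smul_comm, mul_one, smul_smul]
    push_cast
    rfl
  · refine word_mem_kerDiv ?_
    rw [List.count_erase_self, List.count_erase_of_ne (by omega)]
    omega

/-- D_j removes one letter j. When its turn comes, the counts of j and j+1 are still the original
ones, so they differ by one. -/
theorem downDiff_word {m : ℕ} (hm : m < n) {w : List ℕ}
    (hw : ∀ j < m, w.count j = w.count (j + 1) + 1) :
    ∃ (ε : ℤˣ) (v : List ℕ), downDiff n m (word n w) = (ε : ℤ) • word n v ∧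
      ∀ j, w.count j = v.count j + if j < m then 1 else 0 := by
  induction m with
  | zero => exact ⟨1, w, by simp [downDiff], by simp⟩
  | succ m ih =>
    obtain ⟨ε, v, h1, h2⟩ := ih (by omega) (fun j hj => hw j (by omega))
    have e0 := h2 m
    have e1 := h2 (m + 1)
    have e2 := hw m (by omega)
    simp only [lt_irrefl, if_false, show ¬ m + 1 < m by omega] at e0 e1
    obtain ⟨δ, hδ⟩ := adjDiff_word (n := n) (i := m) (w := v) (by omega) (by omega)
    refine ⟨ε * δ, v.erase m, ?_, fun j => ?_⟩
    · change adjDiff n m (downDiff n m (word n w)) = _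
      rw [h1, map_zsmul, hδ, smul_smul]; push_cast; rfl
    · rw [h2 j]
      rcases eq_or_ne j m with rfl | hj
      · rw [List.count_erase_self]; simp; omega
      · rw [List.count_erase_of_ne hj]
        congr 1
        simp only [show j < m + 1 ↔ j < m by omega]

/-- The first block lowers the counts of 0, …, m-1 by one each, so the unit gaps needed by the
remaining, shorter blocks persist. -/
theorem longDiff_word {m : ℕ} (hm : m < n) {w : List ℕ}
    (hw : ∀ j < m, w.count j = w.count (j + 1) + 1) :
    ∃ (ε : ℤˣ) (v : List ℕ), longDiff n m (word n w) = (ε : ℤ) • word n v ∧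
      ∀ j, w.count j = v.count j + (m - j) := by
  induction m generalizing w with
  | zero => exact ⟨1, w, by simp [longDiff], by simp⟩
  | succ m ih =>
    obtain ⟨ε, v, h1, h2⟩ := downDiff_word hm hw
    obtain ⟨δ, u, h3, h4⟩ := ih (w := v) (by omega) (fun j hj => by
      have e0 := h2 j
      have e1 := h2 (j + 1)
      have e2 := hw j (by omega)
      rw [if_pos (by omega)] at e0 e1
      omega)
    refine ⟨ε * δ, u, ?_, fun j => ?_⟩
    · change longDiff n m (downDiff n (m + 1) (word n w)) = _
      rw [h1, map_zsmul, h3, smul_smul]; push_cast; rfl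
    · rw [h2 j, h4 j]
      split_ifs <;> omega

/-! ### The staircase monomial and the straightening operator -/

/-- The word of the exponents `(n-1, …, 1, 0)`. -/
def rhoWord (n : ℕ) : List ℕ := (List.range n).flatMap fun i => List.replicate (n - 1 - i) i

theorem count_flatMap_replicate (n : ℕ) (e : ℕ → ℕ) (j : ℕ) :
    ((List.range n).flatMap fun i => List.replicate (e i) i).count j = if j < n then e j else 0 := by
  induction n with
  | zero => simp
  | succ n ih =>
    rw [List.range_succ, List.flatMap_append, List.count_append, ih]
    simp only [List.flatMap_cons, List.flatMap_nil, List.append_nil, List.count_replicate, beq_iff_eq]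
    split_ifs <;> first | omega | (subst_vars; omega)

theorem count_rhoWord (n j : ℕ) : (rhoWord n).count j = n - 1 - j := by
  rw [rhoWord, count_flatMap_replicate n (fun i => n - 1 - i)]
  split_ifs <;> omega

/-- There is an `OΛ_n`-linear operator that kills the kernels of all divided differences and
is normalized on `x^ρ`. -/
theorem exists_straightening (n : ℕ) : ∃ π : OPol n →+ OPol n,
    (∀ g ∈ oddSymm n, ∀ f, π (g * f) = g * π f) ∧
    (∀ i, i + 1 < n → ∀ f ∈ kerDiv n i, π f = 0) ∧ π (word n (rhoWord n)) = 1 := by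
  -- For n = 0 the index n - 1 truncates and there is no divided difference; the identity serves.
  rcases Nat.eq_zero_or_pos n with rfl | hn
  · exact ⟨AddMonoidHom.id _, fun _ _ _ => rfl, fun i hi => by omega, by simp [rhoWord]⟩
  obtain ⟨ε, v, h1, h2⟩ := longDiff_word (n := n) (m := n - 1) (w := rhoWord n) (by omega)
    (fun j hj => by rw [count_rhoWord, count_rhoWord]; omega)
  have hv : v = [] := by
    rw [List.eq_nil_iff_forall_not_mem]
    intro a ha
    have := h2 a
    rw [count_rhoWord] at this
    have := List.count_pos_iff.2 ha
    omega
  have key : ∀ f, ((ε : ℤ) • longDiff n (n - 1)) f = (ε : ℤ) • longDiff n (n - 1) f := fun _ => rfl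
  refine ⟨(ε : ℤ) • longDiff n (n - 1), ?_, ?_, ?_⟩
  · intro g hg f
    rw [key, key, longDiff_mul_left hg, mul_smul_comm]
  · intro i hi f hf
    rw [key, longDiff_eq_zero (show i < n - 1 by omega) (by omega) (adjDiff_eq_zero hf), smul_zero]
  · rw [key, h1, hv, smul_smul, word_nil, ← Units.val_mul, Int.units_mul_self, Units.val_one,
      one_smul]

/-- A chosen straightening operator. -/
noncomputable def straighten (n : ℕ) : OPol n →+ OPol n := (exists_straightening n).choose

theorem straighten_mul {g : OPol n} (hg : g ∈ oddSymm n) (f : OPol n) :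
    straighten n (g * f) = g * straighten n f := (exists_straightening n).choose_spec.1 g hg f

theorem straighten_eq_zero {i : ℕ} (hi : i + 1 < n) {f : OPol n} (hf : f ∈ kerDiv n i) :
    straighten n f = 0 := (exists_straightening n).choose_spec.2.1 i hi f hf

theorem straighten_rho : straighten n (word n (rhoWord n)) = 1 :=
  (exists_straightening n).choose_spec.2.2

end OPol

/-! ### Columns -/

/-- The entries of a column, read from bottom to top. -/
def colWord (C : Finset ℕ) : List ℕ := C.sort (· ≥ ·)

/-- The number of entries of a column that are smaller than `k`. -/
def below (C : Finset ℕ) (k : ℕ) : ℕ := (C.filter (· < k)).card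

/-- The column `C` may stand to the left of the column `D`, where the top of a column with `m`
boxes is placed in row `o m`. -/
def Fits (o : ℕ → ℤ) (C D : Finset ℕ) : Prop :=
  ∀ k, (below D k : ℤ) + o D.card ≤ below C k + o C.card

/-- Exchange the entries `i` and `i + 1`. -/
def swapCol (i : ℕ) (C : Finset ℕ) : Finset ℕ := C.map (Equiv.swap i (i + 1)).toEmbedding

theorem mem_colWord {C : Finset ℕ} {a : ℕ} : a ∈ colWord C ↔ a ∈ C := by simp [colWord]

theorem nodup_colWord (C : Finset ℕ) : (colWord C).Nodup := by simp [colWord]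

theorem count_colWord (C : Finset ℕ) (a : ℕ) : (colWord C).count a = if a ∈ C then 1 else 0 := by
  rw [(nodup_colWord C).count]; simp only [mem_colWord]

theorem length_colWord (C : Finset ℕ) : (colWord C).length = C.card := by simp [colWord]

theorem below_mono (C : Finset ℕ) {k l : ℕ} (h : k ≤ l) : below C k ≤ below C l :=
  Finset.card_le_card fun a ha => by
    rw [Finset.mem_filter] at ha ⊢
    exact ⟨ha.1, by omega⟩

theorem below_succ (C : Finset ℕ) (k : ℕ) : below C (k + 1) = below C k + if k ∈ C then 1 else 0 := by
  have : C.filter (· < k + 1) = C.filter (· < k) ∪ C.filter (· = k) := by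
    ext a; simp only [Finset.mem_filter, Finset.mem_union]; grind
  rw [below, this, Finset.card_union_of_disjoint, ← below, Finset.filter_eq']
  · split_ifs <;> simp
  · rw [Finset.disjoint_filter]; intros; omega

theorem below_zero (C : Finset ℕ) : below C 0 = 0 := by simp [below]

theorem below_range (d k : ℕ) : below (Finset.range d) k = min k d := by
  have : (Finset.range d).filter (· < k) = Finset.range (min k d) := by
    ext a; simp only [Finset.mem_filter, Finset.mem_range]; omega
  rw [below, this, Finset.card_range]

/-! ### Exchanging neighbouring entries of a column -/

theorem mem_swapCol {i a : ℕ} {C : Finset ℕ} :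
    a ∈ swapCol i C ↔ Equiv.swap i (i + 1) a ∈ C := by
  rw [swapCol, Finset.mem_map_equiv, Equiv.symm_swap]

theorem mem_swapCol_left {i : ℕ} {C : Finset ℕ} : i ∈ swapCol i C ↔ i + 1 ∈ C := by
  rw [mem_swapCol, Equiv.swap_apply_left]

theorem mem_swapCol_right {i : ℕ} {C : Finset ℕ} : i + 1 ∈ swapCol i C ↔ i ∈ C := by
  rw [mem_swapCol, Equiv.swap_apply_right]

theorem mem_swapCol_of_ne {i a : ℕ} {C : Finset ℕ} (h1 : a ≠ i) (h2 : a ≠ i + 1) :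
    a ∈ swapCol i C ↔ a ∈ C := by
  rw [mem_swapCol, Equiv.swap_apply_of_ne_of_ne h1 h2]

theorem swapCol_swapCol (i : ℕ) (C : Finset ℕ) : swapCol i (swapCol i C) = C := by
  ext a; rw [mem_swapCol, mem_swapCol, Equiv.swap_apply_self]

theorem card_swapCol (i : ℕ) (C : Finset ℕ) : (swapCol i C).card = C.card := Finset.card_map _

theorem swapCol_subset_range {n i : ℕ} {C : Finset ℕ} (hi : i + 1 < n)
    (h : C ⊆ Finset.range n) : swapCol i C ⊆ Finset.range n := by
  intro a ha
  rw [Finset.mem_range]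
  by_cases h1 : a = i
  · omega
  by_cases h2 : a = i + 1
  · omega
  · exact Finset.mem_range.1 (h ((mem_swapCol_of_ne h1 h2).1 ha))

theorem below_swapCol {i k : ℕ} (hk : k ≠ i + 1) (C : Finset ℕ) :
    below (swapCol i C) k = below C k := by
  have h1 : ∀ k ≤ i, below (swapCol i C) k = below C k := by
    intro k hk
    unfold below
    congr 1
    ext a
    simp only [Finset.mem_filter]
    constructor <;> rintro ⟨h1, h2⟩ <;>
      simpa [h2, mem_swapCol_of_ne (show a ≠ i by omega) (show a ≠ i + 1 by omega)] using h1
  rcases Nat.lt_or_ge i k with h | h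
  · obtain ⟨j, rfl⟩ : ∃ j, k = i + 1 + 1 + j := ⟨k - (i + 1 + 1), by omega⟩
    clear h hk
    induction j with
    | zero =>
      rw [add_zero, below_succ, below_succ, h1 i le_rfl, below_succ, below_succ]
      simp only [mem_swapCol_left, mem_swapCol_right]
      omega
    | succ j ih =>
      rw [← add_assoc, below_succ, below_succ, ih]
      simp only [mem_swapCol_of_ne (show i + 1 + 1 + j ≠ i by omega)
        (show i + 1 + 1 + j ≠ i + 1 by omega)]
  · exact h1 k h

/-- The exchange affects only the inequality at k = i+1. Under the hypothesis on D, that one follows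
from the inequalities at i and i+2. -/
theorem fits_swapCol {o : ℕ → ℤ} {C D : Finset ℕ} {i : ℕ} (h : Fits o C D)
    (hD : i ∈ D → i + 1 ∈ D) : Fits o (swapCol i C) D := by
  intro k
  rw [card_swapCol]
  rcases eq_or_ne k (i + 1) with rfl | hk
  · have h1 := h i
    have h2 := h (i + 1 + 1)
    rw [← below_swapCol (show i ≠ i + 1 by omega) C] at h1
    rw [← below_swapCol (show i + 1 + 1 ≠ i + 1 by omega) C] at h2
    rw [below_succ _ (i + 1)] at h2
    have h3 := below_succ (swapCol i C) (i + 1)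
    have h4 := below_mono (swapCol i C) (show i ≤ i + 1 by omega)
    by_cases hi : i ∈ D
    · rw [if_pos (hD hi)] at h2
      split_ifs at h3 <;> omega
    · rw [below_succ, if_neg hi]
      omega
  · rw [below_swapCol hk]
    exact h k

/-- When i ∈ D, the exchange can only lower the counts of D. -/
theorem fits_swapCol_right {o : ℕ → ℤ} {C D : Finset ℕ} {i : ℕ} (h : Fits o C D)
    (hi : i ∈ D) : Fits o C (swapCol i D) := by
  intro k
  rw [card_swapCol]
  refine le_trans (add_le_add_left (Nat.cast_le.2 ?_) _) (h k)
  rcases eq_or_ne k (i + 1) with rfl | hk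
  · rw [below_succ, below_succ, below_swapCol (by omega), if_pos hi]
    split_ifs <;> omega
  · rw [below_swapCol hk]

/-- Only the inequality at k = i+1 can fail, and only by one; the inequalities at i and i+2 then
determine C at i and i+1. When i+1 ∉ D, the columns C and D together are balanced in i and i+1. -/
theorem exceptional_of_not_fits {o : ℕ → ℤ} {C D : Finset ℕ} {i : ℕ} (h : Fits o C (swapCol i D))
    (hi : i ∈ D) (hn : ¬ Fits o C D) : i ∉ C ∧ i + 1 ∈ C := by
  rw [Fits] at hn
  push Not at hn
  obtain ⟨k, hk⟩ := hn
  have hk' := h k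
  rw [card_swapCol] at hk'
  rcases eq_or_ne k (i + 1) with rfl | hne
  · have h1 := h i
    have h2 := h (i + 1 + 1)
    rw [card_swapCol, below_swapCol (by omega)] at h1
    rw [card_swapCol, below_swapCol (by omega)] at h2
    have h3 := below_succ D i
    have h4 := below_succ D (i + 1)
    have h5 := below_succ C i
    have h6 := below_succ C (i + 1)
    rw [if_pos hi] at h3
    constructor
    · intro hC
      rw [if_pos hC] at h5
      omega
    · by_contra hC
      rw [if_neg hC] at h6
      split_ifs at h4 <;> omega
  · rw [below_swapCol hne] at hk'
    omega

theorem eq_range_of_downClosed {C : Finset ℕ} (h : ∀ j, j + 1 ∈ C → j ∈ C) :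
    C = Finset.range C.card := by
  have key : ∀ a ∈ C, ∀ b ≤ a, b ∈ C := by
    intro a ha b hb
    induction a, hb using Nat.le_induction with
    | base => exact ha
    | succ a _ ih => exact ih (h a ha)
  symm
  refine Finset.eq_of_subset_of_card_le (fun b hb => ?_) (by simp)
  by_contra hbC
  have : C ⊆ Finset.range b := fun a ha => by
    rw [Finset.mem_range]
    by_contra hab
    exact hbC (key a ha b (by omega))
  have := Finset.card_le_card this
  simp only [Finset.card_range, Finset.mem_range] at this hb
  omega

/-! ### Chains of columns -/

open Classical in
/-- The chains of columns with entries smaller than `n`, listed from right to left, with given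
numbers of boxes, that fit to the left of the column `D`. -/
noncomputable def chains (o : ℕ → ℤ) (n : ℕ) : List ℕ → Finset ℕ → Finset (List (Finset ℕ))
  | [], _ => {[]}
  | l :: s, D => ((Finset.powersetCard l (Finset.range n)).filter (Fits o · D)).biUnion
      fun C => (chains o n s C).image (C :: ·)

theorem mem_chains {o : ℕ → ℤ} {n : ℕ} {s : List ℕ} {D : Finset ℕ} {L : List (Finset ℕ)} :
    L ∈ chains o n s D ↔ L.map Finset.card = s ∧ (∀ C ∈ L, C ⊆ Finset.range n) ∧
      (D :: L).IsChain (fun D C => Fits o C D) := by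
  induction s generalizing D L with
  | nil => rw [chains]; aesop
  | cons l s ih =>
    rw [chains]
    simp only [Finset.mem_biUnion, Finset.mem_filter, Finset.mem_powersetCard, Finset.mem_image, ih]
    constructor
    · rintro ⟨C, ⟨⟨h1, h2⟩, h3⟩, L, ⟨h4, h5, h6⟩, rfl⟩
      refine ⟨by simp [h2, h4], ?_, ?_⟩
      · simpa using ⟨h1, h5⟩
      · rw [List.isChain_cons_cons]; exact ⟨h3, h6⟩
    · rintro ⟨h1, h2, h3⟩
      cases L with
      | nil => simp at h1
      | cons C L =>
        rw [List.isChain_cons_cons] at h3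
        simp only [List.map_cons, List.cons.injEq] at h1
        exact ⟨C, ⟨⟨h2 C (by simp), h1.1⟩, h3.1⟩, L,
          ⟨h1.2, fun C hC => h2 C (by simp [hC]), h3.2⟩, rfl⟩

theorem sum_chains_nil {M : Type*} [AddCommMonoid M] (o : ℕ → ℤ) (n : ℕ) (D : Finset ℕ)
    (f : List (Finset ℕ) → M) : ∑ L ∈ chains o n [] D, f L = f [] := by
  simp [chains]

open Classical in
theorem sum_chains_cons {M : Type*} [AddCommMonoid M] (o : ℕ → ℤ) (n l : ℕ) (s : List ℕ)
    (D : Finset ℕ) (f : List (Finset ℕ) → M) : ∑ L ∈ chains o n (l :: s) D, f L =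
      ∑ C ∈ (Finset.powersetCard l (Finset.range n)).filter (Fits o · D),
        ∑ L ∈ chains o n s C, f (C :: L) := by
  rw [chains, Finset.sum_biUnion]
  · refine Finset.sum_congr rfl fun C _ => ?_
    rw [Finset.sum_image]
    intro a _ b _ h
    simpa using h
  · intro C _ C' _ h
    rw [Function.onFun, Finset.disjoint_left]
    rintro _ hL hL'
    obtain ⟨L, -, rfl⟩ := Finset.mem_image.1 hL
    obtain ⟨L', -, h'⟩ := Finset.mem_image.1 hL'
    exact h (by simp at h'; exact h'.1.symm)

/-- The column word of a list of columns given from right to left. -/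
def chainWord : List (Finset ℕ) → List ℕ
  | [] => []
  | C :: L => chainWord L ++ colWord C

namespace OPol

variable {n : ℕ}

/-- The sum of the column words of all chains. -/
noncomputable def chainSum (o : ℕ → ℤ) (n : ℕ) (s : List ℕ) (D : Finset ℕ) : OPol n :=
  ∑ L ∈ chains o n s D, word n (chainWord L)

theorem chainSum_nil (o : ℕ → ℤ) (n : ℕ) (D : Finset ℕ) : chainSum o n [] D = 1 := by
  rw [chainSum, sum_chains_nil]; rfl

open Classical in
theorem chainSum_cons (o : ℕ → ℤ) (n l : ℕ) (s : List ℕ) (D : Finset ℕ) :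
    chainSum o n (l :: s) D =
      ∑ C ∈ (Finset.powersetCard l (Finset.range n)).filter (Fits o · D),
        chainSum o n s C * word n (colWord C) := by
  rw [chainSum, sum_chains_cons]
  refine Finset.sum_congr rfl fun C _ => ?_
  simp [chainSum, chainWord, Finset.sum_mul]

/-- Such a column reads A, i, B with all letters of A above i+1 and all letters of B below i. The
exchange puts i+1 in the same place, so the sum has the factor x̃_i + x̃_{i+1} in the middle and no
sign appears. -/
theorem word_colWord_add_swapCol {i : ℕ} {D : Finset ℕ} (h1 : i ∈ D) (h2 : i + 1 ∉ D) :
    word n (colWord D) + word n (colWord (swapCol i D)) ∈ kerDiv n i := by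
  obtain ⟨A, B, hAB⟩ := List.append_of_mem (mem_colWord.2 h1)
  have hp : (colWord D).Pairwise (· ≥ ·) := Finset.pairwise_sort _ _
  have hn := nodup_colWord D
  have hm : ∀ a, a ∈ D ↔ a ∈ A ∨ a = i ∨ a ∈ B := fun a => by
    rw [← mem_colWord, hAB]; simp
  rw [hAB] at hp hn
  have hA : ∀ a ∈ A, i + 1 < a := fun a ha => by
    have e1 : i ≤ a := (List.pairwise_append.1 hp).2.2 a ha i (by simp)
    have e2 : a ≠ i := fun h => List.disjoint_of_nodup_append hn ha (by simp [h])
    have e3 : a ≠ i + 1 := fun h => h2 ((hm _).2 (Or.inl (h ▸ ha)))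
    omega
  have hB : ∀ a ∈ B, a < i := fun a ha => by
    have e1 : a ≤ i := (List.pairwise_cons.1 (List.pairwise_append.1 hp).2.1).1 a ha
    have e2 : a ≠ i := fun h => (List.nodup_cons.1 (List.nodup_append.1 hn).2.1).1 (h ▸ ha)
    omega
  have hAn : A.Nodup := (List.nodup_append.1 hn).1
  have hBn : B.Nodup := (List.nodup_cons.1 (List.nodup_append.1 hn).2.1).2
  have key : colWord (swapCol i D) = A ++ (i + 1) :: B := by
    have hn' : (A ++ (i + 1) :: B).Nodup := by
      rw [List.nodup_append, List.nodup_cons]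
      refine ⟨hAn, ⟨fun h => by have := hB _ h; omega, hBn⟩, fun a ha b hb => ?_⟩
      have := hA a ha
      rcases List.mem_cons.1 hb with rfl | hb
      · omega
      · have := hB b hb; omega
    have hs : swapCol i D = (A ++ (i + 1) :: B).toFinset := by
      ext a
      simp only [List.mem_toFinset, List.mem_append, List.mem_cons]
      by_cases e1 : a = i
      · subst e1
        rw [mem_swapCol_left]
        simp only [h2, false_iff]
        rintro (h | h | h)
        · have := hA _ h; omega
        · omega
        · have := hB _ h; omega
      by_cases e2 : a = i + 1
      · subst e2; rw [mem_swapCol_right]; simp [h1]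
      rw [mem_swapCol_of_ne e1 e2, hm]
      simp [e1, e2]
    rw [colWord, hs, (List.toFinset_sort (· ≥ ·) hn')]
    rw [List.pairwise_append, List.pairwise_cons] at hp ⊢
    refine ⟨hp.1, ⟨fun b hb => ?_, hp.2.1.2⟩, fun a ha b hb => ?_⟩
    · have := hB b hb; simp only [ge_iff_le]; omega
    · have := hA a ha
      rcases List.mem_cons.1 hb with rfl | hb
      · simp only [ge_iff_le]; omega
      · have := hB b hb; simp only [ge_iff_le]; omega
  rw [key, hAB, word_append, word_append, word_cons, word_cons, ← mul_add, ← add_mul]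
  have hw : ∀ w : List ℕ, (∀ a ∈ w, a ≠ i ∧ a ≠ i + 1) → word n w ∈ kerDiv n i := fun w hw =>
    word_mem_kerDiv (by
      rw [List.count_eq_zero_of_not_mem fun h => (hw _ h).1 rfl,
        List.count_eq_zero_of_not_mem fun h => (hw _ h).2 rfl])
  refine mul_mem (hw _ fun a ha => ?_) (mul_mem (xt_add_mem_kerDiv i) (hw _ fun a ha => ?_))
  · have := hA a ha; omega
  · have := hB a ha; omega

open Classical in
/-- A sum over columns that is stable under exchange of `i` and `i + 1`. -/
theorem sum_mem_of_swapCol_mem {S : Finset (Finset ℕ)} {i : ℕ} {f : Finset ℕ → OPol n}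
    (hS : ∀ C ∈ S, swapCol i C ∈ S)
    (h1 : ∀ C ∈ S, (i ∈ C ↔ i + 1 ∈ C) → f C ∈ kerDiv n i)
    (h2 : ∀ C ∈ S, i ∈ C → i + 1 ∉ C → f C + f (swapCol i C) ∈ kerDiv n i) :
    ∑ C ∈ S, f C ∈ kerDiv n i := by
  rw [← Finset.sum_filter_add_sum_filter_not S (fun C => (i ∈ C ↔ i + 1 ∈ C)),
    ← Finset.sum_filter_add_sum_filter_not (S.filter fun C => ¬ (i ∈ C ↔ i + 1 ∈ C))
      (fun C => i ∈ C)]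
  have : ∑ C ∈ (S.filter fun C => ¬ (i ∈ C ↔ i + 1 ∈ C)).filter (fun C => ¬ i ∈ C), f C =
      ∑ C ∈ (S.filter fun C => ¬ (i ∈ C ↔ i + 1 ∈ C)).filter (fun C => i ∈ C),
        f (swapCol i C) := by
    refine Finset.sum_nbij' (swapCol i) (swapCol i) ?_ ?_ ?_ ?_ ?_
    · intro C
      simp only [Finset.mem_filter, mem_swapCol_left, mem_swapCol_right]
      rintro ⟨⟨h, h'⟩, h''⟩
      exact ⟨⟨hS C h, by tauto⟩, by tauto⟩
    · intro C
      simp only [Finset.mem_filter, mem_swapCol_left, mem_swapCol_right]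
      rintro ⟨⟨h, h'⟩, h''⟩
      exact ⟨⟨hS C h, by tauto⟩, by tauto⟩
    · intro C _; exact swapCol_swapCol i C
    · intro C _; exact swapCol_swapCol i C
    · intro C _; rw [swapCol_swapCol]
  rw [this, ← Finset.sum_add_distrib]
  refine add_mem (sum_mem fun C hC => ?_) (sum_mem fun C hC => ?_)
  · rw [Finset.mem_filter] at hC
    exact h1 C hC.1 hC.2
  · simp only [Finset.mem_filter] at hC
    exact h2 C hC.1.1 hC.2 (by tauto)

/-- The two claims feed each other. For the first, the possible columns C next to D are stable under
the exchange: those containing both or neither of i, i+1 are handled by the first claim for shorter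
chains, the others pair up by the second. The second claim compares D with its exchange D', next to
which more columns fit. -/
theorem chainSum_mem_kerDiv_aux (o : ℕ → ℤ) {i : ℕ} (hi : i + 1 < n) (s : List ℕ) :
    (∀ D : Finset ℕ, (i ∈ D → i + 1 ∈ D) → chainSum o n s D ∈ kerDiv n i) ∧
    ∀ D : Finset ℕ, i ∈ D → i + 1 ∉ D → chainSum o n s D * word n (colWord D) +
      chainSum o n s (swapCol i D) * word n (colWord (swapCol i D)) ∈ kerDiv n i := by
  classical
  induction s with
  | nil =>
    refine ⟨fun D _ => ?_, fun D h1 h2 => ?_⟩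
    · rw [chainSum_nil]; exact one_mem _
    · rw [chainSum_nil, chainSum_nil, one_mul, one_mul]
      exact word_colWord_add_swapCol h1 h2
  | cons l s ih =>
    have key : ∀ D : Finset ℕ, (i ∈ D → i + 1 ∈ D) → chainSum o n (l :: s) D ∈ kerDiv n i := by
      intro D hD
      rw [chainSum_cons]
      refine sum_mem_of_swapCol_mem (i := i) (fun C hC => ?_) (fun C _ h => ?_)
        (fun C _ h1 h2 => ih.2 C h1 h2)
      · rw [Finset.mem_filter, Finset.mem_powersetCard] at hC ⊢
        exact ⟨⟨swapCol_subset_range hi hC.1.1, by rw [card_swapCol, hC.1.2]⟩,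
          fits_swapCol hC.2 hD⟩
      · refine mul_mem (ih.1 C h.1) (word_mem_kerDiv ?_)
        rw [count_colWord, count_colWord]
        simp only [h]
    refine ⟨key, fun D h1 h2 => ?_⟩
    have hsub : (Finset.powersetCard l (Finset.range n)).filter (Fits o · D) ⊆
        (Finset.powersetCard l (Finset.range n)).filter (Fits o · (swapCol i D)) :=
      Finset.monotone_filter_right _ fun C _ hC => fits_swapCol_right hC h1
    -- The extra columns C that fit next to D' but not next to D contain i+1 and not i, so the word
    -- C D is balanced.
    have hd : (chainSum o n (l :: s) (swapCol i D) - chainSum o n (l :: s) D) *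
        word n (colWord D) ∈ kerDiv n i := by
      rw [chainSum_cons, chainSum_cons, ← Finset.sum_sdiff hsub, add_sub_cancel_right,
        Finset.sum_mul]
      refine sum_mem fun C hC => ?_
      simp only [Finset.mem_sdiff, Finset.mem_filter, not_and] at hC
      have hC' := exceptional_of_not_fits hC.1.2 h1 (hC.2 hC.1.1)
      rw [mul_assoc, ← word_append]
      refine mul_mem (ih.1 C fun h => absurd h hC'.1) (word_mem_kerDiv ?_)
      rw [List.count_append, List.count_append, count_colWord, count_colWord, count_colWord,
        count_colWord]
      simp [h1, h2, hC'.1, hC'.2]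
    have hs : chainSum o n (l :: s) (swapCol i D) *
        (word n (colWord D) + word n (colWord (swapCol i D))) ∈ kerDiv n i :=
      mul_mem (key _ fun h => by
        rw [mem_swapCol_left] at h; exact absurd h h2) (word_colWord_add_swapCol h1 h2)
    -- With c the chain sums: c(D) x^D + c(D') x^D' = c(D') (x^D + x^D') - (c(D') - c(D)) x^D.
    convert sub_mem hs hd using 1
    noncomm_ring

theorem chainSum_mem_oddSymm (o : ℕ → ℤ) (s : List ℕ) {D : Finset ℕ}
    (hD : ∀ i, i + 1 < n → i ∈ D → i + 1 ∈ D) : chainSum o n s D ∈ oddSymm n := fun i hi =>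
  (chainSum_mem_kerDiv_aux o hi s).1 D (hD i hi) hi

/-! ### Cancellation -/

/-- The exponents of the variables in the word strictly decrease. -/
def StrictContent (n : ℕ) (v : List ℕ) : Prop := ∀ i, i + 1 < n → v.count (i + 1) < v.count i

/-- Every final part of a chain, followed by the word `v`, has strictly decreasing exponents. -/
def GoodChain (n : ℕ) (v : List ℕ) (L : List (Finset ℕ)) : Prop :=
  ∀ k, StrictContent n (chainWord (L.take k) ++ v)

theorem goodChain_nil {v : List ℕ} : GoodChain n v [] ↔ StrictContent n v := by
  simp [GoodChain, chainWord]

theorem goodChain_cons {v : List ℕ} {C : Finset ℕ} {L : List (Finset ℕ)} :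
    GoodChain n v (C :: L) ↔ StrictContent n v ∧ GoodChain n (colWord C ++ v) L := by
  constructor
  · intro h
    refine ⟨by simpa [chainWord] using h 0, fun k => ?_⟩
    simpa [chainWord] using h (k + 1)
  · rintro ⟨h1, h2⟩ k
    cases k with
    | zero => simpa [chainWord] using h1
    | succ k => simpa [chainWord] using h2 k

theorem GoodChain.strictContent {v : List ℕ} {L : List (Finset ℕ)} (h : GoodChain n v L) :
    StrictContent n v := by simpa [chainWord] using h 0

open Classical in
-- Columns are moved to the word one at a time from the right. A column that spoils strict decrease
-- makes its whole partial sum vanish under π, so no pairing of individual tableaux is needed.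
theorem straighten_chainSum_mul (o : ℕ → ℤ) (s : List ℕ) (D : Finset ℕ) {v : List ℕ}
    (hv : StrictContent n v) : straighten n (chainSum o n s D * word n v) =
      ∑ L ∈ (chains o n s D).filter (GoodChain n v), straighten n (word n (chainWord L ++ v)) := by
  induction s generalizing D v with
  | nil =>
    rw [Finset.sum_filter, sum_chains_nil, if_pos (goodChain_nil.2 hv), chainSum_nil, one_mul]
    rfl
  | cons l s ih =>
    rw [Finset.sum_filter, sum_chains_cons, chainSum_cons, Finset.sum_mul, map_sum]
    refine Finset.sum_congr rfl fun C _ => ?_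
    rw [mul_assoc, ← word_append]
    by_cases hC : StrictContent n (colWord C ++ v)
    · rw [ih C hC, Finset.sum_filter]
      refine Finset.sum_congr rfl fun L _ => ?_
      simp only [goodChain_cons, hv, true_and, chainWord, List.append_assoc]
    · rw [Finset.sum_eq_zero]
      · rw [StrictContent] at hC
        push Not at hC
        obtain ⟨i, hi, h⟩ := hC
        have h' := hv i hi
        rw [List.count_append, List.count_append, count_colWord, count_colWord] at h
        -- A column adds at most one to each exponent and v was strict, so failure at i forces i ∉
        -- C, i+1 ∈ C and equal exponents.
        have h1 : i ∉ C := fun h1 => by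
          rw [if_pos h1] at h
          split_ifs at h <;> omega
        have h2 : i + 1 ∈ C := by
          by_contra h2
          rw [if_neg h1, if_neg h2] at h
          omega
        refine straighten_eq_zero hi (mul_mem
          ((chainSum_mem_kerDiv_aux o hi s).1 C fun h => absurd h h1) (word_mem_kerDiv ?_))
        rw [List.count_append, List.count_append, count_colWord, count_colWord]
        rw [if_neg h1, if_pos h2] at h ⊢
        omega
      · intro L _
        rw [if_neg fun h => hC (goodChain_cons.1 h).2.strictContent]

end OPol

/-! ### Straight and rotated shapes -/

/-- The offsets of the columns of a straight shape, which are aligned at the top. -/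
def topAligned : ℕ → ℤ := fun _ => 0

/-- The offsets of the columns of a rotated shape, which are aligned at the bottom. -/
def bottomAligned : ℕ → ℤ := fun m => -m

theorem below_eq_card {n k : ℕ} {C : Finset ℕ} (h : C ⊆ Finset.range n) (hk : n ≤ k) :
    below C k = C.card := by
  rw [below, Finset.filter_true_of_mem]
  intro a ha
  have := Finset.mem_range.1 (h ha)
  omega

theorem range_subset_of_fits {d : ℕ} {C : Finset ℕ} (h : Fits topAligned C (Finset.range d)) :
    Finset.range d ⊆ C := by
  intro a ha
  rw [Finset.mem_range] at ha
  by_contra hC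
  have h1 := h (a + 1)
  have h3 : below C a ≤ a := by
    have : C.filter (· < a) ⊆ Finset.range a := fun b hb => by
      rw [Finset.mem_filter] at hb; exact Finset.mem_range.2 hb.2
    simpa [below] using Finset.card_le_card this
  simp only [topAligned, below_range, add_zero, Nat.cast_le] at h1
  rw [below_succ, if_neg hC] at h1
  omega

theorem subset_range_of_fits {d : ℕ} {C : Finset ℕ} (h : Fits bottomAligned C (Finset.range d)) :
    C ⊆ Finset.range d := by
  have h1 := h d
  simp only [bottomAligned, below_range, Finset.card_range, min_self] at h1
  have h2 : C.card ≤ (C.filter (· < d)).card := by rw [below] at h1; omega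
  intro a ha
  rw [← Finset.eq_of_subset_of_card_le (Finset.filter_subset _ _) h2, Finset.mem_filter] at ha
  exact Finset.mem_range.2 ha.2

theorem fits_range_top {l d : ℕ} (h : d ≤ l) :
    Fits topAligned (Finset.range l) (Finset.range d) := by
  intro k
  simp only [topAligned, below_range]
  omega

theorem fits_range_bottom {l d : ℕ} (h : l ≤ d) :
    Fits bottomAligned (Finset.range l) (Finset.range d) := by
  intro k
  simp only [bottomAligned, below_range, Finset.card_range]
  omega

namespace OPol

variable {n : ℕ}

theorem StrictContent.append_range {v : List ℕ} (hv : StrictContent n v) (l : ℕ) :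
    StrictContent n (colWord (Finset.range l) ++ v) := by
  intro i hi
  have := hv i hi
  rw [List.count_append, List.count_append, count_colWord, count_colWord]
  simp only [Finset.mem_range]
  split_ifs <;> omega

theorem goodChain_map_range {v : List ℕ} (hv : StrictContent n v) (s : List ℕ) :
    GoodChain n v (s.map Finset.range) := by
  induction s generalizing v with
  | nil => exact goodChain_nil.2 hv
  | cons l s ih => exact goodChain_cons.2 ⟨hv, ih (hv.append_range l)⟩

/-- Fitting forces C to contain 0, …, d-1. From d on the exponents drop by exactly one, so taking
j+1 without j would make two exponents equal. Hence C is an initial segment, and the unit gaps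
persist from |C| on. -/
theorem eq_map_range_of_top {s : List ℕ} {d : ℕ} {v : List ℕ} {L : List (Finset ℕ)}
    (hv : ∀ j, d ≤ j → j + 1 < n → v.count j = v.count (j + 1) + 1)
    (hL : L ∈ chains topAligned n s (Finset.range d)) (hg : GoodChain n v L) :
    L = s.map Finset.range := by
  rw [mem_chains] at hL
  obtain ⟨rfl, h1, h2⟩ := hL
  induction L generalizing d v with
  | nil => rfl
  | cons C L ih =>
    rw [List.isChain_cons_cons] at h2
    have hsub := range_subset_of_fits h2.1
    have hC := (goodChain_cons.1 hg).2
    have hC' := hC.strictContent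
    have key : C = Finset.range C.card := by
      refine eq_range_of_downClosed fun j hj => ?_
      by_contra hj'
      have h3 : d ≤ j := by
        by_contra h3; exact hj' (hsub (Finset.mem_range.2 (by omega)))
      have h4 : j + 1 < n := Finset.mem_range.1 (h1 C (by simp) hj)
      have := hC' j h4
      rw [List.count_append, List.count_append, count_colWord, count_colWord, if_pos hj,
        if_neg hj', hv j h3 h4] at this
      omega
    have hd : d ≤ C.card := by simpa using Finset.card_le_card hsub
    rw [List.map_cons, List.map_cons, ← key]
    rw [key] at h2 hC
    refine congrArg _ (ih (d := C.card) (v := colWord (Finset.range C.card) ++ v) ?_ hC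
      (fun D hD => h1 D (by simp [hD])) h2.2)
    intro j h3 h4
    have := hv j (by omega) h4
    rw [List.count_append, List.count_append, count_colWord, count_colWord]
    simp only [Finset.mem_range]
    split_ifs <;> omega

/-- The mirror image of the previous argument: bottom alignment confines C to 0, …, d-1, and the
unit gaps needed are those inside this range, which shrinks with each column. -/
theorem eq_map_range_of_bottom {s : List ℕ} {d : ℕ} {v : List ℕ} {L : List (Finset ℕ)}
    (hd : d ≤ n) (hv : ∀ j, j + 1 < d → v.count j = v.count (j + 1) + 1)
    (hL : L ∈ chains bottomAligned n s (Finset.range d)) (hg : GoodChain n v L) :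
    L = s.map Finset.range := by
  rw [mem_chains] at hL
  obtain ⟨rfl, h1, h2⟩ := hL
  induction L generalizing d v with
  | nil => rfl
  | cons C L ih =>
    rw [List.isChain_cons_cons] at h2
    have hsub := subset_range_of_fits h2.1
    have hC := (goodChain_cons.1 hg).2
    have hC' := hC.strictContent
    have key : C = Finset.range C.card := by
      refine eq_range_of_downClosed fun j hj => ?_
      by_contra hj'
      have h3 : j + 1 < d := Finset.mem_range.1 (hsub hj)
      have := hC' j (by omega)
      rw [List.count_append, List.count_append, count_colWord, count_colWord, if_pos hj,
        if_neg hj', hv j h3] at this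
      omega
    have hd' : C.card ≤ d := by simpa using Finset.card_le_card hsub
    rw [List.map_cons, List.map_cons, ← key]
    rw [key] at h2 hC
    refine congrArg _ (ih (d := C.card) (v := colWord (Finset.range C.card) ++ v) (by omega) ?_ hC
      (fun D hD => h1 D (by simp [hD])) h2.2)
    intro j h3
    have := hv j (by omega)
    rw [List.count_append, List.count_append, count_colWord, count_colWord]
    simp only [Finset.mem_range]
    split_ifs <;> omega

/-! ### Schur sums as straightened monomials -/

theorem strictContent_rhoWord : StrictContent n (rhoWord n) := by
  intro i hi
  rw [count_rhoWord, count_rhoWord]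
  omega

theorem straighten_mul_rho {g : OPol n} (hg : g ∈ oddSymm n) :
    straighten n (g * word n (rhoWord n)) = g := by
  rw [straighten_mul hg, straighten_rho, mul_one]

theorem chainSum_eq_of_unique {o : ℕ → ℤ} {s : List ℕ} {D : Finset ℕ} {L : List (Finset ℕ)}
    (hD : ∀ i, i + 1 < n → i ∈ D → i + 1 ∈ D) (hL : L ∈ chains o n s D)
    (hg : GoodChain n (rhoWord n) L)
    (hu : ∀ L' ∈ chains o n s D, GoodChain n (rhoWord n) L' → L' = L) :
    chainSum o n s D = straighten n (word n (chainWord L ++ rhoWord n)) := by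
  classical
  rw [← straighten_mul_rho (chainSum_mem_oddSymm o s hD),
    straighten_chainSum_mul o s D strictContent_rhoWord, Finset.sum_eq_single_of_mem L]
  · exact Finset.mem_filter.2 ⟨hL, hg⟩
  · intro L' hL' hne
    rw [Finset.mem_filter] at hL'
    exact absurd (hu L' hL'.1 hL'.2) hne

theorem map_range_mem_chains {o : ℕ → ℤ} {s : List ℕ} {d : ℕ} (hn : ∀ l ∈ s, l ≤ n)
    (hs : (d :: s).IsChain (fun d l => Fits o (Finset.range l) (Finset.range d))) :
    s.map Finset.range ∈ chains o n s (Finset.range d) := by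
  refine mem_chains.2 ⟨?_, ?_, ?_⟩
  · rw [List.map_map]
    conv_rhs => rw [← List.map_id s]
    exact List.map_congr_left fun a _ => by simp
  · intro C hC
    obtain ⟨l, hl, rfl⟩ := List.mem_map.1 hC
    exact Finset.range_subset_range.2 (hn l hl)
  · rw [← List.map_cons (f := Finset.range), List.isChain_map]
    exact hs

/-- The sum over the semistandard tableaux of a straight shape as a straightened monomial. -/
theorem chainSum_top {s : List ℕ} (hn : ∀ l ∈ s, l ≤ n) (hs : s.IsChain (· ≤ ·)) :
    chainSum topAligned n s ∅ =
      straighten n (word n (chainWord (s.map Finset.range) ++ rhoWord n)) := by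
  have h0 : (0 :: s).IsChain (· ≤ ·) := by
    cases s with
    | nil => simp
    | cons l s => rw [List.isChain_cons_cons]; exact ⟨Nat.zero_le _, hs⟩
  rw [← Finset.range_zero]
  refine chainSum_eq_of_unique (by simp) (map_range_mem_chains hn
    (h0.imp fun _ _ h => fits_range_top h)) (goodChain_map_range strictContent_rhoWord s) ?_
  intro L hL hg
  refine eq_map_range_of_top (fun j _ hj => ?_) hL hg
  rw [count_rhoWord, count_rhoWord]
  omega

/-- The sum over the semistandard tableaux of a rotated shape as a straightened monomial. -/
theorem chainSum_bottom {s : List ℕ} (hn : ∀ l ∈ s, l ≤ n) (hs : s.IsChain (· ≥ ·)) :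
    chainSum bottomAligned n s (Finset.range n) =
      straighten n (word n (chainWord (s.map Finset.range) ++ rhoWord n)) := by
  have h0 : (n :: s).IsChain (· ≥ ·) := by
    cases s with
    | nil => simp
    | cons l s => rw [List.isChain_cons_cons]; exact ⟨hn l (by simp), hs⟩
  refine chainSum_eq_of_unique (fun i hi _ => Finset.mem_range.2 hi) (map_range_mem_chains hn
    (h0.imp fun _ _ h => fits_range_bottom h)) (goodChain_map_range strictContent_rhoWord s) ?_
  intro L hL hg
  refine eq_map_range_of_bottom le_rfl (fun j hj => ?_) hL hg
  rw [count_rhoWord, count_rhoWord]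
  omega

/-! ### Reversal of words and of the alphabet -/

/-- The anti-automorphism of `OPol_n` that exchanges the signed variables `i` and `n - 1 - i`. -/
noncomputable def flip (n : ℕ) : OPol n →+* (OPol n)ᵐᵒᵖ :=
  lift (fun i => MulOpposite.op (((-1 : ℤ) ^ (i : ℕ)) • xt n (n - 1 - i))) (by
    intro i j hij
    have h : n - 1 - (i : ℕ) ≠ n - 1 - j := fun h => hij (Fin.ext (by omega))
    rw [← MulOpposite.op_mul, ← MulOpposite.op_mul, ← MulOpposite.op_add, smul_mul_smul_comm,
      smul_mul_smul_comm, xt_anticomm h, smul_neg, mul_comm ((-1 : ℤ) ^ (i : ℕ)), add_neg_cancel,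
      MulOpposite.op_zero])

theorem flip_xt {i : ℕ} (h : i < n) : flip n (xt n i) = MulOpposite.op (xt n (n - 1 - i)) := by
  rw [xt_of_lt h, map_zsmul, flip, lift_x, ← MulOpposite.op_smul, smul_smul, ← pow_add, ← two_mul,
    pow_mul]
  simp

theorem flip_word {w : List ℕ} (h : ∀ a ∈ w, a < n) :
    flip n (word n w) = MulOpposite.op (word n (w.map (n - 1 - ·)).reverse) := by
  induction w with
  | nil => simp
  | cons a w ih =>
    rw [word_cons, map_mul, ih fun b hb => h b (by simp [hb]), flip_xt (h a (by simp))]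
    simp

/-- The image of a column under the reversal of the alphabet. -/
def flipCol (n : ℕ) (C : Finset ℕ) : Finset ℕ := (Finset.range n).filter (n - 1 - · ∈ C)

theorem flipCol_subset (n : ℕ) (C : Finset ℕ) : flipCol n C ⊆ Finset.range n :=
  Finset.filter_subset _ _

theorem flipCol_flipCol {C : Finset ℕ} (h : C ⊆ Finset.range n) : flipCol n (flipCol n C) = C := by
  ext a
  simp only [flipCol, Finset.mem_filter, Finset.mem_range]
  constructor
  · rintro ⟨h1, -, h2⟩
    rwa [show n - 1 - (n - 1 - a) = a by omega] at h2
  · intro ha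
    have := Finset.mem_range.1 (h ha)
    exact ⟨this, by omega, by rwa [show n - 1 - (n - 1 - a) = a by omega]⟩

theorem flipCol_eq_image {C : Finset ℕ} (h : C ⊆ Finset.range n) :
    flipCol n C = C.image (n - 1 - ·) := by
  ext a
  simp only [flipCol, Finset.mem_filter, Finset.mem_range, Finset.mem_image]
  constructor
  · rintro ⟨h1, h2⟩
    exact ⟨_, h2, by omega⟩
  · rintro ⟨b, hb, rfl⟩
    have := Finset.mem_range.1 (h hb)
    exact ⟨by omega, by rwa [show n - 1 - (n - 1 - b) = b by omega]⟩

theorem injOn_flip : Set.InjOn (fun a : ℕ => n - 1 - a) (Finset.range n : Set ℕ) := by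
  intro a ha b hb h
  simp only [Finset.coe_range, Set.mem_Iio] at ha hb h
  omega

theorem card_flipCol {C : Finset ℕ} (h : C ⊆ Finset.range n) : (flipCol n C).card = C.card := by
  rw [flipCol_eq_image h, Finset.card_image_of_injOn (injOn_flip.mono (by exact_mod_cast h))]

theorem below_flipCol {C : Finset ℕ} (h : C ⊆ Finset.range n) {k : ℕ} (hk : k ≤ n) :
    below (flipCol n C) k + below C (n - k) = C.card := by
  have h1 : (flipCol n C).filter (· < k) = (C.filter fun a => ¬ a < n - k).image (n - 1 - ·) := by
    ext a
    simp only [flipCol_eq_image h, Finset.mem_filter, Finset.mem_image]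
    constructor
    · rintro ⟨⟨b, hb, rfl⟩, h2⟩
      have := Finset.mem_range.1 (h hb)
      exact ⟨b, ⟨hb, by omega⟩, rfl⟩
    · rintro ⟨b, ⟨hb, h2⟩, rfl⟩
      have := Finset.mem_range.1 (h hb)
      exact ⟨⟨b, hb, rfl⟩, by omega⟩
  rw [below, h1, Finset.card_image_of_injOn, below, add_comm,
    Finset.card_filter_add_card_filter_not]
  refine injOn_flip.mono ?_
  exact_mod_cast (Finset.filter_subset _ _).trans h

/-- A half turn: the entries below k after reversal are those that were at least n - k before.
Complementary counts exchange left with right and top alignment with bottom alignment. -/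
theorem fits_flipCol {C D : Finset ℕ} (hC : C ⊆ Finset.range n) (hD : D ⊆ Finset.range n)
    (h : Fits topAligned C D) : Fits bottomAligned (flipCol n D) (flipCol n C) := by
  intro k
  simp only [bottomAligned, card_flipCol hC, card_flipCol hD]
  rcases le_total k n with hk | hk
  · have h1 := below_flipCol hC hk
    have h2 := below_flipCol hD hk
    have h3 := h (n - k)
    simp only [topAligned] at h3
    omega
  · rw [below_eq_card (flipCol_subset n _) hk, below_eq_card (flipCol_subset n _) hk,
      card_flipCol hC, card_flipCol hD]
    omega

theorem fits_flipCol' {C D : Finset ℕ} (hC : C ⊆ Finset.range n) (hD : D ⊆ Finset.range n)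
    (h : Fits bottomAligned C D) : Fits topAligned (flipCol n D) (flipCol n C) := by
  intro k
  simp only [topAligned]
  rcases le_total k n with hk | hk
  · have h1 := below_flipCol hC hk
    have h2 := below_flipCol hD hk
    have h3 := h (n - k)
    simp only [bottomAligned] at h3
    omega
  · have h3 := h 0
    simp only [bottomAligned, below_zero] at h3
    rw [below_eq_card (flipCol_subset n _) hk, below_eq_card (flipCol_subset n _) hk,
      card_flipCol hC, card_flipCol hD]
    omega

theorem colWord_flipCol {C : Finset ℕ} (h : C ⊆ Finset.range n) :
    colWord (flipCol n C) = ((colWord C).map (n - 1 - ·)).reverse := by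
  have hn : ((colWord C).map (n - 1 - ·)).reverse.Nodup := by
    rw [List.nodup_reverse]
    refine List.Nodup.map_on (fun a ha b hb hab => ?_) (nodup_colWord C)
    have h1 := Finset.mem_range.1 (h (mem_colWord.1 ha))
    have h2 := Finset.mem_range.1 (h (mem_colWord.1 hb))
    omega
  have hs : flipCol n C = ((colWord C).map (n - 1 - ·)).reverse.toFinset := by
    ext a
    simp [flipCol_eq_image h, mem_colWord]
  rw [colWord, hs, List.toFinset_sort _ hn, List.pairwise_reverse, List.pairwise_map]
  refine (Finset.pairwise_sort C (· ≥ ·)).imp fun hab => ?_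
  simp only [ge_iff_le] at hab ⊢
  omega

/-- The reversal of a list of columns. -/
def flipChain (n : ℕ) (L : List (Finset ℕ)) : List (Finset ℕ) := (L.map (flipCol n)).reverse

theorem flipChain_flipChain {L : List (Finset ℕ)} (h : ∀ C ∈ L, C ⊆ Finset.range n) :
    flipChain n (flipChain n L) = L := by
  rw [flipChain, flipChain, List.map_reverse, List.reverse_reverse, List.map_map]
  conv_rhs => rw [← List.map_id L]
  exact List.map_congr_left fun C hC => flipCol_flipCol (h C hC)

theorem chainWord_append (L M : List (Finset ℕ)) :
    chainWord (L ++ M) = chainWord M ++ chainWord L := by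
  induction L with
  | nil => simp [chainWord]
  | cons C L ih => simp [chainWord, ih]

theorem chainWord_flipChain {L : List (Finset ℕ)} (h : ∀ C ∈ L, C ⊆ Finset.range n) :
    chainWord (flipChain n L) = ((chainWord L).map (n - 1 - ·)).reverse := by
  induction L with
  | nil => rfl
  | cons C L ih =>
    have := ih fun D hD => h D (by simp [hD])
    rw [flipChain] at this ⊢
    rw [List.map_cons, List.reverse_cons, chainWord_append, this]
    simp [chainWord, colWord_flipCol (h C (by simp))]

theorem fits_empty (o : ℕ → ℤ) (h : o = topAligned) (C : Finset ℕ) : Fits o C ∅ := by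
  subst h
  intro k
  simp [topAligned, below]

theorem fits_bottom_range {C : Finset ℕ} (h : C ⊆ Finset.range n) :
    Fits bottomAligned C (Finset.range n) := by
  intro k
  simp only [bottomAligned, below_range, Finset.card_range]
  rcases le_total k n with hk | hk
  · have h1 := below_flipCol h hk
    have h2 := below_flipCol h (Nat.sub_le n k)
    have h3 : below (flipCol n C) (n - k) ≤ n - k := by
      have : (flipCol n C).filter (· < n - k) ⊆ Finset.range (n - k) := fun b hb => by
        rw [Finset.mem_filter] at hb; exact Finset.mem_range.2 hb.2
      simpa [below] using Finset.card_le_card this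
    rw [show n - (n - k) = k by omega] at h2
    omega
  · rw [below_eq_card h hk]
    omega

theorem mem_chain_of_mem_chainWord {L : List (Finset ℕ)} {a : ℕ} (h : a ∈ chainWord L) :
    ∃ C ∈ L, a ∈ C := by
  induction L with
  | nil => simp [chainWord] at h
  | cons C L ih =>
    rw [chainWord, List.mem_append, mem_colWord] at h
    rcases h with h | h
    · obtain ⟨D, hD, ha⟩ := ih h
      exact ⟨D, by simp [hD], ha⟩
    · exact ⟨C, by simp, h⟩

theorem isChain_cons_of_forall {α : Type*} {R : α → α → Prop} {a : α} {l : List α}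
    (h : ∀ b ∈ l, R a b) : (a :: l).IsChain R ↔ l.IsChain R := by
  cases l with
  | nil => simp
  | cons b l => rw [List.isChain_cons_cons]; simp [h b (by simp)]

theorem isChain_of_forall_imp {α : Type*} {R S : α → α → Prop} {l : List α}
    (h : ∀ a ∈ l, ∀ b ∈ l, R a b → S a b) (hl : l.IsChain R) : l.IsChain S := by
  induction l with
  | nil => simp
  | cons a l ih =>
    cases l with
    | nil => simp
    | cons b l =>
      rw [List.isChain_cons_cons] at hl ⊢
      exact ⟨h a (by simp) b (by simp) hl.1,
        ih (fun c hc d hd => h c (by simp [hc]) d (by simp [hd])) hl.2⟩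

theorem flipChain_mem_bottom {s : List ℕ} {L : List (Finset ℕ)} (h : L ∈ chains topAligned n s ∅) :
    flipChain n L ∈ chains bottomAligned n s.reverse (Finset.range n) := by
  obtain ⟨rfl, h1, h2⟩ := mem_chains.1 h
  refine mem_chains.2 ⟨?_, ?_, ?_⟩
  · rw [flipChain, List.map_reverse, List.map_map]
    exact congrArg _ (List.map_congr_left fun C hC => card_flipCol (h1 C hC))
  · simp only [flipChain, List.mem_reverse, List.mem_map]
    rintro _ ⟨C, -, rfl⟩
    exact flipCol_subset n C
  · rw [isChain_cons_of_forall]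
    · rw [flipChain, List.isChain_reverse, List.isChain_map]
      exact isChain_of_forall_imp (fun D hD C hC h => fits_flipCol (h1 C hC) (h1 D hD) h) h2.tail
    · simp only [flipChain, List.mem_reverse, List.mem_map]
      rintro _ ⟨C, -, rfl⟩
      exact fits_bottom_range (flipCol_subset n C)

theorem flipChain_mem_top {s : List ℕ} {L : List (Finset ℕ)}
    (h : L ∈ chains bottomAligned n s.reverse (Finset.range n)) :
    flipChain n L ∈ chains topAligned n s ∅ := by
  obtain ⟨h0, h1, h2⟩ := mem_chains.1 h
  refine mem_chains.2 ⟨?_, ?_, ?_⟩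
  · rw [flipChain, List.map_reverse, List.map_map, ← s.reverse_reverse, ← h0]
    exact congrArg _ (List.map_congr_left fun C hC => card_flipCol (h1 C hC))
  · simp only [flipChain, List.mem_reverse, List.mem_map]
    rintro _ ⟨C, -, rfl⟩
    exact flipCol_subset n C
  · rw [isChain_cons_of_forall]
    · rw [flipChain, List.isChain_reverse, List.isChain_map]
      exact isChain_of_forall_imp (fun D hD C hC h => fits_flipCol' (h1 C hC) (h1 D hD) h) h2.tail
    · intro C _
      exact fits_empty _ rfl C

/-- The reversal carries straight shapes to rotated shapes. -/
theorem flip_chainSum (s : List ℕ) : flip n (chainSum topAligned n s ∅) =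
    MulOpposite.op (chainSum bottomAligned n s.reverse (Finset.range n)) := by
  rw [chainSum, map_sum, chainSum, Finset.op_sum]
  refine Finset.sum_nbij' (flipChain n) (flipChain n) (fun L hL => flipChain_mem_bottom hL)
    (fun L hL => flipChain_mem_top hL)
    (fun L hL => flipChain_flipChain (mem_chains.1 hL).2.1)
    (fun L hL => flipChain_flipChain (mem_chains.1 hL).2.1) (fun L hL => ?_)
  have h := (mem_chains.1 hL).2.1
  rw [chainWord_flipChain h, flip_word]
  intro a ha
  obtain ⟨C, hC, haC⟩ := mem_chain_of_mem_chainWord ha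
  exact Finset.mem_range.1 (h C hC haC)

end OPol

/-! ### Staircase functions -/

/-- The index of the step of the monotone function `G` that contains `c`. -/
noncomputable def stair (G : ℕ → ℕ) (c : ℕ) : ℕ := sInf {k | c < G (k + 1)}

/-- The hypothesis c < G M makes the set in `stair` nonempty, so the default value 0 of `sInf` never
intervenes. -/
theorem stair_lt_iff {G : ℕ → ℕ} (hG : Monotone G) (h0 : G 0 = 0) {c M : ℕ} (hc : c < G M) {k : ℕ} :
    stair G c < k ↔ c < G k := by
  constructor
  · intro h
    have hne : {k | c < G (k + 1)}.Nonempty := by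
      refine ⟨M - 1, ?_⟩
      cases M with
      | zero => omega
      | succ M => exact hc
    have h1 : c < G (stair G c + 1) := Nat.sInf_mem hne
    exact h1.trans_le (hG h)
  · intro h
    cases k with
    | zero => omega
    | succ k => exact Nat.lt_succ_of_le (Nat.sInf_le h)

/-! ### Inversions of words spelled by lists of cells -/

/-- With the reading order encoded in r, inversions become a count over the set of cells, and
different reading orders can be compared. -/
theorem inversions_map {α : Type*} [DecidableEq α] (r : α → α → Prop) [DecidableRel r]
    (hr : ∀ p q, r p q → ¬ r q p) (f : α → ℕ) (L : List α) (hL : L.Pairwise r) :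
    inversions (L.map f) =
      ∑ p ∈ L.toFinset, (L.toFinset.filter fun q => r p q ∧ f q < f p).card := by
  induction L with
  | nil => rfl
  | cons a L ih =>
    rw [List.pairwise_cons] at hL
    have hirr : ∀ p, ¬ r p p := fun p h => hr p p h h
    have ha : a ∉ L.toFinset := fun h => hirr a (hL.1 a (List.mem_toFinset.1 h))
    have hnd : L.Nodup := hL.2.imp fun {p q} h (e : p = q) => hirr q (by rwa [e] at h)
    rw [List.map_cons, inversions, ih hL.2, List.toFinset_cons, Finset.sum_insert ha]
    congr 1
    · rw [List.countP_map, Finset.filter_insert, if_neg (fun h => hirr a h.1),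
        List.countP_eq_length_filter, ← List.toFinset_card_of_nodup (hnd.filter _),
        List.toFinset_filter]
      congr 1
      refine Finset.filter_congr fun q hq => ?_
      simp [hL.1 q (List.mem_toFinset.1 hq)]
    · refine Finset.sum_congr rfl fun p hp => ?_
      rw [Finset.filter_insert, if_neg fun h => hr _ _ h.1 (hL.1 p (List.mem_toFinset.1 hp))]

theorem inversions_append (v w : List ℕ) : inversions (v ++ w) =
    inversions v + inversions w + (v.map fun a => w.countP (· < a)).sum := by
  induction v with
  | nil => simp [inversions]
  | cons a v ih =>
    rw [List.cons_append, inversions, inversions, ih, List.countP_append, List.map_cons,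
      List.sum_cons]
    ring

/-! ### Cells in reading order -/

/-- The cells in the order of the row reading: left to right, from the bottom row to the top. -/
def rowCells (lam : YoungDiagram) : List (ℕ × ℕ) :=
  (List.range (lam.colLen 0)).reverse.flatMap fun i =>
    (List.range (lam.rowLen i)).map fun j => (i, j)

/-- The cells in the order of the column reading: bottom to top, from left to right. -/
def colCells (lam : YoungDiagram) : List (ℕ × ℕ) :=
  (List.range (lam.rowLen 0)).flatMap fun j =>
    (List.range (lam.colLen j)).reverse.map fun i => (i, j)

/-- The cells in the order of the columns from right to left, each from bottom to top. -/
def revColCells (lam : YoungDiagram) : List (ℕ × ℕ) :=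
  (List.range (lam.rowLen 0)).reverse.flatMap fun j =>
    (List.range (lam.colLen j)).reverse.map fun i => (i, j)

theorem YoungDiagram.lt_rowLen_zero {lam : YoungDiagram} {i j : ℕ} (h : (i, j) ∈ lam) :
    j < lam.rowLen 0 :=
  YoungDiagram.mem_iff_lt_rowLen.1 (lam.up_left_mem (Nat.zero_le i) le_rfl h)

theorem YoungDiagram.lt_colLen_zero {lam : YoungDiagram} {i j : ℕ} (h : (i, j) ∈ lam) :
    i < lam.colLen 0 :=
  YoungDiagram.mem_iff_lt_colLen.1 (lam.up_left_mem le_rfl (Nat.zero_le j) h)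

section

variable (lam : YoungDiagram)

theorem toFinset_rowCells : (rowCells lam).toFinset = lam.cells := by
  ext ⟨i, j⟩
  simp only [rowCells, List.mem_toFinset, List.mem_flatMap, List.mem_reverse, List.mem_range,
    List.mem_map, Prod.mk.injEq, YoungDiagram.mem_cells]
  constructor
  · rintro ⟨i, -, j, hj, rfl, rfl⟩
    exact YoungDiagram.mem_iff_lt_rowLen.2 hj
  · intro h
    exact ⟨i, YoungDiagram.lt_colLen_zero h, j, YoungDiagram.mem_iff_lt_rowLen.1 h, rfl, rfl⟩

theorem toFinset_colCells : (colCells lam).toFinset = lam.cells := by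
  ext ⟨i, j⟩
  simp only [colCells, List.mem_toFinset, List.mem_flatMap, List.mem_reverse, List.mem_range,
    List.mem_map, Prod.mk.injEq, YoungDiagram.mem_cells]
  constructor
  · rintro ⟨j, -, i, hi, rfl, rfl⟩
    exact YoungDiagram.mem_iff_lt_colLen.2 hi
  · intro h
    exact ⟨j, YoungDiagram.lt_rowLen_zero h, i, YoungDiagram.mem_iff_lt_colLen.1 h, rfl, rfl⟩

theorem toFinset_revColCells : (revColCells lam).toFinset = lam.cells := by
  rw [← toFinset_colCells]
  ext c
  simp [revColCells, colCells]

theorem pairwise_rowCells :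
    (rowCells lam).Pairwise fun p q => q.1 < p.1 ∨ q.1 = p.1 ∧ p.2 < q.2 := by
  rw [rowCells, List.pairwise_flatMap]
  refine ⟨fun i _ => ?_, ?_⟩
  · rw [List.pairwise_map]
    exact List.pairwise_lt_range.imp fun h => Or.inr ⟨rfl, h⟩
  · rw [List.pairwise_reverse]
    refine List.pairwise_lt_range.imp fun h => ?_
    simp only [List.mem_map]
    rintro _ ⟨_, -, rfl⟩ _ ⟨_, -, rfl⟩
    exact Or.inl h

theorem pairwise_colCells :
    (colCells lam).Pairwise fun p q => p.2 < q.2 ∨ p.2 = q.2 ∧ q.1 < p.1 := by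
  rw [colCells, List.pairwise_flatMap]
  refine ⟨fun i _ => ?_, ?_⟩
  · rw [List.pairwise_map, List.pairwise_reverse]
    exact List.pairwise_lt_range.imp fun h => Or.inr ⟨rfl, h⟩
  · refine List.pairwise_lt_range.imp fun h => ?_
    simp only [List.mem_map]
    rintro _ ⟨_, -, rfl⟩ _ ⟨_, -, rfl⟩
    exact Or.inl h

theorem pairwise_revColCells :
    (revColCells lam).Pairwise fun p q => q.2 < p.2 ∨ p.2 = q.2 ∧ q.1 < p.1 := by
  rw [revColCells, List.pairwise_flatMap]
  refine ⟨fun i _ => ?_, ?_⟩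
  · rw [List.pairwise_map, List.pairwise_reverse]
    exact List.pairwise_lt_range.imp fun h => Or.inr ⟨rfl, h⟩
  · rw [List.pairwise_reverse]
    refine List.pairwise_lt_range.imp fun h => ?_
    simp only [List.mem_map]
    rintro _ ⟨_, -, rfl⟩ _ ⟨_, -, rfl⟩
    exact Or.inl h

theorem nodup_rowCells : (rowCells lam).Nodup :=
  (pairwise_rowCells lam).imp fun {p q} h e => by subst e; omega

theorem nodup_colCells : (colCells lam).Nodup :=
  (pairwise_colCells lam).imp fun {p q} h e => by subst e; omega

theorem nodup_revColCells : (revColCells lam).Nodup :=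
  (pairwise_revColCells lam).imp fun {p q} h e => by subst e; omega

theorem rowCells_perm_colCells : (rowCells lam).Perm (colCells lam) :=
  (List.perm_ext_iff_of_nodup (nodup_rowCells lam) (nodup_colCells lam)).2 fun c => by
    rw [← List.mem_toFinset, ← List.mem_toFinset, toFinset_rowCells, toFinset_colCells]

theorem revColCells_perm_colCells : (revColCells lam).Perm (colCells lam) :=
  (List.perm_ext_iff_of_nodup (nodup_revColCells lam) (nodup_colCells lam)).2 fun c => by
    rw [← List.mem_toFinset, ← List.mem_toFinset, toFinset_revColCells, toFinset_colCells]

theorem mem_rowCells {c : ℕ × ℕ} : c ∈ rowCells lam ↔ c ∈ lam := by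
  rw [← List.mem_toFinset, toFinset_rowCells, YoungDiagram.mem_cells]

theorem rowWord_bot (T : ℕ → ℕ → ℕ) :
    rowWord lam ⊥ T = (rowCells lam).map fun c => T c.1 c.2 := by
  simp [rowWord, rowCells, List.map_flatMap, Function.comp_def]

/-- The number of pairs of cells one of which is strictly above and strictly left of the other. -/
def boxNW : ℕ := ∑ c ∈ lam.cells, (lam.cells.filter fun d => d.1 < c.1 ∧ d.2 < c.2).card

/-- Inversions of the row reading word. -/
theorem inversions_rowCells {T : ℕ → ℕ → ℕ}
    (hT : ∀ {i j₁ j₂ : ℕ}, j₁ < j₂ → (i, j₂) ∈ lam → T i j₁ ≤ T i j₂) :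
    inversions ((rowCells lam).map fun c => T c.1 c.2) = boxNLess lam T := by
  rw [inversions_map _ (by intros; omega) _ _ (pairwise_rowCells lam), toFinset_rowCells, boxNLess]
  refine Finset.sum_congr rfl fun c _ => congrArg _ (Finset.filter_congr fun d hd => ?_)
  rw [YoungDiagram.mem_cells] at hd
  constructor
  · rintro ⟨h1 | ⟨h1, h2⟩, h3⟩
    · exact ⟨h1, h3⟩
    · have h4 := hT (i := d.1) h2 hd
      rw [h1] at h4 h3
      omega
  · rintro ⟨h1, h2⟩
    exact ⟨Or.inl h1, h2⟩

/-- Inversions of the column reading word. -/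
theorem inversions_colCells (T : SemistandardYoungTableau lam) :
    inversions ((colCells lam).map fun c => T c.1 c.2) + boxNW lam = boxNLess lam (T · ·) := by
  rw [inversions_map _ (by intros; omega) _ _ (pairwise_colCells lam), toFinset_colCells, boxNLess,
    boxNW, ← Finset.sum_add_distrib]
  refine Finset.sum_congr rfl fun c hc => ?_
  -- The pairs counted by N^< are split by whether d lies weakly right of c, which makes a column
  -- inversion, or strictly left. In the second case the entry at d is automatically smaller, so
  -- this part depends on the shape alone.
  rw [← Finset.card_union_of_disjoint, ← Finset.filter_or]
  · refine congrArg _ (Finset.filter_congr fun d hd => ?_)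
    rw [YoungDiagram.mem_cells] at hc hd
    have lt_of : ∀ p q : ℕ × ℕ, q ∈ lam → p.1 < q.1 → p.2 ≤ q.2 → T p.1 p.2 < T q.1 q.2 :=
      fun p q hq h1 h2 => (T.row_weak_of_le h2 (lam.up_left_mem h1.le le_rfl hq)).trans_lt
        (T.col_strict h1 hq)
    have le_of : ∀ p q : ℕ × ℕ, q ∈ lam → p.1 = q.1 → p.2 ≤ q.2 → T p.1 p.2 ≤ T q.1 q.2 :=
      fun p q hq h1 h2 => by rw [h1]; exact T.row_weak_of_le h2 hq
    constructor
    · rintro (⟨h1 | h1, h2⟩ | ⟨h1, h2⟩)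
      · refine ⟨?_, h2⟩
        by_contra h3
        rcases lt_or_eq_of_le (not_lt.1 h3) with h4 | h4
        · have := lt_of c d hd h4 h1.le; omega
        · have := le_of c d hd h4 h1.le; omega
      · exact ⟨h1.2, h2⟩
      · exact ⟨h1, lt_of d c hc h1 h2.le⟩
    · rintro ⟨h1, h2⟩
      rcases lt_trichotomy c.2 d.2 with h3 | h3 | h3
      · exact Or.inl ⟨Or.inl h3, h2⟩
      · exact Or.inl ⟨Or.inr ⟨h3, h1⟩, h2⟩
      · exact Or.inr ⟨h1, h3⟩
  · rw [Finset.disjoint_filter]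
    rintro d - ⟨h1, -⟩ ⟨h2, h3⟩
    omega

theorem inversions_rowCells_fst :
    inversions ((rowCells lam).map Prod.fst) = boxN lam := by
  rw [inversions_rowCells lam (T := fun i _ => i) (fun _ _ => le_rfl)]
  simp [boxNLess, boxN]

/-- A box d above c is an inversion of the first word if it lies weakly to the right, and of the
second if weakly to the left. Every such pair is counted once, those in the same column twice. -/
theorem inversions_colCells_add_revColCells :
    inversions ((colCells lam).map Prod.fst) + inversions ((revColCells lam).map Prod.fst) =
      boxdN lam + boxN lam := by
  rw [inversions_map _ (by intros; omega) _ _ (pairwise_colCells lam), toFinset_colCells,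
    inversions_map _ (by intros; omega) _ _ (pairwise_revColCells lam), toFinset_revColCells,
    boxdN, boxN, ← Finset.sum_add_distrib, ← Finset.sum_add_distrib]
  refine Finset.sum_congr rfl fun c _ => ?_
  rw [← Finset.card_union_add_card_inter, ← Finset.filter_or, ← Finset.filter_and, add_comm]
  congr 2
  · refine Finset.filter_congr fun d _ => ?_
    omega
  · refine Finset.filter_congr fun d _ => ?_
    omega

end

/-! ### Tableaux as chains of columns -/

/-- The columns of a filling, from right to left. -/
def colList (lam : YoungDiagram) (T : ℕ → ℕ → ℕ) : List (Finset ℕ) :=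
  (List.range (lam.rowLen 0)).reverse.map fun j => (Finset.range (lam.colLen j)).image (T · j)

/-- The lengths of the columns, from right to left. -/
def colSizes (lam : YoungDiagram) : List ℕ := (List.range (lam.rowLen 0)).reverse.map lam.colLen

theorem monotone_below (C : Finset ℕ) : Monotone (below C) := fun _ _ h => below_mono C h

theorem colWord_image {l : ℕ} {f : ℕ → ℕ} (hf : ∀ i j, i < j → j < l → f i < f j) :
    colWord ((Finset.range l).image f) = (List.range l).reverse.map f := by
  have hp : ((List.range l).reverse.map f).Pairwise (· > ·) := by
    rw [List.pairwise_map, List.pairwise_reverse]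
    refine List.pairwise_lt_range.imp_of_mem fun {a b} _ hb h => hf a b h (List.mem_range.1 hb)
  have hs : (Finset.range l).image f = ((List.range l).reverse.map f).toFinset := by
    ext a; simp
  rw [colWord, hs, List.toFinset_sort _ (hp.imp fun h => ne_of_gt h)]
  exact hp.imp fun h => le_of_lt h

theorem chainWord_map (L : List ℕ) (f : ℕ → Finset ℕ) :
    chainWord (L.map f) = L.reverse.flatMap fun j => colWord (f j) := by
  induction L with
  | nil => rfl
  | cons a L ih => rw [List.map_cons, chainWord, ih]; simp

theorem flatMap_congr_left {α β : Type*} {L : List α} {f g : α → List β} (h : ∀ a ∈ L, f a = g a) :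
    L.flatMap f = L.flatMap g := by
  rw [List.flatMap_def, List.flatMap_def, List.map_congr_left h]

theorem chainWord_colList {lam : YoungDiagram} {T : ℕ → ℕ → ℕ}
    (hT : ∀ {i₁ i₂ j : ℕ}, i₁ < i₂ → (i₂, j) ∈ lam → T i₁ j < T i₂ j) :
    chainWord (colList lam T) = (colCells lam).map fun c => T c.1 c.2 := by
  rw [colList, chainWord_map, List.reverse_reverse, colCells, List.map_flatMap]
  refine flatMap_congr_left fun j _ => ?_
  rw [colWord_image fun a b h hb => hT h (YoungDiagram.mem_iff_lt_colLen.2 hb), List.map_map]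
  rfl

theorem chainWord_colSizes_range (lam : YoungDiagram) :
    chainWord ((colSizes lam).map Finset.range) = (colCells lam).map Prod.fst := by
  have := chainWord_colList (lam := lam) (T := fun i _ => i) (fun h _ => h)
  rw [← this, colList, colSizes, List.map_map]
  simp [Function.comp_def]

theorem chainWord_colSizes_reverse_range (lam : YoungDiagram) :
    chainWord ((colSizes lam).reverse.map Finset.range) = (revColCells lam).map Prod.fst := by
  rw [colSizes, ← List.map_reverse, List.reverse_reverse, List.map_map, chainWord_map, revColCells,
    List.map_flatMap]
  refine flatMap_congr_left fun j _ => ?_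
  have := colWord_image (l := lam.colLen j) (f := id) (fun _ _ h _ => h)
  rw [Finset.image_id] at this
  simp [this, Function.comp_def]

theorem isChain_colSizes (lam : YoungDiagram) : (colSizes lam).IsChain (· ≤ ·) := by
  rw [colSizes, List.isChain_map, List.isChain_reverse, List.isChain_range]
  intro m _
  exact lam.colLen_anti _ _ (by omega)

theorem below_image {l : ℕ} {f : ℕ → ℕ} (hf : ∀ i j, i < j → j < l → f i < f j) (k : ℕ) :
    below ((Finset.range l).image f) k = ((Finset.range l).filter (f · < k)).card := by
  rw [below, Finset.filter_image, Finset.card_image_of_injOn]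
  intro a ha b hb hab
  rw [Finset.mem_coe, Finset.mem_filter, Finset.mem_range] at ha hb
  rcases lt_trichotomy a b with h | h | h
  · have := hf a b h hb.1; omega
  · exact h
  · have := hf b a h ha.1; omega

theorem card_image_of_strict {l : ℕ} {f : ℕ → ℕ} (hf : ∀ i j, i < j → j < l → f i < f j) :
    ((Finset.range l).image f).card = l := by
  rw [← length_colWord, colWord_image hf]
  simp

theorem stair_below_image {l : ℕ} {f : ℕ → ℕ} (hf : ∀ i j, i < j → j < l → f i < f j) {i : ℕ}
    (hi : i < l) : stair (below ((Finset.range l).image f)) i = f i := by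
  have h1 : below ((Finset.range l).image f) (f i) = i := by
    rw [below_image hf]
    have : (Finset.range l).filter (f · < f i) = Finset.range i := by
      ext a
      simp only [Finset.mem_filter, Finset.mem_range]
      constructor
      · rintro ⟨ha, h⟩
        by_contra hai
        rcases eq_or_lt_of_le (not_lt.1 hai) with h' | h'
        · subst h'; omega
        · have := hf i a h' ha; omega
      · intro ha
        exact ⟨by omega, hf a i ha hi⟩
    rw [this, Finset.card_range]
  have h2 : i < below ((Finset.range l).image f) (f i + 1) := by
    rw [below_succ, h1, if_pos (Finset.mem_image.2 ⟨i, Finset.mem_range.2 hi, rfl⟩)]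
    omega
  have h3 := fun k => stair_lt_iff (monotone_below _) (below_zero _) h2 (k := k)
  have h4 := (h3 (f i + 1)).2 h2
  have h5 := mt (h3 (f i)).1 (by omega)
  omega

theorem image_stair_below (C : Finset ℕ) :
    (Finset.range C.card).image (stair (below C)) = C := by
  have hM : below C (C.sup id + 1) = C.card := by
    refine below_eq_card (n := C.sup id + 1) (fun a ha => ?_) le_rfl
    rw [Finset.mem_range]
    exact Nat.lt_succ_of_le (Finset.le_sup (f := id) ha)
  refine Finset.Subset.antisymm ?_ ?_
  · intro a ha
    obtain ⟨i, hi, rfl⟩ := Finset.mem_image.1 ha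
    rw [Finset.mem_range, ← hM] at hi
    have h3 := fun k => stair_lt_iff (monotone_below C) (below_zero _) hi (k := k)
    have h4 := (h3 (stair (below C) i + 1)).1 (by omega)
    have h5 := mt (h3 (stair (below C) i)).2 (by omega)
    rw [below_succ] at h4
    by_contra hC
    rw [if_neg hC] at h4
    omega
  · intro a ha
    have h1 : below C a < below C (a + 1) := by rw [below_succ, if_pos ha]; omega
    have h3 := fun k => stair_lt_iff (monotone_below C) (below_zero _) h1 (k := k)
    refine Finset.mem_image.2 ⟨below C a, ?_, ?_⟩
    · rw [Finset.mem_range, ← hM]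
      exact h1.trans_le (below_mono C (Nat.succ_le_succ (Finset.le_sup (f := id) ha)))
    · have h4 := (h3 (a + 1)).2 h1
      have h5 := mt (h3 a).1 (by omega)
      omega

theorem stair_below_strict (C : Finset ℕ) {i j : ℕ} (hij : i < j) (hj : j < C.card) :
    stair (below C) i < stair (below C) j := by
  have hM : below C (C.sup id + 1) = C.card := by
    refine below_eq_card (n := C.sup id + 1) (fun a ha => ?_) le_rfl
    rw [Finset.mem_range]
    exact Nat.lt_succ_of_le (Finset.le_sup (f := id) ha)
  rw [← hM] at hj
  have h3 := fun k => stair_lt_iff (monotone_below C) (below_zero _) hj (k := k)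
  have h4 := (h3 (stair (below C) j + 1)).1 (by omega)
  rw [below_succ] at h4
  rw [stair_lt_iff (monotone_below C) (below_zero _) (hij.trans hj)]
  split_ifs at h4 <;> omega

theorem stair_below_mono {C D : Finset ℕ} (h : Fits topAligned C D) {i : ℕ} (hi : i < D.card) :
    stair (below C) i ≤ stair (below D) i := by
  have hM : below D (D.sup id + 1) = D.card := by
    refine below_eq_card (n := D.sup id + 1) (fun a ha => ?_) le_rfl
    rw [Finset.mem_range]
    exact Nat.lt_succ_of_le (Finset.le_sup (f := id) ha)
  rw [← hM] at hi
  have h3 := fun k => stair_lt_iff (monotone_below D) (below_zero _) hi (k := k)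
  have h4 := (h3 (stair (below D) i + 1)).1 (by omega)
  have h5 := h (stair (below D) i + 1)
  simp only [topAligned] at h5
  have h6 : i < below C (stair (below D) i + 1) := by omega
  have := (stair_lt_iff (monotone_below C) (below_zero _) h6).2 h6
  omega

theorem Fits.trans_top {C D E : Finset ℕ} (h1 : Fits topAligned C D) (h2 : Fits topAligned D E) :
    Fits topAligned C E := fun k => by
  have := h1 k
  have := h2 k
  simp only [topAligned] at *
  omega

theorem colList_mem_chains {lam : YoungDiagram} {n : ℕ} (T : BoundedSSYT lam n) :
    colList lam (T.1 · ·) ∈ chains topAligned n (colSizes lam) ∅ := by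
  have hs : ∀ j, ∀ a b, a < b → b < lam.colLen j → T.1 a j < T.1 b j := fun j a b h hb =>
    T.1.col_strict h (YoungDiagram.mem_iff_lt_colLen.2 hb)
  refine mem_chains.2 ⟨?_, ?_, ?_⟩
  · rw [colList, colSizes, List.map_map]
    exact List.map_congr_left fun j _ => card_image_of_strict (hs j)
  · simp only [colList, List.mem_map]
    rintro _ ⟨j, -, rfl⟩ a ha
    obtain ⟨i, hi, rfl⟩ := Finset.mem_image.1 ha
    exact Finset.mem_range.2
      (T.2 i j (YoungDiagram.mem_iff_lt_colLen.2 (Finset.mem_range.1 hi)))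
  · rw [OPol.isChain_cons_of_forall fun C _ => OPol.fits_empty _ rfl C, colList, List.isChain_map,
      List.isChain_reverse, List.isChain_range]
    intro j _ k
    simp only [topAligned, add_zero, Nat.cast_le, below_image (hs _)]
    refine Finset.card_le_card fun i hi => ?_
    simp only [Finset.mem_filter, Finset.mem_range] at hi ⊢
    have hm : (i, j + 1) ∈ lam := YoungDiagram.mem_iff_lt_colLen.2 hi.1
    exact ⟨hi.1.trans_le (lam.colLen_anti _ _ (by omega)),
      (T.1.row_weak (Nat.lt_succ_self j) hm).trans_lt hi.2⟩

theorem colList_injective {lam : YoungDiagram} {n : ℕ} {T T' : BoundedSSYT lam n}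
    (h : colList lam (T.1 · ·) = colList lam (T'.1 · ·)) : T = T' := by
  apply Subtype.ext
  ext i j
  by_cases hc : (i, j) ∈ lam
  · rw [colList, colList, List.map_inj_left] at h
    have h' := h j (by simpa using YoungDiagram.lt_rowLen_zero hc)
    have hi := YoungDiagram.mem_iff_lt_colLen.1 hc
    rw [← stair_below_image (f := (T.1 · j)) (fun a b hab hb => T.1.col_strict hab
        (YoungDiagram.mem_iff_lt_colLen.2 hb)) hi, h',
      ← stair_below_image (f := (T'.1 · j)) (fun a b hab hb => T'.1.col_strict hab
        (YoungDiagram.mem_iff_lt_colLen.2 hb)) hi]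
  · rw [T.1.zeros hc, T'.1.zeros hc]

theorem exists_colList_eq {lam : YoungDiagram} {n : ℕ} {L : List (Finset ℕ)}
    (hL : L ∈ chains topAligned n (colSizes lam) ∅) :
    ∃ T : BoundedSSYT lam n, colList lam (T.1 · ·) = L := by
  obtain ⟨h1, h2, h3⟩ := mem_chains.1 hL
  obtain ⟨C, rfl⟩ : ∃ C : ℕ → Finset ℕ, L = (List.range (lam.rowLen 0)).reverse.map C := by
    have hlen : L.length = lam.rowLen 0 := by simpa [colSizes] using congrArg List.length h1
    refine ⟨fun j => L.reverse.getD j ∅, ?_⟩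
    rw [← List.reverse_inj, ← List.map_reverse, List.reverse_reverse]
    refine List.ext_getElem (by simp [hlen]) fun i hi _ => ?_
    simp [List.getD_eq_getElem?_getD, List.getElem?_eq_getElem hi]
  rw [List.map_map, colSizes, List.map_inj_left] at h1
  rw [OPol.isChain_cons_of_forall fun C _ => OPol.fits_empty _ rfl C, List.isChain_map, List.isChain_reverse,
    List.isChain_range] at h3
  have hcard : ∀ {i j}, (i, j) ∈ lam → i < (C j).card := fun {i j} h => by
    have := h1 j (by simpa using YoungDiagram.lt_rowLen_zero h)
    simp only [Function.comp_apply] at this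
    rw [this]
    exact YoungDiagram.mem_iff_lt_colLen.1 h
  -- The chain condition only speaks of neighbouring columns, while rows must increase between any
  -- two; for top alignment `Fits` is transitive.
  have hfit : ∀ j₁ j₂, j₁ < j₂ → j₂ < lam.rowLen 0 → Fits topAligned (C j₁) (C j₂) := by
    intro j₁ j₂ h hj
    induction j₂, h using Nat.le_induction with
    | base => exact h3 j₁ (by omega)
    | succ j hj' ih => exact (ih (by omega)).trans_top (h3 j (by omega))
  refine ⟨⟨⟨fun i j => if (i, j) ∈ lam then stair (below (C j)) i else 0, ?_, ?_, ?_⟩, ?_⟩, ?_⟩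
  · intro i j₁ j₂ h hm
    rw [if_pos hm, if_pos (lam.up_left_mem le_rfl h.le hm)]
    exact stair_below_mono (hfit _ _ h (YoungDiagram.lt_rowLen_zero hm)) (hcard hm)
  · intro i₁ i₂ j h hm
    rw [if_pos hm, if_pos (lam.up_left_mem h.le le_rfl hm)]
    exact stair_below_strict _ h (hcard hm)
  · intro i j h
    rw [if_neg h]
  · intro i j hm
    change (if (i, j) ∈ lam then stair (below (C j)) i else 0) < n
    rw [if_pos hm]
    have : stair (below (C j)) i ∈ C j := by
      have := Finset.mem_image_of_mem (stair (below (C j))) (Finset.mem_range.2 (hcard hm))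
      rwa [image_stair_below] at this
    refine Finset.mem_range.1 (h2 (C j) ?_ this)
    exact List.mem_map.2 ⟨j, by simpa using YoungDiagram.lt_rowLen_zero hm, rfl⟩
  · refine List.map_congr_left fun j hj => ?_
    have hj' := h1 j hj
    simp only [Function.comp_apply] at hj'
    refine Eq.trans ?_ (image_stair_below (C j))
    rw [hj']
    refine Finset.image_congr fun i hi => ?_
    exact if_pos (YoungDiagram.mem_iff_lt_colLen.2 (by simpa using hi))

/-- Sums over tableaux are sums over chains of columns. -/
theorem sum_boundedSSYT {M : Type*} [AddCommMonoid M] (lam : YoungDiagram) (n : ℕ)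
    (f : List (Finset ℕ) → M) : ∑ T : BoundedSSYT lam n, f (colList lam (T.1 · ·)) =
      ∑ L ∈ chains topAligned n (colSizes lam) ∅, f L := by
  refine Finset.sum_bij (fun T _ => colList lam (T.1 · ·)) (fun T _ => colList_mem_chains T)
    (fun T _ T' _ h => colList_injective h) (fun L hL => ?_) (fun T _ => rfl)
  obtain ⟨T, hT⟩ := exists_colList_eq hL
  exact ⟨T, Finset.mem_univ T, hT⟩

/-! ### Young diagrams with given row lengths -/

/-- The diagram with at most `N` rows of lengths `f 0, f 1, …`, if these decrease weakly. -/
def YoungDiagram.ofRows (N : ℕ) (f : ℕ → ℕ) : YoungDiagram where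
  cells := (Finset.range N ×ˢ Finset.range (f 0)).filter fun c => ∀ i ≤ c.1, c.2 < f i
  isLowerSet := by
    rintro ⟨i, j⟩ ⟨i', j'⟩ ⟨h1, h2⟩ h
    simp only [Finset.coe_filter, Finset.mem_product, Finset.mem_range, Set.mem_ofPred_eq] at h1 h2 h ⊢
    exact ⟨⟨by omega, by omega⟩, fun k hk => lt_of_le_of_lt h2 (h.2 k (by omega))⟩

theorem YoungDiagram.rowLen_ofRows {N : ℕ} {f : ℕ → ℕ} (hf : ∀ i, i + 1 < N → f (i + 1) ≤ f i)
    (h0 : ∀ i, N ≤ i → f i = 0) (i : ℕ) : (YoungDiagram.ofRows N f).rowLen i = f i := by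
  have key : ∀ j, j < (YoungDiagram.ofRows N f).rowLen i ↔ j < f i := by
    intro j
    rw [← YoungDiagram.mem_iff_lt_rowLen, ← YoungDiagram.mem_cells]
    simp only [YoungDiagram.ofRows, Finset.mem_filter, Finset.mem_product, Finset.mem_range]
    constructor
    · exact fun h => h.2 i le_rfl
    · intro h
      have hi : i < N := by
        by_contra hi
        rw [h0 i (by omega)] at h
        omega
      have hmono : ∀ k ≤ i, f i ≤ f k := by
        intro k hk
        induction i, hk using Nat.le_induction with
        | base => exact le_rfl
        | succ i hk ih =>
          exact (hf i hi).trans (ih (h.trans_le (hf i hi)) (by omega))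
      exact ⟨⟨hi, h.trans_le (hmono 0 (Nat.zero_le i))⟩, fun k hk => h.trans_le (hmono k hk)⟩
  have h1 := key (f i)
  have h2 := key ((YoungDiagram.ofRows N f).rowLen i)
  omega

theorem count_map_of_nodup {α : Type*} [DecidableEq α] {L : List α} (hL : L.Nodup) (f : α → ℕ)
    (a : ℕ) : (L.map f).count a = (L.toFinset.filter (f · = a)).card := by
  rw [List.count, List.countP_map, List.countP_eq_length_filter,
    ← List.toFinset_card_of_nodup (hL.filter _), List.toFinset_filter]
  congr 1
  exact Finset.filter_congr fun q _ => by simp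

theorem count_rowCells_fst (lam : YoungDiagram) (i : ℕ) :
    ((rowCells lam).map Prod.fst).count i = lam.rowLen i := by
  rw [count_map_of_nodup (nodup_rowCells lam), toFinset_rowCells, YoungDiagram.rowLen_eq_card]
  rfl

theorem count_colCells_fst (lam : YoungDiagram) (i : ℕ) :
    ((colCells lam).map Prod.fst).count i = lam.rowLen i := by
  rw [← ((rowCells_perm_colCells lam).map Prod.fst).count_eq, count_rowCells_fst]

theorem rowLen_eq_zero {lam : YoungDiagram} {n i : ℕ} (h : lam.colLen 0 ≤ n) (hi : n ≤ i) :
    lam.rowLen i = 0 := by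
  by_contra h0
  have : (i, 0) ∈ lam := YoungDiagram.mem_iff_lt_rowLen.2 (by omega)
  have := YoungDiagram.mem_iff_lt_colLen.1 this
  omega

theorem neg_one_pow_eq_of_mod_two {a b : ℕ} (h : a % 2 = b % 2) : (-1 : ℤ) ^ a = (-1) ^ b := by
  rw [neg_one_pow_eq_pow_mod_two, h, ← neg_one_pow_eq_pow_mod_two]

namespace OPol

variable {n : ℕ}

/-! ### Reading words of tableaux -/

/-- The row word of a tableau. -/
def rowReading {nu : YoungDiagram} (T : BoundedSSYT nu n) : List ℕ :=
  (rowCells nu).map fun c => T.1 c.1 c.2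

/-- The column word of a tableau. -/
def colReading {nu : YoungDiagram} (T : BoundedSSYT nu n) : List ℕ :=
  (colCells nu).map fun c => T.1 c.1 c.2

theorem rowReading_perm {nu : YoungDiagram} (T : BoundedSSYT nu n) :
    (rowReading T).Perm (colReading T) := (rowCells_perm_colCells nu).map _

theorem chainWord_colList' {nu : YoungDiagram} (T : BoundedSSYT nu n) :
    chainWord (colList nu (T.1 · ·)) = colReading T :=
  chainWord_colList fun h hm => T.1.col_strict h hm

theorem inversions_rowReading {nu : YoungDiagram} (T : BoundedSSYT nu n) :
    inversions (rowReading T) = boxNLess nu (T.1 · ·) :=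
  inversions_rowCells nu fun h hm => T.1.row_weak h hm

theorem inversions_colReading {nu : YoungDiagram} (T : BoundedSSYT nu n) :
    inversions (colReading T) + boxNW nu = inversions (rowReading T) := by
  rw [inversions_rowReading, ← inversions_colCells nu T.1]
  rfl

/-- The tableau whose entries are the row indices, as a tableau with bounded entries. -/
def superstandard (lam : YoungDiagram) (h : lam.colLen 0 ≤ n) : BoundedSSYT lam n :=
  ⟨SemistandardYoungTableau.highestWeight lam, fun i j hm => by
    rw [SemistandardYoungTableau.highestWeight_apply, if_pos hm]
    exact (YoungDiagram.lt_colLen_zero hm).trans_le h⟩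

theorem rowReading_superstandard (lam : YoungDiagram) (h : lam.colLen 0 ≤ n) :
    rowReading (superstandard lam h) = (rowCells lam).map Prod.fst := by
  refine List.map_congr_left fun c hc => ?_
  exact if_pos ((mem_rowCells lam).1 hc)

theorem colReading_superstandard (lam : YoungDiagram) (h : lam.colLen 0 ≤ n) :
    colReading (superstandard lam h) = (colCells lam).map Prod.fst := by
  refine List.map_congr_left fun c hc => ?_
  exact if_pos ((mem_rowCells lam).1 ((rowCells_perm_colCells lam).mem_iff.2 hc))

theorem inversions_colCells_fst (lam : YoungDiagram) :
    inversions ((colCells lam).map Prod.fst) + boxNW lam = boxN lam := by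
  rw [← inversions_rowCells_fst, ← colReading_superstandard lam le_rfl,
    ← rowReading_superstandard lam le_rfl, inversions_colReading]

/-! ### Odd Schur polynomials by columns -/

/-- The sum of the column words of all semistandard tableaux. -/
noncomputable def schurSum (lam : YoungDiagram) (n : ℕ) : OPol n :=
  chainSum topAligned n (colSizes lam) ∅

theorem schurSum_eq (lam : YoungDiagram) (n : ℕ) :
    schurSum lam n = ∑ T : BoundedSSYT lam n, word n (colReading T) := by
  rw [schurSum, chainSum, ← sum_boundedSSYT]
  exact Finset.sum_congr rfl fun T _ => by rw [chainWord_colList']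

theorem oddSchurPol_eq_sum (lam : YoungDiagram) (n : ℕ) : oddSchurPol lam n =
    ((-1 : ℤ) ^ (boxdN lam + boxN lam)) • ∑ T : BoundedSSYT lam n, word n (rowReading T) := by
  rw [oddSchurPol, zsmul_eq_mul]
  push_cast
  congr 1
  exact Finset.sum_congr rfl fun T _ => by rw [rowWord_bot]; rfl

theorem oddSchurPol_eq (lam : YoungDiagram) (n : ℕ) : oddSchurPol lam n =
    ((-1 : ℤ) ^ (boxdN lam + boxN lam + boxNW lam)) • schurSum lam n := by
  rw [oddSchurPol_eq_sum, schurSum_eq, pow_add _ (boxdN lam + boxN lam), mul_smul, Finset.smul_sum (r := (-1) ^ boxNW lam)]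
  congr 1
  refine Finset.sum_congr rfl fun T _ => ?_
  have := inversions_colReading T
  rw [word_perm (rowReading_perm T), neg_one_pow_eq_of_mod_two (b := boxNW lam) (by omega)]

theorem schurSum_mem (lam : YoungDiagram) (n : ℕ) : schurSum lam n ∈ oddSymm n :=
  chainSum_mem_oddSymm _ _ (by simp)

theorem oddSchurPol_mem (lam : YoungDiagram) (n : ℕ) : oddSchurPol lam n ∈ oddSymm n := by
  rw [oddSchurPol_eq]
  exact zsmul_mem (schurSum_mem lam n) _

theorem le_of_mem_colSizes {lam : YoungDiagram} (h : lam.colLen 0 ≤ n) : ∀ l ∈ colSizes lam, l ≤ n := by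
  simp only [colSizes, List.mem_map]
  rintro _ ⟨j, -, rfl⟩
  exact (lam.colLen_anti 0 j (Nat.zero_le j)).trans h

theorem schurSum_eq_straighten {lam : YoungDiagram} (h : lam.colLen 0 ≤ n) :
    schurSum lam n = straighten n (word n ((colCells lam).map Prod.fst ++ rhoWord n)) := by
  rw [schurSum, chainSum_top (le_of_mem_colSizes h) (isChain_colSizes lam), chainWord_colSizes_range]

/-- The rotated shape straightens to the same multiset of row indices, read with the columns in the
opposite order. Rearranging it costs the inversions of both column readings, which total dN + N. -/
theorem flip_schurSum {lam : YoungDiagram} (h : lam.colLen 0 ≤ n) : flip n (schurSum lam n) =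
    MulOpposite.op (((-1 : ℤ) ^ (boxdN lam + boxN lam)) • schurSum lam n) := by
  rw [schurSum_eq_straighten h, ← schurSum_eq_straighten h, schurSum, flip_chainSum, chainSum_bottom,
    chainWord_colSizes_reverse_range]
  · have := inversions_colCells_add_revColCells lam
    rw [← schurSum, schurSum_eq_straighten h, word_append, word_append,
      word_perm ((revColCells_perm_colCells lam).map Prod.fst), smul_mul_assoc, map_zsmul, ← this,
      add_comm]
  · intro l hl
    exact le_of_mem_colSizes h l (List.mem_reverse.1 hl)
  · rw [List.isChain_reverse]
    exact isChain_colSizes lam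

/-! ### Products of odd Schur polynomials -/

/-- The word of the exponents `μ + ρ`. -/
def shiftedWord (mu : YoungDiagram) (n : ℕ) : List ℕ := (colCells mu).map Prod.fst ++ rhoWord n

theorem count_shiftedWord (mu : YoungDiagram) (n i : ℕ) :
    (shiftedWord mu n).count i = mu.rowLen i + (n - 1 - i) := by
  rw [shiftedWord, List.count_append, count_colCells_fst, count_rhoWord]

theorem strictContent_shiftedWord (mu : YoungDiagram) (n : ℕ) :
    StrictContent n (shiftedWord mu n) := by
  intro i hi
  rw [count_shiftedWord, count_shiftedWord]
  have := mu.rowLen_anti i (i + 1) (by omega)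
  omega

/-- The tableau `T` builds up from `μ`, column by column from the right, through partitions. -/
def IsGood {nu : YoungDiagram} (mu : YoungDiagram) (T : BoundedSSYT nu n) : Prop :=
  GoodChain n (shiftedWord mu n) (colList nu (T.1 · ·))

/-- The shape obtained from `μ` by adding the content of `T`. -/
noncomputable def prodShape {nu : YoungDiagram} (mu : YoungDiagram) (T : BoundedSSYT nu n) :
    YoungDiagram :=
  YoungDiagram.ofRows n fun i => mu.rowLen i + (rowReading T).count i

theorem lt_of_mem_rowReading {nu : YoungDiagram} (T : BoundedSSYT nu n) {a : ℕ}
    (h : a ∈ rowReading T) : a < n := by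
  obtain ⟨c, hc, rfl⟩ := List.mem_map.1 h
  exact T.2 _ _ ((mem_rowCells nu).1 hc)

theorem rowLen_prodShape {mu nu : YoungDiagram} (hmu : mu.colLen 0 ≤ n) {T : BoundedSSYT nu n}
    (hT : IsGood mu T) (i : ℕ) :
    (prodShape mu T).rowLen i = mu.rowLen i + (rowReading T).count i := by
  refine YoungDiagram.rowLen_ofRows (fun i hi => ?_) (fun i hi => ?_) i
  -- Only the last stage of goodness is needed: strict exponents minus ρ decrease weakly.
  · have := hT (colList nu (T.1 · ·)).length i hi
    rw [List.take_length, chainWord_colList', List.count_append, List.count_append,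
      count_shiftedWord, count_shiftedWord, ← (rowReading_perm T).count_eq,
      ← (rowReading_perm T).count_eq] at this
    omega
  · rw [rowLen_eq_zero hmu hi, zero_add, List.count_eq_zero]
    intro h
    have := lt_of_mem_rowReading T h
    omega

theorem colLen_prodShape {mu nu : YoungDiagram} {T : BoundedSSYT nu n} :
    (prodShape mu T).colLen 0 ≤ n := by
  by_contra h
  have h1 : (n, 0) ∈ prodShape mu T := YoungDiagram.mem_iff_lt_colLen.2 (by omega)
  rw [← YoungDiagram.mem_cells] at h1
  simp [prodShape, YoungDiagram.ofRows] at h1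

theorem prodShape_perm {mu nu : YoungDiagram} (hmu : mu.colLen 0 ≤ n) {T : BoundedSSYT nu n}
    (hT : IsGood mu T) : (colReading T ++ (colCells mu).map Prod.fst).Perm
      ((colCells (prodShape mu T)).map Prod.fst) := by
  rw [List.perm_iff_count]
  intro i
  rw [List.count_append, count_colCells_fst, count_colCells_fst, rowLen_prodShape hmu hT,
    (rowReading_perm T).count_eq, add_comm]

/-- Inversions between the two parts depend only on their multisets of letters, so passing from
column to row reading changes the parity by the two shape constants alone. -/
theorem inversions_col_append {mu nu : YoungDiagram} (T : BoundedSSYT nu n) :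
    inversions (colReading T ++ (colCells mu).map Prod.fst) + boxNW nu + boxNW mu =
      inversions (rowReading T ++ (rowCells mu).map Prod.fst) := by
  have h1 := inversions_colReading T
  have h2 := inversions_colCells_fst mu
  rw [← inversions_rowCells_fst] at h2
  have h3 : ((colReading T).map fun a => ((colCells mu).map Prod.fst).countP (· < a)).sum =
      ((rowReading T).map fun a => ((rowCells mu).map Prod.fst).countP (· < a)).sum := by
    rw [((rowReading_perm T).map _).sum_eq]
    refine congrArg List.sum (List.map_congr_left fun a _ => ?_)
    exact ((rowCells_perm_colCells mu).map Prod.fst).symm.countP_eq _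
  rw [inversions_append, inversions_append, h3]
  omega

-- The left factor is absorbed by linearity, s_ν π(x̃^(μ+ρ)) = π(s_ν x̃^(μ+ρ)), and the surviving
-- tableaux each contribute a straightened monomial of exponents λ+ρ. Here ν stands on the left.
open Classical in
theorem schurSum_mul {mu nu : YoungDiagram} (hmu : mu.colLen 0 ≤ n) :
    schurSum nu n * schurSum mu n = ∑ T ∈ (Finset.univ : Finset (BoundedSSYT nu n)).filter
      (IsGood mu), ((-1 : ℤ) ^ (inversions (colReading T ++ (colCells mu).map Prod.fst) +
        inversions ((colCells (prodShape mu T)).map Prod.fst))) • schurSum (prodShape mu T) n := by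
  rw [schurSum_eq_straighten hmu, ← straighten_mul (schurSum_mem nu n), schurSum, ← shiftedWord,
    straighten_chainSum_mul _ _ _ (strictContent_shiftedWord mu n), Finset.sum_filter,
    ← sum_boundedSSYT, Finset.sum_filter]
  refine Finset.sum_congr rfl fun T _ => ?_
  by_cases hT : IsGood mu T
  · have hT' : GoodChain n (shiftedWord mu n) (colList nu (T.1 · ·)) := hT
    rw [if_pos hT, if_pos hT', schurSum_eq_straighten colLen_prodShape, chainWord_colList',
      shiftedWord, ← List.append_assoc, word_append, word_append _ (rhoWord n),
      word_perm (prodShape_perm hmu hT), smul_mul_assoc, map_zsmul]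
  · have hT' : ¬ GoodChain n (shiftedWord mu n) (colList nu (T.1 · ·)) := hT
    rw [if_neg hT, if_neg hT']

open Classical in
/-- The product of two odd Schur polynomials as a signed sum over tableaux. -/
theorem oddSchurPol_mul {mu nu : YoungDiagram} (hmu : mu.colLen 0 ≤ n) (hnu : nu.colLen 0 ≤ n) :
    oddSchurPol mu n * oddSchurPol nu n =
      ∑ T ∈ (Finset.univ : Finset (BoundedSSYT nu n)).filter (IsGood mu),
        ((-1 : ℤ) ^ (inversions (rowReading T ++ (rowCells mu).map Prod.fst) +
          boxN (prodShape mu T))) • oddSchurPol (prodShape mu T) n := by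
  -- `flip` reverses the product to μ ν and multiplies each Schur sum by a known sign.
  have h := congrArg (flip n) (schurSum_mul (nu := nu) hmu)
  rw [map_mul, flip_schurSum hmu, flip_schurSum hnu, ← MulOpposite.op_mul, map_sum] at h
  simp only [map_zsmul, flip_schurSum colLen_prodShape, ← MulOpposite.op_smul,
    ← Finset.op_sum] at h
  have h' := MulOpposite.op_injective h
  rw [smul_mul_smul_comm] at h'
  -- The sign is inserted twice so that `h'` can be applied to the inner product.
  have h2 : schurSum mu n * schurSum nu n = ((-1 : ℤ) ^ (boxdN mu + boxN mu) *
      (-1) ^ (boxdN nu + boxN nu)) • (((-1 : ℤ) ^ (boxdN mu + boxN mu) *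
      (-1) ^ (boxdN nu + boxN nu)) • (schurSum mu n * schurSum nu n)) := by
    rw [smul_smul, ← pow_add, ← pow_add, neg_one_pow_eq_of_mod_two (b := 0) (by omega), pow_zero, one_smul]
  rw [oddSchurPol_eq, oddSchurPol_eq, smul_mul_smul_comm, h2, h', smul_smul, Finset.smul_sum]
  refine Finset.sum_congr rfl fun T _ => ?_
  rw [oddSchurPol_eq]
  simp only [smul_smul, ← pow_add]
  congr 1
  refine neg_one_pow_eq_of_mod_two ?_
  have h3 := inversions_col_append (mu := mu) T
  have h4 := inversions_colCells_fst (prodShape mu T)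
  omega

end OPol

namespace OPol

variable {n : ℕ}

/-! ### Stability and degree -/

theorem proj_xt (i : ℕ) : proj n (xt (n + 1) i) = xt n i := by
  rcases lt_or_ge i (n + 1) with h | h
  · rw [xt_of_lt h, map_zsmul, proj, lift_x]
    rcases lt_or_ge i n with h' | h'
    · rw [dif_pos h', xt_of_lt h']
    · rw [dif_neg (not_lt.2 h'), xt_of_le h', smul_zero]
  · rw [xt_of_le h, map_zero, xt_of_le (by omega)]

theorem proj_word (w : List ℕ) : proj n (word (n + 1) w) = word n w := by
  induction w with
  | nil => simp
  | cons a w ih => rw [word_cons, map_mul, proj_xt, ih, word_cons]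

/-- Tableaux that use the last letter vanish, since `xt n n` is zero; the others are the tableaux of
the smaller alphabet. -/
theorem proj_oddSchurPol (lam : YoungDiagram) (n : ℕ) :
    proj n (oddSchurPol lam (n + 1)) = oddSchurPol lam n := by
  rw [oddSchurPol_eq_sum, oddSchurPol_eq_sum, map_zsmul, map_sum]
  congr 1
  symm
  refine Finset.sum_of_injOn (fun T : BoundedSSYT lam n =>
    (⟨T.1, fun i j h => (T.2 i j h).trans (Nat.lt_succ_self n)⟩ : BoundedSSYT lam (n + 1)))
    ?_ (fun _ _ => Finset.mem_coe.2 (Finset.mem_univ _)) ?_ ?_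
  · intro T _ T' _ h
    exact Subtype.ext (congrArg (fun S : BoundedSSYT lam (n + 1) => S.1) h)
  · intro T _ hT
    rw [proj_word]
    by_contra h0
    refine hT ⟨⟨T.1, fun i j h => ?_⟩, Finset.mem_coe.2 (Finset.mem_univ _), rfl⟩
    by_contra hn
    refine h0 (word_eq_zero (a := T.1 i j) ?_ (not_lt.1 hn))
    exact List.mem_map.2 ⟨(i, j), (mem_rowCells lam).2 h, rfl⟩
  · intro T _
    rw [proj_word]
    rfl

theorem length_rowCells (lam : YoungDiagram) : (rowCells lam).length = lam.card := by
  rw [← List.toFinset_card_of_nodup (nodup_rowCells lam), toFinset_rowCells]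

theorem oddSchurPol_mem_degLE (lam : YoungDiagram) (n : ℕ) :
    oddSchurPol lam n ∈ degLE n lam.card := by
  rw [oddSchurPol_eq_sum]
  refine zsmul_mem (sum_mem fun T _ => ?_) _
  have := word_mem_degLE (n := n) (rowReading T)
  rwa [rowReading, List.length_map, length_rowCells] at this

theorem colLen_le_card (lam : YoungDiagram) : lam.colLen 0 ≤ lam.card := by
  rw [YoungDiagram.colLen_eq_card]
  exact Finset.card_le_card (Finset.filter_subset _ _)

/-! ### Coefficients -/

/-- The action of a variable on the free group on monomials. -/
noncomputable def addLetter (i : ℕ) : Module.End ℤ (Multiset ℕ →₀ ℤ) :=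
  -- The sign is that of moving x_i past the smaller letters of m into increasing order.
  Finsupp.linearCombination ℤ fun m => Finsupp.single (i ::ₘ m) ((-1) ^ m.countP (· < i))

theorem addLetter_single (i : ℕ) (m : Multiset ℕ) (k : ℤ) : addLetter i (Finsupp.single m k) =
    Finsupp.single (i ::ₘ m) (k * (-1) ^ m.countP (· < i)) := by
  simp [addLetter, Finsupp.linearCombination_single]

theorem addLetter_anticomm {i j : ℕ} (h : i ≠ j) :
    addLetter i * addLetter j + addLetter j * addLetter i = 0 := by
  refine Finsupp.lhom_ext fun m k => ?_
  rw [LinearMap.add_apply, Module.End.mul_apply, Module.End.mul_apply, addLetter_single,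
    addLetter_single, addLetter_single, addLetter_single, Multiset.cons_swap j i,
    ← Finsupp.single_add, LinearMap.zero_apply, Finsupp.single_eq_zero]
  rcases lt_or_gt_of_ne h with h | h
  · rw [Multiset.countP_cons_of_neg (p := (· < i)) m (show ¬ j < i by omega),
      Multiset.countP_cons_of_pos (p := (· < j)) m h]
    ring
  · rw [Multiset.countP_cons_of_pos (p := (· < i)) m h,
      Multiset.countP_cons_of_neg (p := (· < j)) m (show ¬ i < j by omega)]
    ring

/-- The action of skew polynomials on the free group on monomials. -/
noncomputable def monomialRep (n : ℕ) : OPol n →+* Module.End ℤ (Multiset ℕ →₀ ℤ) :=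
  lift (fun i => addLetter i) fun _ _ h => addLetter_anticomm fun e => h (Fin.ext e)

/-- The coefficient of a skew polynomial at a monomial. -/
noncomputable def coefficient (n : ℕ) (m : Multiset ℕ) : OPol n →+ ℤ where
  toFun f := monomialRep n f (Finsupp.single 0 1) m
  map_zero' := by simp
  map_add' f g := by simp

theorem monomialRep_word {w : List ℕ} (h : ∀ a ∈ w, a < n) :
    ∃ ε : ℤˣ, monomialRep n (word n w) (Finsupp.single 0 1) =
      Finsupp.single (w : Multiset ℕ) (ε : ℤ) := by
  induction w with
  | nil => exact ⟨1, by simp⟩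
  | cons a w ih =>
    obtain ⟨ε, hε⟩ := ih fun b hb => h b (by simp [hb])
    refine ⟨(-1) ^ a * (ε * (-1) ^ (w : Multiset ℕ).countP (· < a)), ?_⟩
    rw [word_cons, map_mul, Module.End.mul_apply, hε, xt_of_lt (h a (by simp)), map_zsmul,
      LinearMap.smul_apply, monomialRep, lift_x, addLetter_single, Finsupp.smul_single,
      Multiset.cons_coe]
    push_cast
    rfl

theorem coefficient_word_of_perm {v w : List ℕ} (h : ∀ a ∈ w, a < n) (hvw : w.Perm v) :
    IsUnit (coefficient n v (word n w)) := by
  obtain ⟨ε, hε⟩ := monomialRep_word h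
  change IsUnit (monomialRep n (word n w) (Finsupp.single 0 1) v)
  rw [hε, Multiset.coe_eq_coe.2 hvw, Finsupp.single_eq_same]
  exact ε.isUnit

theorem perm_of_coefficient_word_ne_zero {v w : List ℕ} (h : ∀ a ∈ w, a < n)
    (hc : coefficient n v (word n w) ≠ 0) : w.Perm v := by
  obtain ⟨ε, hε⟩ := monomialRep_word h
  change monomialRep n (word n w) (Finsupp.single 0 1) v ≠ 0 at hc
  rw [hε] at hc
  by_contra hvw
  rw [Finsupp.single_apply, if_neg (fun e => hvw (Multiset.coe_eq_coe.1 e))] at hc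
  exact hc rfl

/-! ### Linear independence -/

theorem le_entry {lam : YoungDiagram} (T : SemistandardYoungTableau lam) {i j : ℕ}
    (h : (i, j) ∈ lam) : i ≤ T i j := by
  induction i with
  | zero => exact Nat.zero_le _
  | succ i ih =>
    have := ih (lam.up_left_mem (Nat.le_succ i) le_rfl h)
    have := T.col_strict (show i < i + 1 by omega) h
    omega

/-- The sum of the row indices of all boxes. -/
def rowSum (lam : YoungDiagram) : ℕ := ∑ c ∈ lam.cells, c.1

theorem sum_map_rowCells (lam : YoungDiagram) (f : ℕ × ℕ → ℕ) :
    ((rowCells lam).map f).sum = ∑ c ∈ lam.cells, f c := by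
  rw [← toFinset_rowCells, List.sum_toFinset _ (nodup_rowCells lam)]

theorem eq_of_rowLen_eq {lam mu : YoungDiagram} (h : ∀ i, lam.rowLen i = mu.rowLen i) :
    lam = mu := by
  ext ⟨i, j⟩
  rw [YoungDiagram.mem_cells, YoungDiagram.mem_cells, YoungDiagram.mem_iff_lt_rowLen,
    YoungDiagram.mem_iff_lt_rowLen, h]

/-- Each entry of T is at least its row index, and the entries add up to `rowSum lam`. Equality of
the sums forces every entry to be its row index. -/
theorem rowReading_perm_fst {kap lam : YoungDiagram} {T : BoundedSSYT kap n}
    (h : (rowReading T).Perm ((rowCells lam).map Prod.fst)) :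
    rowSum kap ≤ rowSum lam ∧ (rowSum kap = rowSum lam →
      kap = lam ∧ rowReading T = (rowCells kap).map Prod.fst) := by
  have h1 : ∑ c ∈ kap.cells, T.1 c.1 c.2 = rowSum lam := by
    rw [rowSum, ← sum_map_rowCells, ← sum_map_rowCells]
    exact h.sum_eq
  have h2 : ∀ c ∈ kap.cells, c.1 ≤ T.1 c.1 c.2 := fun c hc => le_entry T.1 hc
  rw [← h1]
  refine ⟨Finset.sum_le_sum h2, fun he => ?_⟩
  have h3 := (Finset.sum_eq_sum_iff_of_le h2).1 he
  have h4 : rowReading T = (rowCells kap).map Prod.fst :=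
    List.map_congr_left fun c hc => (h3 c ((mem_rowCells kap).1 hc)).symm
  refine ⟨eq_of_rowLen_eq fun i => ?_, h4⟩
  rw [← count_rowCells_fst, ← count_rowCells_fst, ← h4, h.count_eq]

theorem isUnit_coefficient_oddSchurPol {lam : YoungDiagram} (h : lam.colLen 0 ≤ n) :
    IsUnit (coefficient n ((rowCells lam).map Prod.fst : List ℕ) (oddSchurPol lam n)) := by
  rw [oddSchurPol_eq_sum, map_zsmul, map_sum, Finset.sum_eq_single (superstandard lam h)]
  · rw [smul_eq_mul]
    refine IsUnit.mul (IsUnit.pow _ (by decide)) (coefficient_word_of_perm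
      (fun a ha => lt_of_mem_rowReading _ ha) ?_)
    rw [rowReading_superstandard]
  · intro T _ hT
    by_contra h0
    have hp := perm_of_coefficient_word_ne_zero (fun a ha => lt_of_mem_rowReading _ ha) h0
    have h1 := ((rowReading_perm_fst hp).2 rfl).2
    rw [rowReading, List.map_inj_left] at h1
    refine hT (Subtype.ext (SemistandardYoungTableau.ext fun i j => ?_))
    change T.1 i j = SemistandardYoungTableau.highestWeight lam i j
    rw [SemistandardYoungTableau.highestWeight_apply]
    split_ifs with hc
    · exact h1 (i, j) ((mem_rowCells lam).2 hc)
    · exact T.1.zeros hc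
  · intro h'
    exact absurd (Finset.mem_univ _) h'

theorem rowSum_of_coefficient_ne_zero {kap lam : YoungDiagram}
    (h : coefficient n ((rowCells lam).map Prod.fst : List ℕ) (oddSchurPol kap n) ≠ 0) :
    rowSum kap ≤ rowSum lam ∧ (rowSum kap = rowSum lam → kap = lam) := by
  rw [oddSchurPol_eq_sum, map_zsmul, map_sum] at h
  obtain ⟨T, -, hT⟩ := Finset.exists_ne_zero_of_sum_ne_zero (right_ne_zero_of_smul h)
  have := rowReading_perm_fst
    (perm_of_coefficient_word_ne_zero (fun a ha => lt_of_mem_rowReading _ ha) hT)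
  exact ⟨this.1, fun e => (this.2 e).1⟩

/-- The odd Schur polynomials of diagrams with at most `n` rows are linearly independent. -/
theorem oddSchurPol_independent {c : YoungDiagram →₀ ℤ} (hc : ∀ lam ∈ c.support, lam.colLen 0 ≤ n)
    (h : (c.sum fun lam a => a • oddSchurPol lam n) = 0) : c = 0 := by
  by_contra hne
  -- At the content of a λ with least row sum, any other diagram of the support with a nonzero
  -- coefficient would have the same row sum, hence equal λ.
  obtain ⟨lam, hlam, hmin⟩ := Finset.exists_min_image c.support rowSum
    (Finsupp.support_nonempty_iff.2 hne)
  have h1 := congrArg (coefficient n ((rowCells lam).map Prod.fst : List ℕ)) h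
  rw [Finsupp.sum, map_sum, map_zero, Finset.sum_eq_single_of_mem lam hlam] at h1
  · rw [map_zsmul, smul_eq_mul] at h1
    exact (mul_ne_zero (Finsupp.mem_support_iff.1 hlam)
      (isUnit_coefficient_oddSchurPol (hc lam hlam)).ne_zero) h1
  · intro kap hkap hne'
    rw [map_zsmul]
    by_contra h0
    have h2 := rowSum_of_coefficient_ne_zero (right_ne_zero_of_smul h0)
    exact hne' (h2.2 (le_antisymm h2.1 (hmin kap hkap)))

/-! ### Spanning -/

/-- The span of the odd Schur polynomials of diagrams with at most `n` rows and `d` boxes. -/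
noncomputable def schurSpan (n d : ℕ) : Submodule ℤ (OPol n) :=
  Submodule.span ℤ ((fun lam => oddSchurPol lam n) '' {lam | lam.colLen 0 ≤ n ∧ lam.card ≤ d})

theorem schurSum_mem_schurSpan {d : ℕ} {lam : YoungDiagram} (h1 : lam.colLen 0 ≤ n)
    (h2 : lam.card ≤ d) : schurSum lam n ∈ schurSpan n d := by
  have : schurSum lam n =
      ((-1 : ℤ) ^ (boxdN lam + boxN lam + boxNW lam)) • oddSchurPol lam n := by
    rw [oddSchurPol_eq, smul_smul, ← pow_add, ← two_mul, pow_mul]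
    simp
  rw [this]
  exact Submodule.smul_mem _ _ (Submodule.subset_span ⟨lam, ⟨h1, h2⟩, rfl⟩)

/-- Every word in the expansion of the power, other than (i+1)^r, contains an i and so has a smaller
letter sum. -/
theorem add_pow_sub_pow_mem (i r : ℕ) :
    (xt n i + xt n (i + 1)) ^ r - xt n (i + 1) ^ r ∈ AddSubgroup.closure
      {f | ∃ v : List ℕ, v.length = r ∧ (∀ a ∈ v, a ≤ i + 1) ∧ v.sum < r * (i + 1) ∧
        word n v = f} := by
  induction r with
  | zero => simp
  | succ r ih =>
    have h : (xt n i + xt n (i + 1)) ^ (r + 1) - xt n (i + 1) ^ (r + 1) =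
        ((xt n i + xt n (i + 1)) ^ r - xt n (i + 1) ^ r) * xt n i +
        ((xt n i + xt n (i + 1)) ^ r - xt n (i + 1) ^ r) * xt n (i + 1) +
          xt n (i + 1) ^ r * xt n i := by
      rw [pow_succ, pow_succ]; noncomm_ring
    rw [h]
    have step : ∀ a ≤ i + 1, ∀ g ∈ AddSubgroup.closure
        {f | ∃ v : List ℕ, v.length = r ∧ (∀ a ∈ v, a ≤ i + 1) ∧ v.sum < r * (i + 1) ∧
          word n v = f}, g * xt n a ∈ AddSubgroup.closure
        {f | ∃ v : List ℕ, v.length = r + 1 ∧ (∀ a ∈ v, a ≤ i + 1) ∧ v.sum < (r + 1) * (i + 1) ∧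
          word n v = f} := by
      intro a ha g hg
      induction hg using AddSubgroup.closure_induction with
      | mem g hg =>
        obtain ⟨v, h1, h2, h3, rfl⟩ := hg
        refine AddSubgroup.subset_closure ⟨v ++ [a], by simp [h1], ?_, ?_, by simp⟩
        · intro b hb
          rcases List.mem_append.1 hb with hb | hb
          · exact h2 b hb
          · rw [List.mem_singleton.1 hb]; exact ha
        · rw [List.sum_append, List.sum_singleton, add_mul]
          omega
      | zero => rw [zero_mul]; exact zero_mem _
      | add f g _ _ h1 h2 => rw [add_mul f g]; exact add_mem h1 h2
      | neg f _ h => rw [neg_mul f]; exact neg_mem h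
    refine add_mem (add_mem (step i (by omega) _ ih) (step (i + 1) le_rfl _ ih))
      (AddSubgroup.subset_closure ⟨List.replicate r (i + 1) ++ [i], by simp, ?_, ?_, ?_⟩)
    · intro b hb
      rcases List.mem_append.1 hb with hb | hb
      · exact (List.eq_of_mem_replicate hb).le
      · rw [List.mem_singleton.1 hb]; omega
    · rw [List.sum_append, List.sum_replicate, List.sum_singleton, smul_eq_mul, add_mul]
      omega
    · simp [word]

theorem card_eq_length_sub {lam : YoungDiagram} {w : List ℕ} (h : w.Perm (shiftedWord lam n)) :
    w.length = lam.card + (rhoWord n).length := by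
  rw [h.length_eq, shiftedWord, List.length_append, List.length_map,
    ← (rowCells_perm_colCells lam).length_eq, length_rowCells]

/-- Induction on the letter sum. A word with strict exponents has the content λ+ρ and straightens to
± a Schur sum. Otherwise, up to sign it is u x̃_{i+1}^r with u balanced in i and i+1; replacing the
power by (x̃_i + x̃_{i+1})^r gives an element of ker ∂_i, so only words of smaller letter sum
remain. -/
theorem straighten_word_mem {d : ℕ} (w : List ℕ) (hw : ∀ a ∈ w, a < n)
    (hd : w.length ≤ d + (rhoWord n).length) : straighten n (word n w) ∈ schurSpan n d := by
  induction hs : w.sum using Nat.strong_induction_on generalizing w with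
  | _ m ih =>
    by_cases hsc : StrictContent n w
    -- Strictly decreasing exponents dominate ρ, so the truncated subtraction in `lam` is exact.
    · have hge : ∀ k, ∀ i, i + k + 1 = n → k ≤ w.count i := by
        intro k
        induction k with
        | zero => intros; exact Nat.zero_le _
        | succ k ihk =>
          intro i hi
          have := ihk (i + 1) (by omega)
          have := hsc i (by omega)
          omega
      have hrow : ∀ i, (YoungDiagram.ofRows n fun i => w.count i - (n - 1 - i)).rowLen i =
          w.count i - (n - 1 - i) := by
        refine YoungDiagram.rowLen_ofRows (fun i hi => ?_) fun i hi => ?_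
        · have := hsc i hi; omega
        · rw [List.count_eq_zero.2 fun h => by have := hw i h; omega, Nat.zero_sub]
      set lam := YoungDiagram.ofRows n fun i => w.count i - (n - 1 - i) with hlam
      have hcol : lam.colLen 0 ≤ n := by
        by_contra h
        have h1 : (n, 0) ∈ lam := YoungDiagram.mem_iff_lt_colLen.2 (by omega)
        rw [← YoungDiagram.mem_cells] at h1
        simp [hlam, YoungDiagram.ofRows] at h1
      have hp : w.Perm (shiftedWord lam n) := by
        rw [List.perm_iff_count]
        intro i
        rw [count_shiftedWord, hrow]
        rcases lt_or_ge i n with hi | hi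
        · have := hge (n - 1 - i) i (by omega); omega
        · rw [List.count_eq_zero.2 fun h => by have := hw i h; omega]; omega
      have hcard := card_eq_length_sub hp
      rw [word_perm hp, map_zsmul, shiftedWord, ← schurSum_eq_straighten hcol]
      exact Submodule.smul_mem _ _ (schurSum_mem_schurSpan hcol (by omega))
    · rw [StrictContent] at hsc
      push Not at hsc
      obtain ⟨i, hi, h⟩ := hsc
      obtain ⟨r, hr⟩ : ∃ r, w.count (i + 1) = w.count i + r := ⟨_, (Nat.add_sub_cancel' h).symm⟩
      obtain ⟨u, hu⟩ := (List.replicate_sublist_iff.2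
        (show r ≤ w.count (i + 1) by omega)).exists_perm_append
      have hu' : w.Perm (u ++ List.replicate r (i + 1)) := hu.trans List.perm_append_comm
      have c1 := hu'.count_eq i
      have c2 := hu'.count_eq (i + 1)
      rw [List.count_append, List.count_replicate, if_neg (by simp)] at c1
      rw [List.count_append, List.count_replicate_self] at c2
      have huK : word n u * (xt n i + xt n (i + 1)) ^ r ∈ kerDiv n i :=
        mul_mem (word_mem_kerDiv (by omega)) (pow_mem (xt_add_mem_kerDiv i) r)
      have hrw : word n (u ++ List.replicate r (i + 1)) = word n u * (xt n i + xt n (i + 1)) ^ r -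
          word n u * ((xt n i + xt n (i + 1)) ^ r - xt n (i + 1) ^ r) := by
        rw [word_append, mul_sub, sub_sub_cancel, word, word, List.map_replicate,
          List.prod_replicate]
      rw [word_perm hu', map_zsmul, hrw, map_sub, straighten_eq_zero hi huK, zero_sub]
      refine Submodule.smul_mem _ _ (neg_mem ?_)
      have hlen := hu'.length_eq
      have hsum := hu'.sum_eq
      rw [List.length_append, List.length_replicate] at hlen
      rw [List.sum_append, List.sum_replicate, smul_eq_mul] at hsum
      clear hrw huK
      have hmem := add_pow_sub_pow_mem (n := n) i r
      generalize (xt n i + xt n (i + 1)) ^ r - xt n (i + 1) ^ r = g at hmem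
      induction hmem using AddSubgroup.closure_induction with
      | mem g hg =>
        obtain ⟨v, h1, h2, h3, rfl⟩ := hg
        rw [← word_append]
        refine ih (u ++ v).sum ?_ (u ++ v) ?_ ?_ rfl
        · rw [List.sum_append]; omega
        · intro a ha
          rcases List.mem_append.1 ha with ha | ha
          · exact hw a (hu'.mem_iff.2 (List.mem_append_left _ ha))
          · have := h2 a ha; omega
        · rw [List.length_append]; omega
      | zero => rw [mul_zero, map_zero]; exact zero_mem _
      | add f g _ _ h1 h2 => rw [mul_add, map_add]; exact add_mem h1 h2
      | neg f _ h => rw [mul_neg, map_neg]; exact neg_mem h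

theorem lt_of_mem_rhoWord {a : ℕ} (h : a ∈ rhoWord n) : a < n := by
  have := List.count_pos_iff.2 h
  rw [count_rhoWord] at this
  omega

/-- Odd symmetric polynomials are combinations of odd Schur polynomials. -/
theorem mem_schurSpan {d : ℕ} {f : OPol n} (hf : f ∈ oddSymm n) (hd : f ∈ degLE n d) :
    f ∈ schurSpan n d := by
  rw [← straighten_mul_rho hf]
  replace hd := degLE_le_closure_word d hd
  clear hf
  induction hd using AddSubgroup.closure_induction with
  | mem f hf =>
    obtain ⟨w, h1, h2, rfl⟩ := hf
    rw [← word_append]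
    refine straighten_word_mem _ (fun a ha => ?_) (by rw [List.length_append]; omega)
    rcases List.mem_append.1 ha with ha | ha
    · exact h1 a ha
    · exact lt_of_mem_rhoWord ha
  | zero => rw [zero_mul, map_zero]; exact zero_mem _
  | add f g _ _ h1 h2 => rw [add_mul, map_add]; exact add_mem h1 h2
  | neg f _ h => rw [neg_mul, map_neg]; exact neg_mem h

theorem exists_finsupp_of_mem_schurSpan {d : ℕ} {f : OPol n} (hf : f ∈ schurSpan n d) :
    ∃ c : YoungDiagram →₀ ℤ, (∀ lam ∈ c.support, lam.colLen 0 ≤ n ∧ lam.card ≤ d) ∧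
      (c.sum fun lam a => a • oddSchurPol lam n) = f := by
  rw [schurSpan, Finsupp.mem_span_image_iff_linearCombination] at hf
  obtain ⟨c, hc, rfl⟩ := hf
  exact ⟨c, fun lam hlam => (Finsupp.mem_supported _ _).1 hc hlam, rfl⟩

end OPol

/-! ### The basis of odd Schur functions -/

open OPol

/-- The odd Schur function. -/
noncomputable def oddSchur (lam : YoungDiagram) : OddSymm :=
  ⟨fun n => oddSchurPol lam n, fun n => oddSchurPol_mem lam n, fun n => proj_oddSchurPol lam n,
    lam.card, fun n => oddSchurPol_mem_degLE lam n⟩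

/-- The component of an odd symmetric function in `n` variables. -/
noncomputable def component (n : ℕ) : OddSymm →+ OPol n where
  toFun f := (f : ∀ n, OPol n) n
  map_zero' := rfl
  map_add' _ _ := rfl

theorem component_sum (c : YoungDiagram →₀ ℤ) (n : ℕ) :
    component n (c.sum fun lam a => a • oddSchur lam) =
      c.sum fun lam a => a • oddSchurPol lam n := by
  rw [Finsupp.sum, map_sum]
  exact Finset.sum_congr rfl fun lam _ => map_zsmul (component n) _ _

theorem linearIndependent_oddSchur : LinearIndependent ℤ oddSchur := by
  rw [linearIndependent_iff]
  intro c hc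
  refine oddSchurPol_independent (n := c.support.sup fun lam => lam.colLen 0)
    (fun lam hlam => Finset.le_sup (f := fun lam : YoungDiagram => lam.colLen 0) hlam) ?_
  rw [← component_sum]
  exact (congrArg (component _) hc).trans (map_zero _)

/-- Components below d are projections of the one at d. Above d, the diagrams that occur have at
most d boxes, hence at most d rows, so projection loses none of the coefficients. -/
theorem eq_zero_of_component_eq_zero {d : ℕ} {f : OddSymm} (hd : ∀ n, component n f ∈ degLE n d)
    (h0 : component d f = 0) : f = 0 := by
  have hproj : ∀ n, proj n (component (n + 1) f) = component n f := f.2.2.1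
  have hle : ∀ k n, n + k = d → component n f = 0 := by
    intro k
    induction k with
    | zero => intro n hn; rw [add_zero] at hn; rw [hn, h0]
    | succ k ih => intro n hn; rw [← hproj, ih (n + 1) (by omega), map_zero]
  have hge : ∀ n, d ≤ n → component n f = 0 := by
    intro n hn
    induction n, hn using Nat.le_induction with
    | base => exact h0
    | succ n hn ih =>
      obtain ⟨c, hc, hcf⟩ := exists_finsupp_of_mem_schurSpan (mem_schurSpan (f.2.1 (n + 1)) (hd (n + 1)))
      change _ = component (n + 1) f at hcf
      have hc0 : c = 0 := by
        refine oddSchurPol_independent (n := n)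
          (fun lam hlam => ((colLen_le_card lam).trans (hc lam hlam).2).trans hn) ?_
        rw [← ih, ← hproj, ← hcf, Finsupp.sum, Finsupp.sum, map_sum]
        exact Finset.sum_congr rfl fun lam _ => by rw [map_zsmul, proj_oddSchurPol]
      rw [← hcf, hc0, Finsupp.sum_zero_index]
  refine Subtype.ext (funext fun n => ?_)
  rcases le_total d n with h | h
  · exact hge n h
  · exact hle (d - n) n (by omega)

theorem span_oddSchur : ⊤ ≤ Submodule.span ℤ (Set.range oddSchur) := by
  intro f _
  obtain ⟨d, hd⟩ := f.2.2.2
  obtain ⟨c, hc, hcf⟩ := exists_finsupp_of_mem_schurSpan (mem_schurSpan (f.2.1 d) (hd d))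
  have hg : (c.sum fun lam a => a • oddSchur lam) ∈ Submodule.span ℤ (Set.range oddSchur) :=
    Submodule.sum_mem _ fun lam _ =>
      Submodule.smul_mem _ _ (Submodule.subset_span ⟨lam, rfl⟩)
  have h0 : f - (c.sum fun lam a => a • oddSchur lam) = 0 := by
    refine eq_zero_of_component_eq_zero (d := d) (fun n => ?_) ?_
    · rw [map_sub, component_sum]
      refine sub_mem (hd n) (sum_mem fun lam hlam => zsmul_mem ?_ _)
      exact degLE_mono n (hc lam hlam).2 (oddSchurPol_mem_degLE lam n)
    · rw [map_sub, component_sum, hcf]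
      exact sub_self _
  rw [sub_eq_zero.1 h0]
  exact hg

/-- The basis of odd Schur functions. -/
noncomputable def oddSchurBasis : Module.Basis YoungDiagram ℤ OddSymm :=
  Module.Basis.mk linearIndependent_oddSchur span_oddSchur

theorem oddSchurBasis_apply (lam : YoungDiagram) : oddSchurBasis lam = oddSchur lam :=
  Module.Basis.mk_apply _ _ _

/-! ### Structure constants -/

open Classical in
/-- The structure constants as signed counts of tableaux with bounded entries. -/
theorem repr_mul_eq_sum {mu nu lam : YoungDiagram} {N : ℕ} : ∃ n ≥ N,
    oddSchurBasis.repr (oddSchurBasis mu * oddSchurBasis nu) lam =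
      ∑ T ∈ (Finset.univ : Finset (BoundedSSYT nu n)).filter
        (fun T => IsGood mu T ∧ prodShape mu T = lam),
        (-1 : ℤ) ^ (inversions (rowReading T ++ (rowCells mu).map Prod.fst) + boxN lam) := by
  set r := oddSchurBasis.repr (oddSchurBasis mu * oddSchurBasis nu) with hr
  -- With n at least the number of rows of every diagram in the expansion, independence in n
  -- variables already identifies the coefficients.
  set n := max N (max (mu.colLen 0) (max (nu.colLen 0) (r.support.sup fun lam => lam.colLen 0)))
  refine ⟨n, le_max_left _ _, ?_⟩
  have hmu : mu.colLen 0 ≤ n := by omega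
  have hnu : nu.colLen 0 ≤ n := by omega
  have hprod : (r.sum fun lam a => a • oddSchur lam) = oddSchur mu * oddSchur nu := by
    have h := oddSchurBasis.linearCombination_repr (oddSchurBasis mu * oddSchurBasis nu)
    rw [← hr, Finsupp.linearCombination_apply, oddSchurBasis_apply, oddSchurBasis_apply] at h
    rw [← h]
    simp only [oddSchurBasis_apply]
  have h1 := congrArg (component n) hprod
  rw [component_sum] at h1
  have h2 : component n (oddSchur mu * oddSchur nu) = oddSchurPol mu n * oddSchurPol nu n := rfl
  rw [h2, oddSchurPol_mul hmu hnu] at h1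
  set q : YoungDiagram →₀ ℤ := ∑ T ∈ (Finset.univ : Finset (BoundedSSYT nu n)).filter (IsGood mu),
    Finsupp.single (prodShape mu T)
      ((-1 : ℤ) ^ (inversions (rowReading T ++ (rowCells mu).map Prod.fst) +
        boxN (prodShape mu T))) with hq
  have hqs : (q.sum fun lam a => a • oddSchurPol lam n) =
      r.sum fun lam a => a • oddSchurPol lam n := by
    rw [h1, hq, ← Finsupp.sum_finsetSum_index (by intros; rw [zero_smul])
      (by intros; rw [add_smul])]
    exact Finset.sum_congr rfl fun T _ => Finsupp.sum_single_index (zero_smul _ _)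
  have hrq : r - q = 0 := by
    refine oddSchurPol_independent (n := n) (fun kap hkap => ?_) ?_
    · rcases Finset.mem_union.1 (Finsupp.support_sub hkap) with h | h
      · have := Finset.le_sup (f := fun lam : YoungDiagram => lam.colLen 0) h
        exact this.trans (by omega)
      · rw [Finsupp.mem_support_iff, hq, Finsupp.finsetSum_apply] at h
        obtain ⟨T, -, hT⟩ := Finset.exists_ne_zero_of_sum_ne_zero h
        have hTk : prodShape mu T = kap := by
          by_contra hne
          exact hT (Finsupp.single_eq_of_ne' hne)
        rw [← hTk]
        exact colLen_prodShape
    · rw [Finsupp.sum_sub_index (by intros; rw [sub_smul]), hqs, sub_self]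
  rw [sub_eq_zero.1 hrq, hq, Finsupp.finsetSum_apply, ← Finset.filter_filter,
    Finset.sum_filter (fun T => prodShape mu T = lam)]
  refine Finset.sum_congr rfl fun T _ => ?_
  rw [Finsupp.single_apply]
  split_ifs with h
  · rw [h]
  · rfl

/-! ### Row statistics of fillings -/

/-- The number of entries `k` in row `i` of a filling. -/
def rowCount (lam : YoungDiagram) (f : ℕ → ℕ → ℕ) (i k : ℕ) : ℕ :=
  ((Finset.range (lam.rowLen i)).filter fun j => f i j = k).card

/-- The number of entries less than `k` in row `i` of a filling. -/
def rowBelow (lam : YoungDiagram) (f : ℕ → ℕ → ℕ) (i k : ℕ) : ℕ :=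
  ((Finset.range (lam.rowLen i)).filter fun j => f i j < k).card

section

variable {lam : YoungDiagram} {f : ℕ → ℕ → ℕ}

theorem rowBelow_zero (i : ℕ) : rowBelow lam f i 0 = 0 := by simp [rowBelow]

theorem rowBelow_succ (i k : ℕ) :
    rowBelow lam f i (k + 1) = rowBelow lam f i k + rowCount lam f i k := by
  rw [rowBelow, rowBelow, rowCount, ← Finset.card_union_of_disjoint]
  · congr 1
    ext j
    simp only [Finset.mem_union, Finset.mem_filter]
    have : f i j < k + 1 ↔ f i j < k ∨ f i j = k := by omega
    rw [this]; tauto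
  · rw [Finset.disjoint_filter]
    intros; omega

theorem rowBelow_eq_sum (i k : ℕ) :
    rowBelow lam f i k = ∑ l ∈ Finset.range k, rowCount lam f i l := by
  induction k with
  | zero => exact rowBelow_zero i
  | succ k ih => rw [rowBelow_succ, ih, Finset.sum_range_succ]

theorem rowBelow_le (i k : ℕ) : rowBelow lam f i k ≤ lam.rowLen i := by
  simpa [rowBelow] using Finset.card_filter_le (Finset.range (lam.rowLen i)) fun j => f i j < k

theorem rowBelow_eq_rowLen {i k : ℕ} (h : ∀ j, (i, j) ∈ lam → f i j < k) :
    rowBelow lam f i k = lam.rowLen i := by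
  rw [rowBelow, Finset.filter_true_of_mem, Finset.card_range]
  exact fun j hj => h j (YoungDiagram.mem_iff_lt_rowLen.2 (Finset.mem_range.1 hj))

/-- In a weakly increasing row the entries below k fill an initial segment, so the row statistics
determine the filling. -/
theorem lt_rowBelow_iff {i j k : ℕ} (hf : ∀ {j₁ j₂}, j₁ < j₂ → (i, j₂) ∈ lam → f i j₁ ≤ f i j₂)
    (hj : (i, j) ∈ lam) : j < rowBelow lam f i k ↔ f i j < k := by
  have hf' : ∀ {j₁ j₂}, j₁ ≤ j₂ → (i, j₂) ∈ lam → f i j₁ ≤ f i j₂ := fun h h2 => by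
    rcases h.lt_or_eq with h | rfl
    · exact hf h h2
    · exact le_rfl
  constructor
  · intro h
    by_contra hk
    have hsub : (Finset.range (lam.rowLen i)).filter (fun j => f i j < k) ⊆ Finset.range j := by
      intro j' hj'
      rw [Finset.mem_filter, Finset.mem_range] at hj'
      rw [Finset.mem_range]
      by_contra hlt
      have := hf' (not_lt.1 hlt) (YoungDiagram.mem_iff_lt_rowLen.2 hj'.1)
      omega
    have := Finset.card_le_card hsub
    rw [Finset.card_range] at this
    exact absurd h (not_lt.2 this)
  · intro h
    have hsub : Finset.range (j + 1) ⊆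
        (Finset.range (lam.rowLen i)).filter (fun j => f i j < k) := by
      intro j' hj'
      rw [Finset.mem_range] at hj'
      have := YoungDiagram.mem_iff_lt_rowLen.1 hj
      rw [Finset.mem_filter, Finset.mem_range]
      exact ⟨by omega, (hf' (Nat.le_of_lt_succ hj') hj).trans_lt h⟩
    have := Finset.card_le_card hsub
    rw [Finset.card_range] at this
    exact this

theorem rowBelow_mono (i : ℕ) : Monotone (rowBelow lam f i) := by
  refine monotone_nat_of_le_succ fun k => ?_
  rw [rowBelow_succ]
  omega

theorem eq_of_rowBelow_eq {g : ℕ → ℕ → ℕ} {i j : ℕ}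
    (hf : ∀ {j₁ j₂}, j₁ < j₂ → (i, j₂) ∈ lam → f i j₁ ≤ f i j₂)
    (hg : ∀ {j₁ j₂}, j₁ < j₂ → (i, j₂) ∈ lam → g i j₁ ≤ g i j₂)
    (h : ∀ k, rowBelow lam f i k = rowBelow lam g i k) (hj : (i, j) ∈ lam) : f i j = g i j := by
  have key : ∀ k, f i j < k ↔ g i j < k := fun k => by
    rw [← lt_rowBelow_iff hf hj, ← lt_rowBelow_iff hg hj, h]
  have h1 := (key (f i j + 1)).1 (Nat.lt_succ_self _)
  have h2 := (key (g i j + 1)).2 (Nat.lt_succ_self _)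
  omega

/-- The filling with given row statistics. -/
theorem exists_filling (lam : YoungDiagram) {F : ℕ → ℕ → ℕ} (hF : ∀ i, Monotone (F i))
    (h0 : ∀ i, F i 0 = 0) (hle : ∀ i k, F i k ≤ lam.rowLen i) (hM : ∀ i, ∃ M, F i M = lam.rowLen i) :
    ∃ f : ℕ → ℕ → ℕ, (∀ {i j}, (i, j) ∉ lam → f i j = 0) ∧
      (∀ {i j₁ j₂}, j₁ < j₂ → (i, j₂) ∈ lam → f i j₁ ≤ f i j₂) ∧
      ∀ i k, rowBelow lam f i k = F i k := by
  classical
  set f : ℕ → ℕ → ℕ := fun i j => if (i, j) ∈ lam then stair (F i) j else 0 with hf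
  have hlt : ∀ {i j}, (i, j) ∈ lam → ∀ k, f i j < k ↔ j < F i k := by
    intro i j hj k
    obtain ⟨M, hM⟩ := hM i
    rw [hf]
    simp only [if_pos hj]
    exact stair_lt_iff (hF i) (h0 i) (M := M) (by rw [hM]; exact YoungDiagram.mem_iff_lt_rowLen.1 hj)
  have hw : ∀ {i j₁ j₂}, j₁ < j₂ → (i, j₂) ∈ lam → f i j₁ ≤ f i j₂ := by
    intro i j₁ j₂ h hj
    have h1 := (hlt hj (f i j₂ + 1)).1 (Nat.lt_succ_self _)
    exact Nat.le_of_lt_succ ((hlt (lam.up_left_mem le_rfl h.le hj) _).2 (h.trans h1))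
  refine ⟨f, fun h => if_neg h, hw, fun i k => ?_⟩
  have : (Finset.range (lam.rowLen i)).filter (fun j => f i j < k) = Finset.range (F i k) := by
    ext j
    rw [Finset.mem_filter, Finset.mem_range, Finset.mem_range]
    constructor
    · rintro ⟨h1, h2⟩
      exact (hlt (YoungDiagram.mem_iff_lt_rowLen.2 h1) k).1 h2
    · intro h
      have h1 := h.trans_le (hle i k)
      exact ⟨h1, (hlt (YoungDiagram.mem_iff_lt_rowLen.2 h1) k).2 h⟩
  rw [rowBelow, this, Finset.card_range]

theorem sum_cells {R : ℕ} (hR : lam.colLen 0 ≤ R) {M : Type*} [AddCommMonoid M] (g : ℕ × ℕ → M) :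
    ∑ c ∈ lam.cells, g c = ∑ i ∈ Finset.range R, ∑ j ∈ Finset.range (lam.rowLen i), g (i, j) := by
  refine Finset.sum_finset_product _ _ _ fun ⟨i, j⟩ => ?_
  rw [YoungDiagram.mem_cells, Finset.mem_range, Finset.mem_range, ← YoungDiagram.mem_iff_lt_rowLen]
  exact ⟨fun h => ⟨(YoungDiagram.lt_colLen_zero h).trans_le hR, h⟩, fun h => h.2⟩

theorem card_filter_cells_lt (a : ℕ) (P : ℕ × ℕ → Prop) [DecidablePred P] :
    (lam.cells.filter fun c => c.1 < a ∧ P c).card =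
      ∑ i ∈ Finset.range a, ((Finset.range (lam.rowLen i)).filter fun j => P (i, j)).card := by
  simp only [Finset.card_filter]
  rw [sum_cells (R := max a (lam.colLen 0)) (le_max_right _ _),
    ← Finset.sum_subset (Finset.range_mono (le_max_left a (lam.colLen 0)))]
  · refine Finset.sum_congr rfl fun i hi => Finset.sum_congr rfl fun j _ => ?_
    simp [Finset.mem_range.1 hi]
  · intro i _ hi
    refine Finset.sum_eq_zero fun j _ => ?_
    rw [if_neg fun h => hi (Finset.mem_range.2 h.1)]

theorem card_filter_cells_eq {R : ℕ} (hR : lam.colLen 0 ≤ R) (k : ℕ) :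
    (lam.cells.filter fun c => f c.1 c.2 = k).card = ∑ i ∈ Finset.range R, rowCount lam f i k := by
  rw [Finset.card_filter, sum_cells hR]
  exact Finset.sum_congr rfl fun i _ => (Finset.card_filter _ _).symm

theorem sum_cells_rowCount {R E : ℕ} (hR : lam.colLen 0 ≤ R)
    (hE : ∀ i j, (i, j) ∈ lam → f i j < E) (g : ℕ → ℕ → ℕ) :
    ∑ c ∈ lam.cells, g c.1 (f c.1 c.2) =
      ∑ i ∈ Finset.range R, ∑ k ∈ Finset.range E, rowCount lam f i k * g i k := by
  rw [sum_cells hR]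
  refine Finset.sum_congr rfl fun i _ => ?_
  rw [← Finset.sum_fiberwise_of_maps_to (t := Finset.range E) (g := fun j => f i j) fun j hj =>
    Finset.mem_range.2 (hE i j (YoungDiagram.mem_iff_lt_rowLen.2 (Finset.mem_range.1 hj)))]
  refine Finset.sum_congr rfl fun k _ => ?_
  rw [rowCount, ← smul_eq_mul, ← Finset.sum_const]
  exact Finset.sum_congr rfl fun j hj => by rw [(Finset.mem_filter.1 hj).2]

theorem boxNLess_eq_sum {R E : ℕ} (hR : lam.colLen 0 ≤ R) (hE : ∀ i j, (i, j) ∈ lam → f i j < E) :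
    boxNLess lam f = ∑ i ∈ Finset.range R, ∑ k ∈ Finset.range E,
      rowCount lam f i k * ∑ i' ∈ Finset.range i, rowBelow lam f i' k := by
  rw [← sum_cells_rowCount hR hE]
  refine Finset.sum_congr rfl fun c _ => ?_
  exact card_filter_cells_lt c.1 fun d => f d.1 d.2 < f c.1 c.2

theorem strict_of_adjacent {mu : YoungDiagram} {j : ℕ}
    (h : ∀ i, (i + 1, j) ∈ lam → (i, j) ∉ mu → f i j < f (i + 1) j) {i₁ i₂ : ℕ} (hi : i₁ < i₂)
    (h2 : (i₂, j) ∈ lam) (h1 : (i₁, j) ∉ mu) : f i₁ j < f i₂ j := by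
  induction i₂, hi using Nat.le_induction with
  | base => exact h _ h2 h1
  | succ i hi ih =>
    refine (ih (lam.up_left_mem (Nat.le_succ i) le_rfl h2)).trans (h i h2 fun hm => h1 ?_)
    exact mu.up_left_mem (by omega) le_rfl hm

end

/-! ### Suffixes of sorted lists -/

/-- A property inherited by all later elements of a list cuts out a suffix; this supplies the
suffixes on which the Yamanouchi condition is tested. -/
theorem dropWhile_eq_filter {α : Type*} {r : α → α → Prop} {P : α → Prop} [DecidablePred P]
    (hP : ∀ p q, r p q → P p → P q) {L : List α} (hL : L.Pairwise r) :
    L.dropWhile (fun c => !decide (P c)) = L.filter P := by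
  induction L with
  | nil => rfl
  | cons p L ih =>
    rw [List.pairwise_cons] at hL
    by_cases hp : P p
    · rw [List.dropWhile_cons_of_neg (by simp [hp]), List.filter_cons_of_pos (by simp [hp]),
        List.filter_eq_self.2 fun q hq => by simpa using hP p q (hL.1 q hq) hp]
    · rw [List.dropWhile_cons_of_pos (by simp [hp]), List.filter_cons_of_neg (by simp [hp]), ih hL.2]

theorem rowWord_eq (lam mu : YoungDiagram) (f : ℕ → ℕ → ℕ) :
    rowWord lam mu f = ((rowCells lam).filter fun c => c ∉ mu).map fun c => f c.1 c.2 := by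
  simp [rowWord, rowCells, List.map_flatMap, List.filter_flatMap, List.filter_map,
    Function.comp_def]

section

variable {lam mu : YoungDiagram}

theorem SkewSSYT.row_weak_ext (S : SkewSSYT lam mu) {i j₁ j₂ : ℕ} (h : j₁ < j₂)
    (h2 : (i, j₂) ∈ lam) : S.entry i j₁ ≤ S.entry i j₂ := by
  by_cases h1 : (i, j₁) ∈ mu
  · rw [S.zeros (Or.inr h1)]; exact Nat.zero_le _
  · exact S.row_weak h h2 h1

theorem SkewSSYT.rowCount_zero (S : SkewSSYT lam mu) (i : ℕ) :
    rowCount lam S.entry i 0 = mu.rowLen i := by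
  have : (Finset.range (lam.rowLen i)).filter (fun j => S.entry i j = 0) =
      Finset.range (mu.rowLen i) := by
    ext j
    rw [Finset.mem_filter, Finset.mem_range, Finset.mem_range, ← YoungDiagram.mem_iff_lt_rowLen,
      ← YoungDiagram.mem_iff_lt_rowLen]
    constructor
    · rintro ⟨h1, h2⟩
      by_contra h
      exact (S.pos h1 h).ne' h2
    · exact fun h => ⟨S.sub h, S.zeros (Or.inr h)⟩
  rw [rowCount, this, Finset.card_range]

theorem card_skew_filter {f : ℕ → ℕ → ℕ} (hz : ∀ {i j}, (i, j) ∈ mu → f i j = 0) (k : ℕ) :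
    ((lam.cells \ mu.cells).filter fun c => f c.1 c.2 = k + 1) =
      lam.cells.filter fun c => f c.1 c.2 = k + 1 := by
  ext ⟨i, j⟩
  simp only [Finset.mem_filter, Finset.mem_sdiff, YoungDiagram.mem_cells]
  constructor
  · exact fun h => ⟨h.1.1, h.2⟩
  · refine fun h => ⟨⟨h.1, fun hm => ?_⟩, h.2⟩
    have := hz hm
    have := h.2
    omega

theorem sum_rowCount_eq_card (f : ℕ → ℕ → ℕ) (a k : ℕ) :
    ∑ i ∈ Finset.range a, rowCount lam f i k =
      (lam.cells.filter fun c => c.1 < a ∧ f c.1 c.2 = k).card :=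
  (card_filter_cells_lt a fun c => f c.1 c.2 = k).symm

/-- The Yamanouchi condition for tableaux in terms of row statistics. -/
theorem isYamanouchi_iff {f : ℕ → ℕ → ℕ} (hz : ∀ {i j}, (i, j) ∈ mu → f i j = 0)
    (hf : ∀ {i j₁ j₂}, j₁ < j₂ → (i, j₂) ∈ lam → f i j₁ ≤ f i j₂) :
    IsYamanouchi (rowWord lam mu f) ↔ ∀ a b,
      ∑ i ∈ Finset.range (a + 1), rowCount lam f i (b + 2) ≤
        ∑ i ∈ Finset.range a, rowCount lam f i (b + 1) := by
  have hpw := (pairwise_rowCells lam).filter fun c => decide (c ∉ mu)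
  have hnd := (nodup_rowCells lam).filter fun c => decide (c ∉ mu)
  have hmem : ∀ c, c ∈ (rowCells lam).filter (fun c => decide (c ∉ mu)) ↔ c ∈ lam ∧ c ∉ mu := by
    intro c; rw [List.mem_filter, mem_rowCells]; simp
  rw [rowWord_eq]
  set L := (rowCells lam).filter fun c => decide (c ∉ mu)
  have upper : ∀ {v : List (ℕ × ℕ)} {a e : ℕ}, v.Nodup → (∀ c ∈ v, c ∈ lam) →
      (∀ c ∈ v, f c.1 c.2 = e → c.1 < a) →
      (v.map fun c => f c.1 c.2).count e ≤ ∑ i ∈ Finset.range a, rowCount lam f i e := by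
    intro v a e hv h1 h2
    rw [count_map_of_nodup hv, sum_rowCount_eq_card]
    refine Finset.card_le_card fun c hc => ?_
    rw [Finset.mem_filter, List.mem_toFinset] at hc
    exact Finset.mem_filter.2 ⟨(YoungDiagram.mem_cells c).2 (h1 c hc.1), h2 c hc.1 hc.2, hc.2⟩
  have lower : ∀ {v : List (ℕ × ℕ)} {a e : ℕ}, v.Nodup →
      (∀ c ∈ lam, c.1 < a → f c.1 c.2 = e → c ∈ v) →
      ∑ i ∈ Finset.range a, rowCount lam f i e ≤ (v.map fun c => f c.1 c.2).count e := by
    intro v a e hv h1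
    rw [count_map_of_nodup hv, sum_rowCount_eq_card]
    refine Finset.card_le_card fun c hc => ?_
    rw [Finset.mem_filter, YoungDiagram.mem_cells] at hc
    exact Finset.mem_filter.2 ⟨List.mem_toFinset.2 (h1 c hc.1 hc.2.1 hc.2.2), hc.2.2⟩
  have hnot : ∀ {c : ℕ × ℕ} {k : ℕ}, f c.1 c.2 = k + 1 → c ∉ mu := fun h hm => by
    rw [hz hm] at h; omega
  constructor
  · intro h a b
    -- This suffix contains every letter b+2 of the rows up to a, but the letters b+1 only of the
    -- rows before a.
    set P : ℕ × ℕ → Prop := fun c => c.1 < a ∨ c.1 = a ∧ b + 2 ≤ f c.1 c.2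
    have hd : L.dropWhile (fun c => !decide (P c)) = L.filter P := by
      refine dropWhile_eq_filter (fun p q hr hp => ?_) (List.Pairwise.and_mem.1 hpw)
      obtain ⟨-, hq, hr⟩ := hr
      rcases hp with hp | ⟨hp, hp'⟩
      · exact Or.inl (by omega)
      · rcases hr with hr | ⟨hr, hr'⟩
        · exact Or.inl (by omega)
        · refine Or.inr ⟨hr.trans hp, hp'.trans ?_⟩
          rw [← hr]
          refine hf hr' ?_
          exact ((hmem q).1 hq).1
    have hsuf := (List.dropWhile_suffix (l := L) fun c => !decide (P c)).map fun c => f c.1 c.2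
    rw [hd] at hsuf
    refine (lower (hnd.filter _) fun c hc h1 h2 => ?_).trans
      ((h _ hsuf (b + 1) (b + 2) (by omega) (by omega)).trans
        (upper (hnd.filter _) (fun c hc => ?_) fun c hc h2 => ?_))
    · rw [List.mem_filter, hmem]
      exact ⟨⟨hc, hnot h2⟩, decide_eq_true (by change c.1 < a ∨ _; omega)⟩
    · exact ((hmem c).1 (List.mem_filter.1 hc).1).1
    · have h3 : c.1 < a ∨ c.1 = a ∧ b + 2 ≤ f c.1 c.2 := of_decide_eq_true (List.mem_filter.1 hc).2
      omega
  · intro h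
    have step : ∀ u : List ℕ, u <:+ (L.map fun c => f c.1 c.2) → ∀ b,
        u.count (b + 2) ≤ u.count (b + 1) := by
      intro u hu b
      rw [List.suffix_iff_eq_drop, ← List.map_drop] at hu
      obtain ⟨m, hu⟩ : ∃ m, u = (L.drop m).map fun c => f c.1 c.2 := ⟨_, hu⟩
      rw [hu]
      have hsplit := List.take_append_drop m L
      have hdnd : (L.drop m).Nodup := hnd.sublist (List.drop_sublist m L)
      have hdm : ∀ c ∈ L.drop m, c ∈ lam := fun c hc => ((hmem c).1 (List.mem_of_mem_drop hc)).1
      rw [← hsplit, List.pairwise_append] at hpw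
      cases hv : L.drop m with
      | nil => simp
      | cons p v =>
        rw [hv] at hdnd hdm hpw hsplit
        -- With p the first cell of the suffix, the suffix lies in the rows up to that of p and
        -- contains all skew cells of the rows above it.
        refine (upper hdnd hdm fun c hc _ => ?_).trans ((h p.1 b).trans
          (lower hdnd fun c hc h1 h2 => ?_))
        · rcases List.mem_cons.1 hc with rfl | hc
          · omega
          · have := (List.pairwise_cons.1 hpw.2.1).1 c hc
            omega
        · have hcL := (hmem c).2 ⟨hc, hnot h2⟩
          rw [← hsplit, List.mem_append] at hcL
          refine hcL.resolve_left fun ht => ?_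
          have := hpw.2.2 c ht p List.mem_cons_self
          omega
    intro u hu a b ha hab
    obtain ⟨a, rfl⟩ := Nat.exists_eq_succ_of_ne_zero ha.ne'
    induction b, hab using Nat.le_induction with
    | base => exact step u hu a
    | succ b hb ih =>
      obtain ⟨b, rfl⟩ := Nat.exists_eq_succ_of_ne_zero (show b ≠ 0 by omega)
      exact (step u hu b).trans ih

end

/-! ### Good tableaux in terms of row statistics -/

/-- Two ways to compare three interlacing sequences. -/
theorem interlacing_iff {p q r : ℕ → ℕ} {u v B : ℕ} (huv : u ≤ v) (hpq : ∀ b, p b ≤ q b)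
    (hqr : ∀ b, q b ≤ r b) (hqp : ∀ b, q (b + 1) ≤ p b) (hrq : ∀ b, r (b + 1) ≤ q b)
    (hB : r B = 0) :
    (∀ m, u + ∑ b ∈ Finset.range B, ((r b - m) - (q b - m)) ≤
        v + ∑ b ∈ Finset.range B, ((q b - m) - (p b - m))) ↔
      ∀ b, u + ∑ b' ∈ Finset.range (b + 1), (r b' - q b') ≤
        v + ∑ b' ∈ Finset.range b, (q b' - p b') := by
  have hqa : Antitone q := antitone_nat_of_succ_le fun b => (hqp b).trans (hpq b)
  have hr0 : ∀ b, B ≤ b → r b = 0 := by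
    intro b hb
    have := (antitone_nat_of_succ_le fun b => (hrq b).trans (hqr b) : Antitone r) hb
    omega
  constructor
  · intro h b
    -- The cut m = q b is the right one: the steps from q to r in rows up to b lie beyond it, while
    -- steps from p to q lie beyond it only in rows before b.
    have h1 : ∑ b' ∈ Finset.range (b + 1), (r b' - q b') ≤
        ∑ b' ∈ Finset.range B, ((r b' - q b) - (q b' - q b)) := by
      rw [Finset.sum_congr rfl fun b' hb' => show r b' - q b' = (r b' - q b) - (q b' - q b) by
        have := hqa (Nat.le_of_lt_succ (Finset.mem_range.1 hb'))
        omega]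
      refine Finset.sum_le_sum_of_ne_zero fun b' _ hne => Finset.mem_range.2 ?_
      by_contra hlt
      have := hr0 b' (not_lt.1 hlt)
      omega
    have h2 : ∑ b' ∈ Finset.range B, ((q b' - q b) - (p b' - q b)) ≤
        ∑ b' ∈ Finset.range b, (q b' - p b') := by
      rw [← Finset.sum_congr rfl fun b' hb' => show (q b' - q b) - (p b' - q b) = q b' - p b' by
        have := (hqa (show b' + 1 ≤ b from Finset.mem_range.1 hb')).trans (hqp b')
        have := hpq b'
        omega]
      refine Finset.sum_le_sum_of_ne_zero fun b' _ hne => Finset.mem_range.2 ?_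
      by_contra hlt
      have := hqa (not_lt.1 hlt)
      omega
    have := h (q b)
    omega
  · intro h m
    -- The level is the first b with q b ≤ m: earlier steps from q to r lie wholly beyond m, and
    -- later ones not at all.
    have hex : ∃ b, q b ≤ m := ⟨B, by have := hqr B; omega⟩
    obtain ⟨b, hb, hmin⟩ : ∃ b, q b ≤ m ∧ ∀ b' < b, m < q b' :=
      ⟨Nat.find hex, Nat.find_spec hex, fun b' hb' => not_le.1 (Nat.find_min hex hb')⟩
    have hbB : b ≤ B := by
      by_contra hlt
      have := hmin B (by omega)
      have := hqr B
      omega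
    have h1 : ∑ b' ∈ Finset.range B, ((r b' - m) - (q b' - m)) ≤
        ∑ b' ∈ Finset.range (b + 1), ((r b' - m) - (q b' - m)) := by
      refine Finset.sum_le_sum_of_ne_zero fun b' _ hne => Finset.mem_range.2 ?_
      by_contra hlt
      obtain ⟨c, rfl⟩ : ∃ c, b' = c + 1 := ⟨b' - 1, by omega⟩
      have := hrq c
      have := hqa (show b ≤ c by omega)
      omega
    have h2 : ∑ b' ∈ Finset.range b, ((r b' - m) - (q b' - m)) =
        ∑ b' ∈ Finset.range b, (r b' - q b') :=
      Finset.sum_congr rfl fun b' hb' => by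
        have := hmin b' (Finset.mem_range.1 hb')
        have := hqr b'
        omega
    have h3 : ∑ b' ∈ Finset.range b, ((q b' - m) - (p b' - m)) ≤
        ∑ b' ∈ Finset.range B, ((q b' - m) - (p b' - m)) :=
      Finset.sum_le_sum_of_subset (Finset.range_mono hbB)
    rw [Finset.sum_range_succ, h2] at h1
    have h4 := h b
    rw [Finset.sum_range_succ] at h4
    cases b with
    | zero =>
      simp only [Finset.range_zero, Finset.sum_empty] at *
      omega
    | succ b =>
      -- The cut can divide the step from p to q in row b. If m ≤ p b, the inequality at level b+1
      -- suffices; otherwise the one at level b does, together with r (b+1) ≤ q b.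
      have h5 := h b
      have h6 : ∑ b' ∈ Finset.range b, ((q b' - m) - (p b' - m)) =
          ∑ b' ∈ Finset.range b, (q b' - p b') :=
        Finset.sum_congr rfl fun b' hb' => by
          have := hmin (b' + 1) (by have := Finset.mem_range.1 hb'; omega)
          have := hqp b'
          omega
      rw [Finset.sum_range_succ, h6] at h3
      rw [Finset.sum_range_succ (fun b' => q b' - p b')] at h4
      have := hmin b (Nat.lt_succ_self b)
      have := hpq b
      have := hqr (b + 1)
      have := hqp b
      omega

theorem sum_columns_eq_sum_rows {lam : YoungDiagram} {m : ℕ} (P : ℕ → ℕ → Prop)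
    [∀ i j, Decidable (P i j)] :
    ∑ j ∈ Finset.Ico m (lam.rowLen 0), ((Finset.range (lam.colLen j)).filter fun i => P i j).card =
      ∑ i ∈ Finset.range (lam.colLen 0),
        ((Finset.Ico m (lam.rowLen i)).filter fun j => P i j).card := by
  simp only [Finset.card_filter]
  refine Finset.sum_comm' fun j i => ?_
  rw [Finset.mem_Ico, Finset.mem_Ico, Finset.mem_range, Finset.mem_range,
    ← YoungDiagram.mem_iff_lt_rowLen, ← YoungDiagram.mem_iff_lt_colLen,
    ← YoungDiagram.mem_iff_lt_rowLen, ← YoungDiagram.mem_iff_lt_colLen]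
  exact ⟨fun h => ⟨⟨h.1.1, h.2⟩, lam.up_left_mem le_rfl (Nat.zero_le _) h.2⟩,
    fun h => ⟨⟨h.1.1, lam.up_left_mem (Nat.zero_le _) le_rfl h.1.2⟩, h.1.2⟩⟩

theorem card_filter_Ico_eq {lam : YoungDiagram} {f : ℕ → ℕ → ℕ} {i m a : ℕ}
    (hf : ∀ {j₁ j₂}, j₁ < j₂ → (i, j₂) ∈ lam → f i j₁ ≤ f i j₂) :
    ((Finset.Ico m (lam.rowLen i)).filter fun j => f i j = a).card =
      (rowBelow lam f i (a + 1) - m) - (rowBelow lam f i a - m) := by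
  have h : (Finset.Ico m (lam.rowLen i)).filter (fun j => f i j = a) =
      Finset.Ico (max m (rowBelow lam f i a)) (rowBelow lam f i (a + 1)) := by
    ext j
    rw [Finset.mem_filter, Finset.mem_Ico, Finset.mem_Ico]
    constructor
    · rintro ⟨⟨h1, h2⟩, h3⟩
      have hj := YoungDiagram.mem_iff_lt_rowLen.2 h2
      refine ⟨max_le h1 (not_lt.1 fun h => ?_), (lt_rowBelow_iff hf hj).2 (by omega)⟩
      have := (lt_rowBelow_iff hf hj).1 h
      omega
    · rintro ⟨h1, h2⟩
      have h3 := h2.trans_le (rowBelow_le i (a + 1))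
      have hj := YoungDiagram.mem_iff_lt_rowLen.2 h3
      have h4 := (lt_rowBelow_iff hf hj).1 h2
      have h5 := mt (lt_rowBelow_iff hf hj).2 (not_lt.2 ((le_max_right _ _).trans h1))
      exact ⟨⟨(le_max_left _ _).trans h1, h3⟩, by omega⟩
  rw [h, Nat.card_Ico]
  omega

/-- Strictness down the columns in terms of row statistics. -/
theorem rowBelow_succ_le {lam : YoungDiagram} {f : ℕ → ℕ → ℕ} {i k m : ℕ}
    (hf : ∀ {i j₁ j₂}, j₁ < j₂ → (i, j₂) ∈ lam → f i j₁ ≤ f i j₂)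
    (hm : m ≤ rowBelow lam f i k)
    (hs : ∀ j, m ≤ j → (i + 1, j) ∈ lam → f i j < f (i + 1) j) :
    rowBelow lam f (i + 1) (k + 1) ≤ rowBelow lam f i k := by
  by_contra hlt
  rw [not_le] at hlt
  have hj := YoungDiagram.mem_iff_lt_rowLen.2 (hlt.trans_le (rowBelow_le (i + 1) (k + 1)))
  have h1 := (lt_rowBelow_iff hf hj).1 hlt
  have h2 := hs _ hm hj
  exact lt_irrefl _ ((lt_rowBelow_iff hf (lam.up_left_mem (Nat.le_succ i) le_rfl hj)).2
    (show f i (rowBelow lam f i k) < k by omega))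

theorem lt_of_rowBelow_succ_le {lam : YoungDiagram} {f : ℕ → ℕ → ℕ} {i j : ℕ}
    (hf : ∀ {i j₁ j₂}, j₁ < j₂ → (i, j₂) ∈ lam → f i j₁ ≤ f i j₂) (hj : (i + 1, j) ∈ lam)
    (h : rowBelow lam f (i + 1) (f (i + 1) j + 1) ≤ rowBelow lam f i (f (i + 1) j)) :
    f i j < f (i + 1) j :=
  (lt_rowBelow_iff hf (lam.up_left_mem (Nat.le_succ i) le_rfl hj)).1
    (((lt_rowBelow_iff hf hj).2 (Nat.lt_succ_self _)).trans_le h)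

namespace OPol

variable {n : ℕ}

theorem count_chainWord_take {nu : YoungDiagram} (T : BoundedSSYT nu n) (k a : ℕ) :
    (chainWord ((colList nu (T.1 · ·)).take k)).count a =
      ∑ j ∈ Finset.Ico (nu.rowLen 0 - k) (nu.rowLen 0),
        ((Finset.range (nu.colLen j)).filter fun i => T.1 i j = a).card := by
  have hr : ((List.range (nu.rowLen 0)).reverse.take k).reverse =
      List.range' (nu.rowLen 0 - k) (nu.rowLen 0 - (nu.rowLen 0 - k)) := by
    rw [List.take_reverse, List.reverse_reverse, List.length_range, List.range_eq_range',
      List.drop_range']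
    simp
  have ht : (List.range' (nu.rowLen 0 - k) (nu.rowLen 0 - (nu.rowLen 0 - k))).toFinset =
      Finset.Ico (nu.rowLen 0 - k) (nu.rowLen 0) := by
    ext j; simp [List.mem_range'_1]
  rw [colList, ← List.map_take, chainWord_map, hr, List.count_flatMap, ← ht,
    List.sum_toFinset _ List.nodup_range']
  congr 1
  refine List.map_congr_left fun j _ => ?_
  rw [Function.comp_apply, colWord_image fun a b h hb => T.1.col_strict h
      (YoungDiagram.mem_iff_lt_colLen.2 hb),
    count_map_of_nodup (List.nodup_reverse.2 List.nodup_range), List.toFinset_reverse,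
    List.toFinset_range]

theorem rowBelow_succ_le_tableau {nu : YoungDiagram} (T : SemistandardYoungTableau nu) (b a : ℕ) :
    rowBelow nu (T · ·) (b + 1) (a + 1) ≤ rowBelow nu (T · ·) b a :=
  rowBelow_succ_le (m := 0) (fun h hm => T.row_weak h hm) (Nat.zero_le _)
    fun _ _ hj => T.col_strict (Nat.lt_succ_self b) hj

theorem rowCount_eq_sub {lam : YoungDiagram} {f : ℕ → ℕ → ℕ} (i k : ℕ) :
    rowCount lam f i k = rowBelow lam f i (k + 1) - rowBelow lam f i k := by
  rw [rowBelow_succ]; omega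

/-- The condition on `T` in terms of its row statistics. -/
theorem isGood_iff {mu nu : YoungDiagram} (T : BoundedSSYT nu n) : IsGood mu T ↔
    ∀ a, a + 1 < n → ∀ b,
      mu.rowLen (a + 1) + ∑ b' ∈ Finset.range (b + 1), rowCount nu (T.1 · ·) b' (a + 1) ≤
        mu.rowLen a + ∑ b' ∈ Finset.range b, rowCount nu (T.1 · ·) b' a := by
  have hf : ∀ {i j₁ j₂}, j₁ < j₂ → (i, j₂) ∈ nu → T.1 i j₁ ≤ T.1 i j₂ :=
    fun h hm => T.1.row_weak h hm
  have hcount : ∀ k a, (chainWord ((colList nu (T.1 · ·)).take k) ++ shiftedWord mu n).count a =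
      ∑ b ∈ Finset.range (nu.colLen 0), ((rowBelow nu (T.1 · ·) b (a + 1) - (nu.rowLen 0 - k)) -
        (rowBelow nu (T.1 · ·) b a - (nu.rowLen 0 - k))) + (mu.rowLen a + (n - 1 - a)) := by
    intro k a
    rw [List.count_append, count_shiftedWord, count_chainWord_take,
      sum_columns_eq_sum_rows fun i j => T.1 i j = a]
    congr 1
    exact Finset.sum_congr rfl fun b _ => card_filter_Ico_eq (f := (T.1 · ·)) hf
  have hzero : ∀ a, rowBelow nu (T.1 · ·) (nu.colLen 0) a = 0 := by
    intro a
    have := rowBelow_le (lam := nu) (f := (T.1 · ·)) (nu.colLen 0) a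
    rw [rowLen_eq_zero le_rfl le_rfl] at this
    omega
  -- Here p, q, r count the entries of row b of T below a, a+1 and a+2. Goodness tests all cuts
  -- between columns, and the interlacing argument replaces them by cuts between rows.
  have key : ∀ a, _ := fun a => interlacing_iff (u := mu.rowLen (a + 1)) (v := mu.rowLen a)
    (mu.rowLen_anti a (a + 1) (Nat.le_succ a))
    (fun b => rowBelow_mono (lam := nu) (f := (T.1 · ·)) b (Nat.le_add_right a 1))
    (fun b => rowBelow_mono (lam := nu) (f := (T.1 · ·)) b (Nat.le_add_right (a + 1) 1))
    (fun b => rowBelow_succ_le_tableau T.1 b a)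
    (fun b => rowBelow_succ_le_tableau T.1 b (a + 1)) (hzero _)
  simp only [rowCount_eq_sub]
  constructor
  · intro h a ha
    refine (key a).1 fun m => ?_
    rcases le_or_gt m (nu.rowLen 0) with hm | hm
    · have h1 := h (nu.rowLen 0 - m) a ha
      rw [hcount, hcount, Nat.sub_sub_self hm] at h1
      omega
    -- A cut beyond the first row leaves no boxes and reduces to μ being a partition.
    · have hbig : ∀ b k, rowBelow nu (T.1 · ·) b k - m = 0 := fun b k => by
        have := rowBelow_le (lam := nu) (f := (T.1 · ·)) b k
        have := nu.rowLen_anti 0 b (Nat.zero_le b)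
        omega
      simp only [hbig, Nat.sub_self, Finset.sum_const_zero, add_zero]
      exact mu.rowLen_anti a (a + 1) (Nat.le_succ a)
  · intro h k a ha
    have h1 := (key a).2 (h a ha) (nu.rowLen 0 - k)
    rw [hcount, hcount]
    omega

end OPol

/-! ### Companion tableaux -/

namespace OPol

variable {n : ℕ} {lam mu nu : YoungDiagram}

/-- The entries of `S` in row `a` correspond to the entries `a` of `T`: row `a` of `S` has as many
letters `b + 1` as row `b` of `T` has letters `a`. -/
def Companion (T : BoundedSSYT nu n) (S : LRTableau lam mu nu) : Prop :=
  ∀ a b, rowCount lam S.1.entry a (b + 1) = rowCount nu (T.1 · ·) b a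

/-- The letter 0 occupies exactly μ, which supplies the term μ_a and shifts the letters of S by one
against the row indices of T. -/
theorem rowBelow_entry (S : SkewSSYT lam mu) (a b : ℕ) : rowBelow lam S.entry a (b + 1) =
    mu.rowLen a + ∑ b' ∈ Finset.range b, rowCount lam S.entry a (b' + 1) := by
  rw [rowBelow_eq_sum, Finset.sum_range_succ', S.rowCount_zero, add_comm]

theorem Companion.left_unique {T T' : BoundedSSYT nu n} {S : LRTableau lam mu nu}
    (h : Companion T S) (h' : Companion T' S) : T = T' := by
  refine Subtype.ext (SemistandardYoungTableau.ext fun i j => ?_)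
  by_cases hj : (i, j) ∈ nu
  · refine eq_of_rowBelow_eq (f := (T.1 · ·)) (g := (T'.1 · ·)) (fun h hm => T.1.row_weak h hm)
      (fun h hm => T'.1.row_weak h hm) (fun k => ?_) hj
    rw [rowBelow_eq_sum, rowBelow_eq_sum]
    exact Finset.sum_congr rfl fun a _ => (h a i).symm.trans (h' a i)
  · rw [T.1.zeros hj, T'.1.zeros hj]

theorem SkewSSYT.entry_injective {S S' : SkewSSYT lam mu} (h : S.entry = S'.entry) : S = S' := by
  cases S; cases S'; cases h; rfl

theorem Companion.right_unique {T : BoundedSSYT nu n} {S S' : LRTableau lam mu nu}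
    (h : Companion T S) (h' : Companion T S') : S = S' := by
  refine Subtype.ext (SkewSSYT.entry_injective (funext fun i => funext fun j => ?_))
  by_cases hj : (i, j) ∈ lam
  · refine eq_of_rowBelow_eq (fun h hm => S.1.row_weak_ext h hm)
      (fun h hm => S'.1.row_weak_ext h hm) (fun k => ?_) hj
    cases k with
    | zero => rw [rowBelow_zero, rowBelow_zero]
    | succ k =>
      rw [rowBelow_entry, rowBelow_entry]
      congr 1
      exact Finset.sum_congr rfl fun b _ => (h i b).trans (h' i b).symm
  · rw [S.1.zeros (Or.inl hj), S'.1.zeros (Or.inl hj)]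

theorem count_rowReading (T : BoundedSSYT nu n) {R : ℕ} (hR : nu.colLen 0 ≤ R) (a : ℕ) :
    (rowReading T).count a = ∑ b ∈ Finset.range R, rowCount nu (T.1 · ·) b a := by
  rw [rowReading, count_map_of_nodup (nodup_rowCells nu), toFinset_rowCells]
  exact card_filter_cells_eq (f := (T.1 · ·)) hR a

/-- The row statistics of S are prescribed by T and realized by `exists_filling`. The rows of T have
lengths ν, giving the content of S, and the content of T added to μ gives the shape λ. -/
theorem exists_companion_right (hmu : mu.colLen 0 ≤ n) (hlam : lam.colLen 0 ≤ n)
    (T : BoundedSSYT nu n) (hT : IsGood mu T) (hs : prodShape mu T = lam) :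
    ∃ S : LRTableau lam mu nu, Companion T S := by
  have hlen : ∀ a, lam.rowLen a =
      mu.rowLen a + ∑ b ∈ Finset.range (nu.colLen 0), rowCount nu (T.1 · ·) b a := fun a => by
    rw [← hs, rowLen_prodShape hmu hT, count_rowReading T le_rfl]
  have hzero : ∀ a b, nu.colLen 0 ≤ b → rowCount nu (T.1 · ·) b a = 0 := fun a b hb => by
    rw [rowCount, rowLen_eq_zero le_rfl hb]; rfl
  -- F a k is to be the number of entries below k in row a of S: none for k = 0, then μ_a zeros and
  -- the letters transposed from T.
  set F : ℕ → ℕ → ℕ := fun a k => Nat.casesOn k 0 fun b =>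
    mu.rowLen a + ∑ b' ∈ Finset.range b, rowCount nu (T.1 · ·) b' a with hF
  have hF0 : ∀ a, F a 0 = 0 := fun a => rfl
  have hFs : ∀ a b, F a (b + 1) =
      mu.rowLen a + ∑ b' ∈ Finset.range b, rowCount nu (T.1 · ·) b' a := fun a b => rfl
  have hFmono : ∀ a, Monotone (F a) := fun a => monotone_nat_of_le_succ fun k => by
    cases k with
    | zero => exact Nat.zero_le _
    | succ k => rw [hFs, hFs, Finset.sum_range_succ]; omega
  have hFle : ∀ a k, F a k ≤ lam.rowLen a := fun a k => by
    cases k with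
    | zero => exact Nat.zero_le _
    | succ k =>
      rw [hFs, hlen]
      refine Nat.add_le_add_left (Finset.sum_le_sum_of_ne_zero fun b _ hne => ?_) _
      rw [Finset.mem_range]
      by_contra hb
      exact hne (hzero a b (not_lt.1 hb))
  obtain ⟨f, hf0, hfw, hfF⟩ := exists_filling lam hFmono hF0 hFle
    fun a => ⟨nu.colLen 0 + 1, by rw [hFs, hlen]⟩
  have hcount : ∀ a b, rowCount lam f a (b + 1) = rowCount nu (T.1 · ·) b a := fun a b => by
    rw [rowCount_eq_sub, hfF, hfF, hFs, hFs, Finset.sum_range_succ]; omega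
  have hsub : mu ≤ lam := by
    rintro ⟨i, j⟩ h
    exact YoungDiagram.mem_iff_lt_rowLen.2 ((YoungDiagram.mem_iff_lt_rowLen.1 h).trans_le
      (by rw [hlen]; exact Nat.le_add_right _ _))
  have hpos : ∀ {i j}, (i, j) ∈ lam → (0 < f i j ↔ (i, j) ∉ mu) := fun {i j} h => by
    rw [← not_iff_not, not_not, not_lt, Nat.le_zero, ← Nat.lt_one_iff, ← lt_rowBelow_iff (hfw) h, hfF,
      YoungDiagram.mem_iff_lt_rowLen]
    exact Iff.rfl
  have hmu0 : ∀ {i j}, (i, j) ∈ mu → f i j = 0 := fun h => by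
    by_contra hne
    exact (hpos (hsub h)).1 (Nat.pos_of_ne_zero hne) h
  -- Goodness of T, in its row form, is column strictness of S; rows from n on are empty.
  have hcond : ∀ i k, rowBelow lam f (i + 1) (k + 2) ≤ rowBelow lam f i (k + 1) := by
    intro i k
    rw [hfF, hfF]
    rcases lt_or_ge (i + 1) n with hi | hi
    · exact (isGood_iff T).1 hT i hi k
    · have := hFle (i + 1) (k + 2)
      rw [rowLen_eq_zero hlam hi] at this
      omega
  have hcontent : ∀ k, ∑ i ∈ Finset.range n, rowCount lam f i (k + 1) = nu.rowLen k := fun k => by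
    rw [Finset.sum_congr rfl fun i _ => hcount i k, ← rowBelow_eq_sum]
    exact rowBelow_eq_rowLen fun j hj => T.2 k j hj
  refine ⟨⟨⟨f, hsub, fun h h' => (hpos h).2 h', fun h => h.elim hf0 hmu0,
    fun h h2 _ => hfw h h2, fun hi h2 h1 => strict_of_adjacent (fun i hi h1 => ?_) hi h2 h1⟩,
    fun k => ?_, (isYamanouchi_iff hmu0 hfw).2 fun a b => ?_⟩, hcount⟩
  · obtain ⟨k, hk⟩ := Nat.exists_eq_succ_of_ne_zero
      ((hpos hi).2 fun hm => h1 (mu.up_left_mem (Nat.le_succ i) le_rfl hm)).ne'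
    refine lt_of_rowBelow_succ_le hfw hi ?_
    rw [hk]
    exact hcond i k
  · rw [card_skew_filter hmu0, card_filter_cells_eq hlam, hcontent]
  -- The Yamanouchi inequality for S is column strictness of T.
  · rw [Finset.sum_congr rfl fun i _ => hcount i b, Finset.sum_congr rfl fun i _ => hcount i (b + 1),
      ← rowBelow_eq_sum, ← rowBelow_eq_sum]
    exact rowBelow_succ_le_tableau T.1 b a

theorem entry_le (S : LRTableau lam mu nu) {i j : ℕ} (hj : (i, j) ∈ lam) :
    S.1.entry i j ≤ nu.colLen 0 := by
  by_contra hlt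
  obtain ⟨k, hk⟩ := Nat.exists_eq_succ_of_ne_zero (show S.1.entry i j ≠ 0 by omega)
  have h1 := S.2.1 k
  rw [rowLen_eq_zero (n := nu.colLen 0) le_rfl (by omega), Finset.card_eq_zero] at h1
  have h2 : (i, j) ∉ mu := fun hm => by rw [S.1.zeros (Or.inr hm)] at hk; omega
  have : (i, j) ∈ (∅ : Finset (ℕ × ℕ)) := by
    rw [← h1, Finset.mem_filter, Finset.mem_sdiff]
    exact ⟨⟨hj, h2⟩, hk⟩
  simp at this

/-- The same dictionary read backwards: the Yamanouchi condition makes T column strict, and column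
strictness of S makes T good. -/
theorem exists_companion_left (hmu : mu.colLen 0 ≤ n) (hlam : lam.colLen 0 ≤ n)
    (S : LRTableau lam mu nu) :
    ∃ T : BoundedSSYT nu n, IsGood mu T ∧ prodShape mu T = lam ∧ Companion T S := by
  obtain ⟨S, hS, hY'⟩ := S
  have hw : ∀ {i j₁ j₂}, j₁ < j₂ → (i, j₂) ∈ lam → S.entry i j₁ ≤ S.entry i j₂ :=
    fun h hm => S.row_weak_ext h hm
  have hY := (isYamanouchi_iff (fun h => S.zeros (Or.inr h)) hw).1 hY'
  have hcontent : ∀ b, ∑ a ∈ Finset.range n, rowCount lam S.entry a (b + 1) = nu.rowLen b := by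
    intro b
    rw [← hS b, card_skew_filter (fun h => S.zeros (Or.inr h)), card_filter_cells_eq hlam]
  have hzero : ∀ a b, n ≤ a → rowCount lam S.entry a b = 0 := fun a b ha => by
    rw [rowCount, rowLen_eq_zero hlam ha]; rfl
  set F : ℕ → ℕ → ℕ := fun b k => ∑ a ∈ Finset.range k, rowCount lam S.entry a (b + 1) with hF
  obtain ⟨f, hf0, hfw, hfF⟩ := exists_filling nu (F := F)
    (fun b => monotone_nat_of_le_succ fun k => by
      simp only [hF]; rw [Finset.sum_range_succ]; omega) (fun b => rfl) (fun b k => by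
      rw [← hcontent b]
      refine Finset.sum_le_sum_of_ne_zero fun a _ hne => Finset.mem_range.2 ?_
      by_contra ha
      exact hne (hzero a _ (not_lt.1 ha)))
    fun b => ⟨n, hcontent b⟩
  have hcount : ∀ a b, rowCount lam S.entry a (b + 1) = rowCount nu f b a := fun a b => by
    rw [rowCount_eq_sub (lam := nu), hfF, hfF]
    simp only [hF]
    rw [Finset.sum_range_succ]; omega
  have hstrict : ∀ {i₁ i₂ j}, i₁ < i₂ → (i₂, j) ∈ nu → f i₁ j < f i₂ j := fun {i₁ i₂ j} hi h2 =>
    strict_of_adjacent (f := f) (mu := ⊥) (fun i hi _ => lt_of_rowBelow_succ_le hfw hi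
      (by rw [hfF, hfF]; exact hY (f (i + 1) j) i)) hi h2 (YoungDiagram.notMem_bot _)
  set T : BoundedSSYT nu n := ⟨⟨f, hfw, hstrict, hf0⟩, fun i j hj => by
    refine (lt_rowBelow_iff hfw hj).1 ?_
    rw [hfF]
    exact (YoungDiagram.mem_iff_lt_rowLen.1 hj).trans_le (hcontent i).ge⟩ with hTdef
  have hTf : (fun i j => T.1 i j) = f := rfl
  have hgood : IsGood mu T := by
    rw [isGood_iff]
    intro a ha b
    rw [hTf, ← Finset.sum_congr rfl fun b _ => hcount (a + 1) b,
      ← Finset.sum_congr rfl fun b _ => hcount a b, ← rowBelow_entry, ← rowBelow_entry]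
    -- Below a box of μ, the tableau S satisfies no strictness condition, so the comparison starts
    -- at column μ_a.
    refine rowBelow_succ_le (m := mu.rowLen a) hw (by rw [rowBelow_entry]; omega) fun j hj h => ?_
    exact S.col_strict (Nat.lt_succ_self a) h
      fun hm => absurd (YoungDiagram.mem_iff_lt_rowLen.1 hm) (not_lt.2 hj)
  refine ⟨T, hgood, eq_of_rowLen_eq fun a => ?_, hcount⟩
  rw [rowLen_prodShape hmu hgood, count_rowReading T le_rfl, hTf,
    ← Finset.sum_congr rfl fun b _ => hcount a b, ← rowBelow_entry]
  exact rowBelow_eq_rowLen fun j hj => Nat.lt_succ_of_le (entry_le ⟨S, hS, hY'⟩ hj)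

/-- Let t_{b,a} be the number of letters a in row b of T. Both sides contain the sum of t_{b,a}
t_{b',a'} over b' < b and a' < a, which is symmetric under transposition. Inversions of T against μ
match the pairs of S whose smaller entry is a 0, and the inversions within μ give N(μ). -/
theorem inversions_companion (hlam : lam.colLen 0 ≤ n) {T : BoundedSSYT nu n}
    {S : LRTableau lam mu nu} (h : Companion T S) :
    inversions (rowReading T ++ (rowCells mu).map Prod.fst) =
      boxN mu + boxNLess lam S.1.entry := by
  have hcross : ((rowReading T).map fun a => ((rowCells mu).map Prod.fst).countP (· < a)).sum =
      ∑ b ∈ Finset.range (nu.colLen 0), ∑ a ∈ Finset.range n, rowCount nu (T.1 · ·) b a *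
        ∑ a' ∈ Finset.range a, mu.rowLen a' := by
    have hc : ∀ a, ((rowCells mu).map Prod.fst).countP (· < a) =
        ∑ a' ∈ Finset.range a, mu.rowLen a' := by
      intro a
      have := card_filter_cells_lt (lam := mu) a fun _ => True
      simp only [and_true, Finset.filter_true, Finset.card_range] at this
      rw [← this, List.countP_map, List.countP_eq_length_filter,
        ← List.toFinset_card_of_nodup ((nodup_rowCells mu).filter _), List.toFinset_filter,
        toFinset_rowCells]
      simp
    simp only [hc]
    rw [rowReading, List.map_map, sum_map_rowCells]
    exact sum_cells_rowCount (f := (T.1 · ·)) le_rfl (fun i j hj => T.2 i j hj)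
      fun _ a => ∑ a' ∈ Finset.range a, mu.rowLen a'
  have hE : ∀ i j, (i, j) ∈ lam → S.1.entry i j < nu.colLen 0 + 1 :=
    fun i j hj => Nat.lt_succ_of_le (entry_le S hj)
  rw [inversions_append, inversions_rowReading, inversions_rowCells_fst, hcross,
    boxNLess_eq_sum (f := (T.1 · ·)) le_rfl (fun i j hj => T.2 i j hj), boxNLess_eq_sum hlam hE]
  have hR : ∀ i, ∑ k ∈ Finset.range (nu.colLen 0 + 1), rowCount lam S.1.entry i k *
      ∑ i' ∈ Finset.range i, rowBelow lam S.1.entry i' k =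
      ∑ b ∈ Finset.range (nu.colLen 0), rowCount nu (T.1 · ·) b i *
        ∑ i' ∈ Finset.range i,
          (mu.rowLen i' + ∑ b' ∈ Finset.range b, rowCount nu (T.1 · ·) b' i') := by
    intro i
    rw [Finset.sum_range_succ']
    simp only [rowBelow_zero, Finset.sum_const_zero, mul_zero, add_zero, rowBelow_entry, h _ _]
  rw [Finset.sum_congr rfl fun i _ => hR i,
    Finset.sum_comm (s := Finset.range n)]
  simp only [Finset.sum_add_distrib, mul_add, rowBelow_eq_sum]
  rw [add_comm _ (boxN mu), add_assoc, add_comm (Finset.sum _ _) (Finset.sum _ _)]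
  congr 2
  refine Finset.sum_congr rfl fun b _ => Finset.sum_congr rfl fun a _ => ?_
  rw [Finset.sum_comm]

end OPol

/-! ### The odd Littlewood–Richardson rule -/

/-- The odd Schur functions form a `ℤ`-basis of the ring of odd symmetric functions, and the
coefficient of `s_λ` in the expansion of `s_μ s_ν` in this basis is given by the odd
Littlewood-Richardson rule. -/
theorem mainTheorem2 :
    ∃ s : Module.Basis YoungDiagram ℤ OddSymm,
      (∀ (lam : YoungDiagram) (n : ℕ), (s lam : ∀ n : ℕ, OPol n) n = oddSchurPol lam n) ∧
      ∀ mu nu lam : YoungDiagram,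
        s.repr (s mu * s nu) lam =
          (-1) ^ (boxN mu + boxN lam) *
            ∑ S : LRTableau lam mu nu, (-1 : ℤ) ^ boxNLess lam S.1.entry := by
  classical
  refine ⟨oddSchurBasis, fun lam n => by rw [oddSchurBasis_apply]; rfl, fun mu nu lam => ?_⟩
  obtain ⟨n, hn, h⟩ := repr_mul_eq_sum (mu := mu) (nu := nu) (lam := lam)
    (N := max (mu.colLen 0) (lam.colLen 0))
  have hmu : mu.colLen 0 ≤ n := (le_max_left _ _).trans hn
  have hlam : lam.colLen 0 ≤ n := (le_max_right _ _).trans hn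
  have hex : ∀ T ∈ (Finset.univ : Finset (BoundedSSYT nu n)).filter
      (fun T => IsGood mu T ∧ prodShape mu T = lam), ∃ S : LRTableau lam mu nu, Companion T S :=
    fun T hT => exists_companion_right hmu hlam T (Finset.mem_filter.1 hT).2.1
      (Finset.mem_filter.1 hT).2.2
  choose S hS using hex
  rw [h, Finset.mul_sum]
  refine Finset.sum_bij S (fun _ _ => Finset.mem_univ _) (fun T hT T' hT' e => ?_)
    (fun S' _ => ?_) fun T hT => ?_
  · exact (hS T hT).left_unique (e ▸ hS T' hT')
  · obtain ⟨T, h1, h2, h3⟩ := exists_companion_left hmu hlam S'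
    have hT : T ∈ (Finset.univ : Finset (BoundedSSYT nu n)).filter
        (fun T => IsGood mu T ∧ prodShape mu T = lam) :=
      Finset.mem_filter.2 ⟨Finset.mem_univ T, h1, h2⟩
    exact ⟨T, hT, (hS T hT).right_unique h3⟩
  · rw [inversions_companion hlam (hS T hT), ← pow_add]
    congr 1
    ring
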